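/- Let $\mu>0$, $2\mu+3\lambda>0$, $\omega>0$, $k_p=\omega/\sqrt{2\mu+\lambda}$, $k_s=\omega/\sqrt{\mu}$. Let $D\subset\mathbb R^3$ be a bounded open set with $C^2$ boundary and connected exterior $D^c:=\mathbb R^3\setminus\overline D$, and let $R>0$ with $\overline D\subset B_R=\{|x|<R\}$, $S_R=\partial B_R$. The solution operator $G:[H^{1/2}(\partial D)]^3\to[L^2(S_R)]^3$ maps $h$ to $v|_{S_R}$, where $v\in[H^1_{loc}(D^c)]^3$ solves $\mu\Delta v+(\lambda+\mu)\nabla(\nabla\cdot v)+\omega^2v=0$ in $D^c$ (smoothly, after choosing the smooth representative), $v=h$ on $\partial D$ in the sense of traces, and $v$ satisfies the Kupradze radiation condition: with $v_p=-k_p^{-2}\nabla(\nabla\cdot v)$ and $v_s=k_s^{-2}\nabla\times(\nabla\times v)$, $$\lim_{r=|x|\to\infty} r\,[\partial_r v_\alpha-ik_\alpha v_\alpha]=0,\qquad \alpha=p,s,$$ uniformly in all directions. Let $\{Y_n^m:\ n\ge0,\ -n\le m\le n\}$ be any orthonormal system of spherical harmonics on $\mathbb S^2$ ($Y_n^m$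 of order $n$), $\delta_n=n(n+1)$, and put $U_n^m=\delta_n^{-1/2}\nabla_{\mathbb S^2}Y_n^m$ (with $U_0^0=0$), $V_n^m=\hat x\times U_n^m$, $W_n^m=Y_n^m\,\hat x$, and let $M_n^m=(V_n^m,U_n^m,W_n^m)$ be the matrix with these columns. With the spherical Hankel functions $h_n=h_n^{(1)}$ let $$A_n(r)=\begin{pmatrix}h_n(k_sr)&0&0\\0&-\big(h_n(k_sr)+k_sr\,h_n'(k_sr)\big)/r&\sqrt{\delta_n}\,h_n(k_pr)/r\\0&-\sqrt{\delta_n}\,h_n(k_sr)/r&k_p\,h_n'(k_pr)\end{pmatrix}.$$ The outgoing-to-incoming (OtI) mapping $\mathcal T$ is defined as follows: if $\varphi=u|_{S_R}\in\mathrm{Range}(G)$ with $u$ a radiating solution as above, expanded as $$u(x)=\sum_{n=0}^\infty\sum_{m=-n}^nM_n^m(\hat x)A_n(|x|)\alpha_n^m,\qquad |x|\ge R,\quad \alpha_n^m\in\mathbb C^3,$$ then $$\mathcal T\varphi=\tilde u|_{S_R},\qquad \tilde u(x)=-\sum_{n=0}^\infty\sum_{m=-n}^nM_n^m(\hat x)\overline{A_n(|x|)}\,\alpha_n^m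 .$$ Here the expansion of $u$ is meant as convergence in $[L^2(S_r)]^3$ for every $r\ge R$, and that of $\tilde u|_{S_R}$ in $[L^2(S_R)]^3$. Then the matrices $A_n(R)$ are invertible for all $n\ge0$, the definition above determines a well-defined mapping $\mathcal T:\mathrm{Range}(G)\to[L^2(S_R)]^3$ (each $\varphi\in\mathrm{Range}(G)$ has exactly one image), and for every $\varphi\in\mathrm{Range}(G)$ $$(\mathcal T\varphi)(x)=-\frac1{R^2}\sum_{n=0}^\infty\sum_{m=-n}^nM_n^m(\hat x)\,\overline{A_n(R)}\,[A_n(R)]^{-1}\int_{S_R}\overline{M_n^m(\hat y)}^{\top}\varphi(y)\,ds(y),$$ where the series converges in $[L^2(S_R)]^3$. -/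

import Mathlib

open MeasureTheory Filter Topology
open scoped ContDiff Matrix

noncomputable section

namespace ElasticOtI

/-- Physical space `ℝ³`. -/
abbrev E3 : Type := EuclideanSpace ℝ (Fin 3)

/-- The values of displacement fields, `ℂ³` with its Hermitian norm. -/
abbrev C3 : Type := EuclideanSpace ℂ (Fin 3)

/-! ### Differential operators -/

/-- The partial derivative `∂_j f`. -/
def pd (j : Fin 3) (f : E3 → ℂ) (x : E3) : ℂ :=
  fderiv ℝ f x (EuclideanSpace.single j 1)

/-- The gradient of a complex scalar field. -/
def grad (f : E3 → ℂ) (x : E3) : C3 := WithLp.toLp 2 fun j => pd j f x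

/-- The divergence of a complex vector field. -/
def dvg (u : E3 → C3) (x : E3) : ℂ := ∑ j, pd j (fun y => u y j) x

/-- The curl of a complex vector field. -/
def curl (u : E3 → C3) (x : E3) : C3 :=
  !₂[pd 1 (fun y => u y 2) x - pd 2 (fun y => u y 1) x,
     pd 2 (fun y => u y 0) x - pd 0 (fun y => u y 2) x,
     pd 0 (fun y => u y 1) x - pd 1 (fun y => u y 0) x]

/-- The Lamé operator `Δ* u = μ Δ u + (λ + μ) ∇ (∇ · u)`; here `la` is `λ` and `mu` is `μ`. -/
def lame (la mu : ℝ) (u : E3 → C3) (x : E3) : C3 :=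
  mu • Laplacian.laplacian u x + (la + mu) • grad (dvg u) x

/-- The compressional wave number `k_p = ω / √(2μ + λ)`. -/
def kp (la mu om : ℝ) : ℝ := om / Real.sqrt (2 * mu + la)

/-- The shear wave number `k_s = ω / √μ`. -/
def ks (mu om : ℝ) : ℝ := om / Real.sqrt mu

/-- The compressional part `u_p = - k_p⁻² ∇ (∇ · u)`. -/
def pPart (la mu om : ℝ) (u : E3 → C3) (x : E3) : C3 :=
  -(((kp la mu om) ^ 2)⁻¹ • grad (dvg u) x)

/-- The shear part `u_s = k_s⁻² ∇ × (∇ × u)`, so that `u = u_p + u_s` for solutions of the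
Navier equation. -/
def sPart (mu om : ℝ) (u : E3 → C3) (x : E3) : C3 :=
  ((ks mu om) ^ 2)⁻¹ • curl (curl u) x

/-- The unit vector `x̂ = x / |x|`. -/
def unitVec (x : E3) : E3 := ‖x‖⁻¹ • x

/-- The Sommerfeld condition `r (∂u/∂r - i k u) → 0` as `r = |x| → ∞`, uniformly in all
directions. -/
def Sommerfeld (k : ℝ) (u : E3 → C3) : Prop :=
  Tendsto (fun x : E3 => ‖x‖ * ‖fderiv ℝ u x (unitVec x) - (Complex.I * (k : ℂ)) • u x‖)
    (Bornology.cobounded E3) (𝓝 0)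

/-- The Kupradze radiation condition. -/
def Kupradze (la mu om : ℝ) (u : E3 → C3) : Prop :=
  Sommerfeld (kp la mu om) (pPart la mu om u) ∧ Sommerfeld (ks mu om) (sPart mu om u)

/-! ### The obstacle, the boundary space and the solution operator -/

/-- A set with `C²` boundary: near each boundary point it is the sublevel set `{g < 0}` of a `C²`
function with nonzero differential at that point. -/
def HasC2Boundary (D : Set E3) : Prop :=
  ∀ x ∈ frontier D, ∃ U : Set E3, IsOpen U ∧ x ∈ U ∧ ∃ g : E3 → ℝ,
    ContDiffOn ℝ 2 g U ∧ fderiv ℝ g x ≠ 0 ∧ D ∩ U = {y ∈ U | g y < 0}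

/-- An obstacle inside `B_R`: open, with `C²` boundary, closure contained in `B_R`, and connected
exterior. -/
structure IsObstacle (D : Set E3) (R : ℝ) : Prop where
  isOpen : IsOpen D
  closure_subset : closure D ⊆ Metric.ball 0 R
  boundary : HasC2Boundary D
  exterior_connected : IsConnected (closure D)ᶜ

/-- The surface measure on `∂D`. -/
def bdMeasure (D : Set E3) : Measure E3 :=
  Measure.restrict (Measure.euclideanHausdorffMeasure 2) (frontier D)

/-- Membership in `[H^{1/2}(∂D)]³`: square integrable, with finite Sobolev–Slobodeckij seminorm
(`∂D` is two-dimensional, so the kernel is `|x - y|⁻³`). -/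
def MemHHalf (D : Set E3) (h : E3 → C3) : Prop :=
  MemLp h 2 (bdMeasure D) ∧
    ∫⁻ x, ∫⁻ y, ‖h x - h y‖ₑ ^ 2 / ‖x - y‖ₑ ^ 3 ∂(bdMeasure D) ∂(bdMeasure D) < ⊤

/-- `v` (smooth in the exterior of `D`) belongs to `[H¹(D^c ∩ B_ρ)]³` for every `ρ`. -/
def MemHOneLoc (D : Set E3) (v : E3 → C3) : Prop :=
  ∀ ρ : ℝ, 0 < ρ →
    MemLp v 2 (volume.restrict ((closure D)ᶜ ∩ Metric.ball 0 ρ)) ∧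
    MemLp (fderiv ℝ v) 2 (volume.restrict ((closure D)ᶜ ∩ Metric.ball 0 ρ))

/-- `h` is the trace of `v` on `∂D`: there are functions smooth on all of space that converge to
`v` in `H¹(D^c ∩ B_R)` and whose restrictions to `∂D` converge to `h` in `L²(∂D)`. -/
def HasTrace (D : Set E3) (R : ℝ) (v h : E3 → C3) : Prop :=
  ∃ w : ℕ → E3 → C3, (∀ j, ContDiff ℝ ∞ (w j)) ∧
    Tendsto (fun j => eLpNorm (fun x => w j x - v x) 2
      (volume.restrict ((closure D)ᶜ ∩ Metric.ball 0 R))) atTop (𝓝 0) ∧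
    Tendsto (fun j => eLpNorm (fun x => fderiv ℝ (w j) x - fderiv ℝ v x) 2
      (volume.restrict ((closure D)ᶜ ∩ Metric.ball 0 R))) atTop (𝓝 0) ∧
    Tendsto (fun j => eLpNorm (fun x => w j x - h x) 2 (bdMeasure D)) atTop (𝓝 0)

/-- `v` is a radiating `H¹_loc` solution of the Navier equation in the exterior of `D` with
boundary value `h`. Solutions are represented by their smooth representative, on which the
radiation condition is read. -/
structure IsRadiatingSolution (la mu om : ℝ) (D : Set E3) (R : ℝ) (h v : E3 → C3) : Prop where
  smooth : ContDiffOn ℝ ∞ v (closure D)ᶜ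
  hOneLoc : MemHOneLoc D v
  navier : ∀ x ∈ (closure D)ᶜ, lame la mu v x + (om ^ 2) • v x = 0
  boundary_value : HasTrace D R v h
  radiation : Kupradze la mu om v

/-- The surface measure on the sphere `S_R`, as a measure on `ℝ³`: the push-forward of `R²` times
the surface measure of the unit sphere under `y ↦ R y`. -/
def sphereMeasure (R : ℝ) : Measure E3 :=
  ENNReal.ofReal (R ^ 2) •
    Measure.map (fun y : Metric.sphere (0 : E3) 1 => R • (y : E3)) (volume : Measure E3).toSphere

/-- The space `[L²(S_R)]³`. -/
abbrev L2S (R : ℝ) : Type := Lp C3 2 (sphereMeasure R)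

/-- The graph of the solution operator `G : [H^{1/2}(∂D)]³ → [L²(S_R)]³`, `h ↦ v|_{S_R}`, with the
solution `v` displayed. -/
def IsSolutionOn (la mu om : ℝ) (D : Set E3) (R : ℝ) (h v : E3 → C3) (φ : L2S R) : Prop :=
  MemHHalf D h ∧ IsRadiatingSolution la mu om D R h v ∧ φ =ᵐ[sphereMeasure R] v

/-- `Range(G)`. -/
def rangeG (la mu om : ℝ) (D : Set E3) (R : ℝ) : Set (L2S R) :=
  {φ | ∃ h v : E3 → C3, IsSolutionOn la mu om D R h v φ}

/-! ### Spherical harmonics and the matrices `M_n^m` and `A_n` -/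

/-- `f` restricted to the unit sphere is a spherical harmonic of order `n`: the restriction of a
homogeneous harmonic polynomial of degree `n`. -/
def IsSphericalHarmonic (n : ℕ) (f : E3 → ℂ) : Prop :=
  ∃ p : MvPolynomial (Fin 3) ℂ, p.IsHomogeneous n ∧
    ∑ i, MvPolynomial.pderiv i (MvPolynomial.pderiv i p) = 0 ∧
    ∀ x : E3, ‖x‖ = 1 → f x = MvPolynomial.eval (fun i => ((x i : ℝ) : ℂ)) p

/-- `Y n m`, `n ≥ 0`, `-n ≤ m ≤ n`, is an orthonormal sequence of spherical harmonics on the unit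
sphere, `Y n m` being of order `n`. Only the values on the unit sphere matter. -/
structure IsSphericalHarmonicSystem (Y : ℕ → ℤ → E3 → ℂ) : Prop where
  harmonic : ∀ (n : ℕ) (m : ℤ), m ∈ Finset.Icc (-(n : ℤ)) n → IsSphericalHarmonic n (Y n m)
  orthonormal : ∀ (n n' : ℕ) (m m' : ℤ),
    m ∈ Finset.Icc (-(n : ℤ)) n → m' ∈ Finset.Icc (-(n' : ℤ)) n' →
    ∫ x, Y n m x * (starRingEnd ℂ) (Y n' m' x) ∂(sphereMeasure 1)
      = if n = n' ∧ m = m' then 1 else 0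

/-- The number `√δ_n = √(n (n + 1))`. -/
def sqrtDelta (n : ℕ) : ℝ := Real.sqrt ((n : ℝ) * ((n : ℝ) + 1))

/-- The surface gradient on the unit sphere at a point `x` with `|x| = 1`: the gradient of the
extension of `f` that is homogeneous of degree `0`. -/
def surfGrad (f : E3 → ℂ) (x : E3) : Fin 3 → ℂ := fun j => pd j (fun y => f (unitVec y)) x

/-- `U_n^m = (√δ_n)⁻¹ ∇_{S²} Y_n^m`; it is `0` for `n = 0`. -/
def vshU (Y : ℕ → ℤ → E3 → ℂ) (n : ℕ) (m : ℤ) (x : E3) : Fin 3 → ℂ :=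
  ((sqrtDelta n : ℂ))⁻¹ • surfGrad (Y n m) x

/-- `V_n^m(x) = x × U_n^m(x)` for `|x| = 1`. -/
def vshV (Y : ℕ → ℤ → E3 → ℂ) (n : ℕ) (m : ℤ) (x : E3) : Fin 3 → ℂ :=
  (fun i => ((x i : ℝ) : ℂ)) ⨯₃ vshU Y n m x

/-- `W_n^m(x) = Y_n^m(x) x` for `|x| = 1`. -/
def vshW (Y : ℕ → ℤ → E3 → ℂ) (n : ℕ) (m : ℤ) (x : E3) : Fin 3 → ℂ :=
  fun i => Y n m x * ((x i : ℝ) : ℂ)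

/-- The matrix `M_n^m(x)` with columns `V_n^m(x)`, `U_n^m(x)`, `W_n^m(x)`, for `|x| = 1`. -/
def vshM (Y : ℕ → ℤ → E3 → ℂ) (n : ℕ) (m : ℤ) (x : E3) : Matrix (Fin 3) (Fin 3) ℂ :=
  Matrix.of fun i j => ![vshV Y n m x i, vshU Y n m x i, vshW Y n m x i] j

/-- The spherical Hankel function `h_n^{(1)}(t)` for `t > 0`, i.e.
`(-i)^{n+1} (e^{it} / t) ∑_{k ≤ n} (n+k)! / (k! (n-k)!) (i / (2t))^k`. -/
def hankel (n : ℕ) (t : ℝ) : ℂ :=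
  (-Complex.I) ^ (n + 1) * (Complex.exp (Complex.I * (t : ℂ)) / (t : ℂ)) *
    ∑ k ∈ Finset.range (n + 1),
      ((Nat.factorial (n + k) : ℂ) / ((Nat.factorial k : ℂ) * (Nat.factorial (n - k) : ℂ))) *
        (Complex.I / (2 * (t : ℂ))) ^ k

/-- The matrix `A_n(r)`. -/
def matA (la mu om : ℝ) (n : ℕ) (r : ℝ) : Matrix (Fin 3) (Fin 3) ℂ :=
  !![hankel n (ks mu om * r), 0, 0;
     0, -(hankel n (ks mu om * r)
          + ((ks mu om * r : ℝ) : ℂ) * deriv (hankel n) (ks mu om * r)) / (r : ℂ),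
        (sqrtDelta n : ℂ) * hankel n (kp la mu om * r) / (r : ℂ);
     0, -((sqrtDelta n : ℂ) * hankel n (ks mu om * r)) / (r : ℂ),
        (kp la mu om : ℂ) * deriv (hankel n) (kp la mu om * r)]

/-- The entrywise complex conjugate of a matrix. -/
def conjM (A : Matrix (Fin 3) (Fin 3) ℂ) : Matrix (Fin 3) (Fin 3) ℂ := A.map (starRingEnd ℂ)

/-- `∑_{n=0}^∞ f_n = ψ` in `[L²(S_r)]³`. -/
def HasL2Sum (r : ℝ) (f : ℕ → E3 → C3) (ψ : E3 → C3) : Prop :=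
  Tendsto (fun N : ℕ => eLpNorm (fun x => ψ x - ∑ n ∈ Finset.range N, f n x) 2 (sphereMeasure r))
    atTop (𝓝 0)

/-- The `n`-th term `∑_{m=-n}^n M_n^m(x̂) A_n(|x|) α_n^m` of an outgoing expansion. -/
def outTerm (la mu om : ℝ) (Y : ℕ → ℤ → E3 → ℂ) (α : ℕ → ℤ → Fin 3 → ℂ) (n : ℕ) (x : E3) : C3 :=
  WithLp.toLp 2 (∑ m ∈ Finset.Icc (-(n : ℤ)) n,
    vshM Y n m (unitVec x) *ᵥ (matA la mu om n ‖x‖ *ᵥ α n m))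

/-- The `n`-th term `- ∑_{m=-n}^n M_n^m(x̂) conj(A_n(|x|)) α_n^m` of the incoming expansion. -/
def inTerm (la mu om : ℝ) (Y : ℕ → ℤ → E3 → ℂ) (α : ℕ → ℤ → Fin 3 → ℂ) (n : ℕ) (x : E3) : C3 :=
  WithLp.toLp 2 (-∑ m ∈ Finset.Icc (-(n : ℤ)) n,
    vshM Y n m (unitVec x) *ᵥ (conjM (matA la mu om n ‖x‖) *ᵥ α n m))

/-- The defining relation `𝒯 φ = ψ` of the outgoing-to-incoming mapping: `φ` is the restriction
to `S_R` of a radiating solution `u` which has the outgoing expansion with coefficients `α` on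
every sphere `S_r`, `r ≥ R`, and `ψ` is the restriction to `S_R` of the incoming expansion with
the same coefficients. -/
def OtIGraph (la mu om : ℝ) (D : Set E3) (R : ℝ) (Y : ℕ → ℤ → E3 → ℂ) (φ ψ : L2S R) : Prop :=
  ∃ (h u : E3 → C3) (α : ℕ → ℤ → Fin 3 → ℂ), IsSolutionOn la mu om D R h u φ ∧
    (∀ r : ℝ, R ≤ r → HasL2Sum r (outTerm la mu om Y α) u) ∧
    HasL2Sum R (inTerm la mu om Y α) ψ

/-- The `n`-th term of the series representation,
`- R⁻² ∑_{m=-n}^n M_n^m(x̂) conj(A_n(R)) A_n(R)⁻¹ ∫_{S_R} conj(M_n^m(ŷ))ᵀ φ(y) ds(y)`. -/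
def otiTerm (la mu om R : ℝ) (Y : ℕ → ℤ → E3 → ℂ) (φ : E3 → C3) (n : ℕ) (x : E3) : C3 :=
  WithLp.toLp 2 (-((R : ℂ) ^ 2)⁻¹ • ∑ m ∈ Finset.Icc (-(n : ℤ)) n,
    vshM Y n m (unitVec x) *ᵥ ((conjM (matA la mu om n R) * (matA la mu om n R)⁻¹) *ᵥ
      ∫ y, (vshM Y n m (unitVec y))ᴴ *ᵥ (φ y).ofLp ∂(sphereMeasure R)))

end ElasticOtI

end

open scoped ComplexConjugate Pointwise

/-! Two facts carry the theorem. The nonzero vector spherical harmonics form a Hilbert basis of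
square integrable fields on the unit sphere (`vshBasis`), and on every sphere of radius r around the
obstacle the coefficient vector of a radiating field is A_n(r) α with α independent of r
(`IsDecomposition.exists_expansion`). Since A_n(R) is invertible, α can be recovered from φ, and
-conj(A_n(R)) α becomes -conj(A_n(R)) A_n(R)⁻¹ applied to the coefficients of φ. Hence every image
of φ is the sum of a series that depends on φ alone, which gives both the formula and uniqueness
(`OtIGraph.hasL2Sum`, `eq_of_hasL2Sum_otiTerm`). For n = 0 only the W component is visible; this
does no harm because A_0 is diagonal.

The coefficients are found by splitting u = ∇f + w, with f a multiple of div u and w a multiple of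
curl curl u. The pairing of a scalar Helmholtz field with a harmonic polynomial solves the spherical
Bessel equation (`isBessel_coef`), and the radiation condition excludes conj(h_n)
(`IsBessel.eq_hankelS`). This is applied to the components of w, to x · w and to f. The Kupradze
condition only speaks of w and ∇f; that f and x · w have outgoing coefficients is extracted by
suitable pairings (`exists_coef_eq_of_grad`, `exists_coef_xdot_eq`).

Totality of the basis is algebraic: polynomials are dense by Stone–Weierstrass, every polynomial
field is generated by the three families of harmonic fields (`eq_top_of_harmonic_fields`), and the
harmonic polynomials of degree n have dimension at most 2n + 1, so the given orthonormal system
exhausts them (`span_pconj`).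

The determinant of A_n(r) cannot vanish because Im(h_n' conj(h_n)) > 0 for both wave numbers
(`isUnit_matA`). The incoming series converges because w and ∇f are separately square integrable on
the sphere, and conjugating the Hankel factors leaves the modulus of each separate contribution
unchanged.

The vector identities are proved in an abstract algebra with commuting derivations, so that they
serve both polynomials and smooth functions. -/

/-! ### Vector calculus in a commutative algebra with three commuting derivations -/

/-- A commutative algebra with coordinate elements `X j` and commuting partial derivatives `d j`. -/
structure VecCalc (A : Type*) [CommRing A] [Algebra ℂ A] where
  d : Fin 3 → Derivation ℂ A A
  X : Fin 3 → A
  d_X : ∀ i j, d i (X j) = if i = j then 1 else 0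
  d_comm : ∀ i j f, d i (d j f) = d j (d i f)

namespace VecCalc

variable {A : Type*} [CommRing A] [Algebra ℂ A] (S : VecCalc A)

/-- The angular derivative `(x × ∇)_j`. -/
def ang (j : Fin 3) (f : A) : A := S.X (j + 1) * S.d (j + 2) f - S.X (j + 2) * S.d (j + 1) f

/-- The Euler operator `x · ∇`. -/
def eul (f : A) : A := ∑ j, S.X j * S.d j f

/-- The Laplace operator. -/
def lap (f : A) : A := ∑ j, S.d j (S.d j f)

/-- The divergence. -/
def div (v : Fin 3 → A) : A := ∑ j, S.d j (v j)

/-- The curl. -/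
def curl (v : Fin 3 → A) (j : Fin 3) : A := S.d (j + 1) (v (j + 2)) - S.d (j + 2) (v (j + 1))

/-- The cross product `x × v`. -/
def xcross (v : Fin 3 → A) (j : Fin 3) : A := S.X (j + 1) * v (j + 2) - S.X (j + 2) * v (j + 1)

/-- The product `x · v`. -/
def xdot (v : Fin 3 → A) : A := ∑ j, S.X j * v j

/-- The squared radius. -/
def rsq : A := ∑ j, S.X j ^ 2

/-- Indices are taken modulo 3, so j, j + 1, j + 2 is always a cyclic triple and one formula covers
all components of a cross product. -/
lemma fin3_add : (1 : Fin 3) + 1 = 2 ∧ (1 : Fin 3) + 2 = 0 ∧ (2 : Fin 3) + 1 = 0 ∧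
    (2 : Fin 3) + 2 = 1 := by decide

/-- Oriented forms of commutativity: as rewrite rules they sort mixed derivatives and terminate. -/
lemma d_comm_sorted : (∀ f, S.d 1 (S.d 0 f) = S.d 0 (S.d 1 f)) ∧
    (∀ f, S.d 2 (S.d 0 f) = S.d 0 (S.d 2 f)) ∧ (∀ f, S.d 2 (S.d 1 f) = S.d 1 (S.d 2 f)) :=
  ⟨fun _ => S.d_comm _ _ _, fun _ => S.d_comm _ _ _, fun _ => S.d_comm _ _ _⟩

/-- The splitting of the Laplacian into radial and angular parts, free of division by the radius. It
is the source of both the eigenvalue n(n + 1) and the radial Bessel equation. -/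
lemma rsq_mul_lap (f : A) :
    S.rsq * S.lap f = S.eul (S.eul f) + S.eul f + ∑ j, S.ang j (S.ang j f) := by
  obtain ⟨h1, h2, h3⟩ := S.d_comm_sorted
  obtain ⟨a1, a2, a3, a4⟩ := fin3_add
  simp [rsq, lap, eul, ang, Fin.sum_univ_three, S.d_X, a1, a2, a3, a4, Derivation.leibniz,
    h1, h2, h3, smul_eq_mul]
  ring

lemma ang_rsq_mul (j : Fin 3) (f : A) : S.ang j (S.rsq * f) = S.rsq * S.ang j f := by
  obtain ⟨a1, a2, a3, a4⟩ := fin3_add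
  fin_cases j <;>
  · simp [rsq, ang, Fin.sum_univ_three, S.d_X, a1, a2, a3, a4, Derivation.leibniz,
      smul_eq_mul, pow_two]
    ring

lemma lap_ang (j : Fin 3) (f : A) : S.lap (S.ang j f) = S.ang j (S.lap f) := by
  obtain ⟨h1, h2, h3⟩ := S.d_comm_sorted
  obtain ⟨a1, a2, a3, a4⟩ := fin3_add
  fin_cases j <;>
  · simp [lap, ang, Fin.sum_univ_three, S.d_X, a1, a2, a3, a4, Derivation.leibniz,
      smul_eq_mul, h1, h2, h3]
    ring

lemma lap_xdot (v : Fin 3 → A) :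
    S.lap (S.xdot v) = S.xdot (fun j => S.lap (v j)) + 2 * S.div v := by
  simp [lap, xdot, div, Fin.sum_univ_three, S.d_X, Derivation.leibniz, smul_eq_mul]
  ring

/-- For solenoidal v only x · v survives on the right, so this tangential quantity is controlled by
the radial component. -/
lemma sum_ang_xcross (v : Fin 3 → A) :
    ∑ j, S.ang j (S.xcross v j) = S.rsq * S.div v - S.xdot v - S.eul (S.xdot v) := by
  obtain ⟨a1, a2, a3, a4⟩ := fin3_add
  simp [rsq, xdot, eul, xcross, ang, div, Fin.sum_univ_three, S.d_X, Derivation.leibniz,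
      smul_eq_mul, a1, a2, a3, a4]
  ring

lemma sum_ang_d (f : A) : ∑ j, S.ang j (S.d j f) = 0 := by
  obtain ⟨h1, h2, h3⟩ := S.d_comm_sorted
  obtain ⟨a1, a2, a3, a4⟩ := fin3_add
  simp [ang, Fin.sum_univ_three, h1, h2, h3, a1, a2, a3, a4]
  ring

lemma curl_curl (v : Fin 3 → A) (j : Fin 3) :
    S.curl (S.curl v) j = S.d j (S.div v) - S.lap (v j) := by
  obtain ⟨h1, h2, h3⟩ := S.d_comm_sorted
  obtain ⟨a1, a2, a3, a4⟩ := fin3_add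
  fin_cases j <;>
  · simp [lap, curl, div, Fin.sum_univ_three, a1, a2, a3, a4, h1, h2, h3]
    ring

lemma div_curl (v : Fin 3 → A) : S.div (S.curl v) = 0 := by
  obtain ⟨h1, h2, h3⟩ := S.d_comm_sorted
  obtain ⟨a1, a2, a3, a4⟩ := fin3_add
  simp [curl, div, Fin.sum_univ_three, a1, a2, a3, a4, h1, h2, h3]
  ring

lemma curl_d (f : A) (j : Fin 3) : S.curl (fun i => S.d i f) j = 0 := by
  obtain ⟨h1, h2, h3⟩ := S.d_comm_sorted
  obtain ⟨a1, a2, a3, a4⟩ := fin3_add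
  fin_cases j <;> simp [curl, a1, a2, a3, a4, h1, h2, h3]

lemma lap_d (f : A) (j : Fin 3) : S.lap (S.d j f) = S.d j (S.lap f) := by
  simp [lap, S.d_comm j]

lemma xdot_eul_d (f : A) :
    S.xdot (fun j => S.eul (S.d j f)) = S.eul (S.eul f) - S.eul f := by
  obtain ⟨h1, h2, h3⟩ := S.d_comm_sorted
  simp [xdot, eul, Fin.sum_univ_three, S.d_X, Derivation.leibniz, smul_eq_mul, h1, h2, h3]
  ring

lemma xcross_d (f : A) (j : Fin 3) : S.xcross (fun i => S.d i f) j = S.ang j f := rfl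

/-- On fields homogeneous of degree l the first two terms add up to (l + 1) v, so v can be recovered
from ∇(x · v) and x × curl v. -/
lemma d_xdot (v : Fin 3 → A) (j : Fin 3) :
    S.d j (S.xdot v) = v j + S.eul (v j) + S.xcross (S.curl v) j := by
  obtain ⟨a1, a2, a3, a4⟩ := fin3_add
  fin_cases j <;>
  · simp [xdot, eul, xcross, curl, Fin.sum_univ_three, S.d_X, Derivation.leibniz, smul_eq_mul,
      a1, a2, a3, a4]
    ring

lemma xcross_xcross (v : Fin 3 → A) (j : Fin 3) :
    S.xcross (S.xcross v) j = S.X j * S.xdot v - S.rsq * v j := by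
  obtain ⟨a1, a2, a3, a4⟩ := fin3_add
  fin_cases j <;>
  · simp [xdot, xcross, rsq, Fin.sum_univ_three, a1, a2, a3, a4]
    ring

lemma xcross_ang (f : A) (j : Fin 3) :
    S.xcross (fun i => S.ang i f) j = S.X j * S.eul f - S.rsq * S.d j f :=
  S.xcross_xcross (fun i => S.d i f) j

lemma xdot_ang (f : A) : S.xdot (fun j => S.ang j f) = 0 := by
  obtain ⟨a1, a2, a3, a4⟩ := fin3_add
  simp [xdot, ang, Fin.sum_univ_three, a1, a2, a3, a4]
  ring

lemma div_ang (f : A) : S.div (fun j => S.ang j f) = 0 := by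
  obtain ⟨h1, h2, h3⟩ := S.d_comm_sorted
  obtain ⟨a1, a2, a3, a4⟩ := fin3_add
  simp [div, ang, Fin.sum_univ_three, S.d_X, Derivation.leibniz, smul_eq_mul, h1, h2, h3,
      a1, a2, a3, a4]
  ring

/-- `L · (x × L f) = 0` for the angular derivatives `L`. -/
lemma sum_ang_xcross_ang (f : A) :
    ∑ j, S.ang j (S.xcross (fun i => S.ang i f) j) = 0 := by
  rw [S.sum_ang_xcross, S.div_ang, S.xdot_ang]
  simp [eul]

end VecCalc

namespace ElasticOtI

/-! ### Spherical Hankel functions -/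

/-- The coefficients `(n + k)! / (k! (n - k)!)`. -/
noncomputable def hankelCoeff (n k : ℕ) : ℂ :=
  (Nat.factorial (n + k) : ℂ) / ((Nat.factorial k : ℂ) * (Nat.factorial (n - k) : ℂ))

/-- The polynomial factor of the Hankel function, and its first two derivatives for `j = 1, 2`. -/
noncomputable def hankelPoly (n j : ℕ) (t : ℝ) : ℂ :=
  ∑ k ∈ Finset.range (n + 1), hankelCoeff n k * (k.ascFactorial j : ℂ) * (2 * Complex.I) ^ j *
    (Complex.I / (2 * (t : ℂ))) ^ (k + j)

lemma hankelCoeff_zero (n : ℕ) : hankelCoeff n 0 = 1 := by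
  simp [hankelCoeff, Nat.factorial_ne_zero]

/-- The termwise form of the differential equation for the polynomial factor. -/
lemma hankelCoeff_succ {n k : ℕ} (hk : k < n) :
    hankelCoeff n (k + 1) * (k + 1) = hankelCoeff n k * ((n * (n + 1) : ℂ) - k * (k + 1)) := by
  obtain ⟨m, rfl⟩ := Nat.exists_eq_add_of_lt hk
  have h1 : k + m + 1 - (k + 1) = m := by omega
  have h2 : k + m + 1 - k = m + 1 := by omega
  have h3 : k + m + 1 + (k + 1) = (k + m + 1 + k) + 1 := by omega
  simp only [hankelCoeff, h1, h2, h3, Nat.factorial_succ (k + m + 1 + k), Nat.factorial_succ m,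
    Nat.factorial_succ k]
  have e1 : ((Nat.factorial k : ℕ) : ℂ) ≠ 0 := by exact_mod_cast Nat.factorial_ne_zero _
  have e2 : ((Nat.factorial m : ℕ) : ℂ) ≠ 0 := by exact_mod_cast Nat.factorial_ne_zero _
  have e3 : (k : ℂ) + 1 ≠ 0 := by exact_mod_cast Nat.succ_ne_zero k
  have e4 : (m : ℂ) + 1 ≠ 0 := by exact_mod_cast Nat.succ_ne_zero m
  push_cast
  field_simp
  ring

/-- With y = i / (2t) one has y' = 2i y², so each derivative of y^k raises the power by one and
extends the ascending factorial. -/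
lemma hasDerivAt_hankelPoly (n j : ℕ) (hj : j < 2) {t : ℝ} (ht : t ≠ 0) :
    HasDerivAt (hankelPoly n j) (hankelPoly n (j + 1) t) t := by
  unfold hankelPoly
  have htc : (t : ℂ) ≠ 0 := by exact_mod_cast ht
  refine HasDerivAt.fun_sum fun k _ => ?_
  have h1 : HasDerivAt (fun s : ℝ => Complex.I / (2 * (s : ℂ)))
      (2 * Complex.I * (Complex.I / (2 * (t : ℂ))) ^ 2) t := by
    have h := (((Complex.ofRealCLM.hasDerivAt (x := t)).const_mul (2 : ℂ)).fun_inv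
      (by simpa using htc)).const_mul Complex.I
    simp only [div_eq_mul_inv]
    refine h.congr_deriv ?_
    simp only [Complex.ofRealCLM_apply, Complex.ofReal_one]
    field_simp
    linear_combination (-1 : ℂ) * Complex.I_sq
  have h2 := (h1.fun_pow (k + j)).const_mul
    (hankelCoeff n k * (k.ascFactorial j : ℂ) * (2 * Complex.I) ^ j)
  refine h2.congr_deriv ?_
  rcases Nat.eq_zero_or_pos (k + j) with h0 | h0
  · obtain ⟨rfl, rfl⟩ : k = 0 ∧ j = 0 := by omega
    simp [Nat.ascFactorial]
  · obtain ⟨m, hm⟩ := Nat.exists_eq_succ_of_ne_zero h0.ne'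
    rw [Nat.ascFactorial_succ, hm, ← add_assoc, hm]
    push_cast
    simp only [Nat.succ_eq_add_one]
    ring

/-- The coefficient recurrence makes the sum telescope. The top term k = n has no successor, but its
factor n(n + 1) - k(k + 1) vanishes. -/
lemma hankelPoly_ode (n : ℕ) {t : ℝ} :
    hankelPoly n 2 t + 2 * Complex.I * hankelPoly n 1 t
      + 4 * (n * (n + 1)) * (Complex.I / (2 * (t : ℂ))) ^ 2 * hankelPoly n 0 t = 0 := by
  set y : ℂ := Complex.I / (2 * (t : ℂ)) with hy
  have h2 : (2 * Complex.I) ^ 2 = -4 := by rw [mul_pow, Complex.I_sq]; norm_num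
  set g : ℕ → ℂ := fun k => 4 * k * hankelCoeff n k * y ^ (k + 1) with hg
  have key : hankelPoly n 2 t + 2 * Complex.I * hankelPoly n 1 t
      + 4 * (n * (n + 1)) * y ^ 2 * hankelPoly n 0 t =
      ∑ k ∈ Finset.range (n + 1), (4 * hankelCoeff n k * ((n * (n + 1) : ℂ) - k * (k + 1)) *
        y ^ (k + 2) - g k) := by
    unfold hankelPoly
    rw [Finset.mul_sum, Finset.mul_sum, ← Finset.sum_add_distrib, ← Finset.sum_add_distrib]
    refine Finset.sum_congr rfl fun k _ => ?_
    simp only [← hy, hg, Nat.ascFactorial, h2]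
    push_cast
    linear_combination hankelCoeff n k * k * y ^ (k + 1) * h2
  rw [key, Finset.sum_range_succ]
  have : ∀ k ∈ Finset.range n, 4 * hankelCoeff n k * ((n * (n + 1) : ℂ) - k * (k + 1)) *
        y ^ (k + 2) - g k = g (k + 1) - g k := by
    intro k hk
    have := hankelCoeff_succ (Finset.mem_range.mp hk)
    simp only [hg]
    push_cast
    linear_combination (-4 * y ^ (k + 2)) * this
  rw [Finset.sum_congr rfl this, Finset.sum_range_sub]
  simp [hg]

/-- The derivative of the Hankel function. -/
noncomputable def hankelD (n : ℕ) (t : ℝ) : ℂ :=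
  (-Complex.I) ^ (n + 1) * Complex.exp (Complex.I * (t : ℂ)) *
    ((Complex.I / t - 1 / t ^ 2) * hankelPoly n 0 t + hankelPoly n 1 t / t)

lemma hankel_eq (n : ℕ) (t : ℝ) : hankel n t =
    (-Complex.I) ^ (n + 1) * Complex.exp (Complex.I * (t : ℂ)) * (hankelPoly n 0 t / t) := by
  simp only [hankel, hankelPoly, hankelCoeff, Nat.ascFactorial, Nat.cast_one, mul_one, pow_zero,
    add_zero]
  ring

lemma hasDerivAt_cexp_I (t : ℝ) : HasDerivAt (fun s : ℝ => Complex.exp (Complex.I * (s : ℂ)))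
    (Complex.exp (Complex.I * (t : ℂ)) * Complex.I) t := by
  have h := ((Complex.ofRealCLM.hasDerivAt (x := t)).const_mul Complex.I).cexp
  simpa using h

lemma hasDerivAt_ofReal_inv {t : ℝ} (ht : t ≠ 0) :
    HasDerivAt (fun s : ℝ => ((s : ℂ))⁻¹) (-1 / (t : ℂ) ^ 2) t := by
  have htc : (t : ℂ) ≠ 0 := by exact_mod_cast ht
  simpa using (Complex.ofRealCLM.hasDerivAt (x := t)).fun_inv (by simpa using htc)

lemma hasDerivAt_hankel (n : ℕ) {t : ℝ} (ht : t ≠ 0) :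
    HasDerivAt (hankel n) (hankelD n t) t := by
  rw [funext (hankel_eq n)]
  simp only [div_eq_mul_inv]
  refine (((hasDerivAt_cexp_I t).const_mul _).fun_mul ((hasDerivAt_hankelPoly n 0 (by norm_num)
    ht).fun_mul (hasDerivAt_ofReal_inv ht))).congr_deriv ?_
  simp only [hankelD, div_eq_mul_inv]
  ring

/-- The spherical Bessel equation solved for the second derivative. -/
lemma hasDerivAt_hankelD (n : ℕ) {t : ℝ} (ht : t ≠ 0) :
    HasDerivAt (hankelD n)
      ((-2 * t * hankelD n t - ((t : ℂ) ^ 2 - n * (n + 1)) * hankel n t) / t ^ 2) t := by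
  have htc : (t : ℂ) ≠ 0 := by exact_mod_cast ht
  have hi := hasDerivAt_ofReal_inv ht
  have h := ((hasDerivAt_cexp_I t).const_mul ((-Complex.I) ^ (n + 1))).fun_mul
    ((((hi.const_mul Complex.I).fun_sub (hi.fun_pow 2)).fun_mul
      (hasDerivAt_hankelPoly n 0 (by norm_num) ht)).fun_add
      ((hasDerivAt_hankelPoly n 1 (by norm_num) ht).fun_mul hi))
  have e : hankelD n = fun s : ℝ => (-Complex.I) ^ (n + 1) * Complex.exp (Complex.I * (s : ℂ)) *
    ((Complex.I * (s : ℂ)⁻¹ - (s : ℂ)⁻¹ ^ 2) * hankelPoly n 0 s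
      + hankelPoly n 1 s * (s : ℂ)⁻¹) := by
    funext s
    simp only [hankelD, div_eq_mul_inv, inv_pow, one_mul]
  rw [e]
  refine h.congr_deriv ?_
  have ode := hankelPoly_ode n (t := t)
  rw [hankel_eq]
  have ode' : hankelPoly n 2 t = - 2 * Complex.I * hankelPoly n 1 t
      + (n * (n + 1)) / (t : ℂ) ^ 2 * hankelPoly n 0 t := by
    have : (Complex.I / (2 * (t : ℂ))) ^ 2 = - 1 / (4 * (t : ℂ) ^ 2) := by
      rw [div_pow, Complex.I_sq, mul_pow]; norm_num
    rw [this] at ode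
    field_simp at ode ⊢
    linear_combination ode
  norm_num
  rw [ode']
  field_simp
  ring_nf
  simp only [Complex.I_sq]
  ring

lemma tendsto_ofReal_inv : Tendsto (fun t : ℝ => ((t : ℂ))⁻¹) atTop (𝓝 0) := by
  have h := (Complex.continuous_ofReal.tendsto 0).comp tendsto_inv_atTop_zero
  rw [Complex.ofReal_zero] at h
  exact h.congr fun t => by simp

lemma tendsto_hankelPoly (n j : ℕ) :
    Tendsto (hankelPoly n j) atTop (𝓝 (if j = 0 then 1 else 0)) := by
  have hy : Tendsto (fun t : ℝ => Complex.I / (2 * (t : ℂ))) atTop (𝓝 0) := by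
    have h2 := tendsto_ofReal_inv.const_mul (Complex.I / 2)
    rw [mul_zero] at h2
    refine h2.congr fun t => ?_
    ring
  have h : Tendsto (hankelPoly n j) atTop (𝓝 (∑ k ∈ Finset.range (n + 1),
      hankelCoeff n k * (k.ascFactorial j : ℂ) * (2 * Complex.I) ^ j * 0 ^ (k + j))) :=
    tendsto_finsetSum _ fun k _ => (hy.pow (k + j)).const_mul _
  convert h using 2
  rw [Finset.sum_range_succ', Finset.sum_eq_zero]
  · rcases j with _ | j <;> simp [hankelCoeff_zero]
  · intro k _
    simp

lemma norm_hankel_factor (n : ℕ) (t : ℝ) :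
    ‖(-Complex.I) ^ (n + 1) * Complex.exp (Complex.I * (t : ℂ))‖ = 1 := by
  rw [norm_mul, mul_comm Complex.I, Complex.norm_exp_ofReal_mul_I]
  simp

lemma tendsto_norm_mul_hankel (n : ℕ) :
    Tendsto (fun t : ℝ => ‖(t : ℂ) * hankel n t‖) atTop (𝓝 1) := by
  have h := (tendsto_hankelPoly n 0).norm
  simp only [if_true, norm_one] at h
  refine h.congr' ?_
  filter_upwards [eventually_gt_atTop 0] with t ht
  have htc : (t : ℂ) ≠ 0 := by exact_mod_cast ht.ne'
  rw [hankel_eq, mul_left_comm, norm_mul, norm_hankel_factor, one_mul, mul_div_cancel₀ _ htc]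

lemma tendsto_hankelD_sub (n : ℕ) :
    Tendsto (fun t : ℝ => (t : ℂ) * (hankelD n t - Complex.I * hankel n t)) atTop (𝓝 0) := by
  have h := (tendsto_ofReal_inv.neg.mul (tendsto_hankelPoly n 0)).add (tendsto_hankelPoly n 1)
  simp only [if_true, neg_zero, zero_mul, one_ne_zero, if_false, add_zero] at h
  rw [tendsto_zero_iff_norm_tendsto_zero] at h ⊢
  refine h.congr' ?_
  filter_upwards [eventually_gt_atTop 0] with t ht
  have htc : (t : ℂ) ≠ 0 := by exact_mod_cast ht.ne'
  rw [← one_mul ‖_ + _‖, ← norm_hankel_factor n t, ← norm_mul]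
  congr 1
  rw [hankelD, hankel_eq]
  field_simp
  ring

end ElasticOtI

namespace ElasticOtI

/-! ### Solutions of the spherical Bessel equation -/

/-- `F` solves the spherical Bessel equation of order `n` with wave number `k` on `(a, ∞)`, and
`F1 = r F'`. -/
def IsBessel (k : ℝ) (n : ℕ) (a : ℝ) (F F1 : ℝ → ℂ) : Prop :=
  ∀ r, a < r → HasDerivAt F (F1 r / r) r ∧
    HasDerivAt F1 ((-F1 r + ((n : ℂ) * (n + 1) - (k : ℂ) ^ 2 * (r : ℂ) ^ 2) * F r) / r) r

/-- The function `r ↦ h_n(k r)`. -/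
noncomputable def hankelS (k : ℝ) (n : ℕ) (r : ℝ) : ℂ := hankel n (k * r)

/-- The function `r ↦ r (d/dr) h_n(k r)`. -/
noncomputable def hankelS1 (k : ℝ) (n : ℕ) (r : ℝ) : ℂ := (k * r : ℝ) * hankelD n (k * r)

lemma isBessel_hankelS {k : ℝ} (hk : 0 < k) (n : ℕ) {a : ℝ} (ha : 0 ≤ a) :
    IsBessel k n a (hankelS k n) (hankelS1 k n) := by
  intro r hr
  have hr0 : 0 < r := ha.trans_lt hr
  have hkr : k * r ≠ 0 := (mul_pos hk hr0).ne'
  have hrc : (r : ℂ) ≠ 0 := by exact_mod_cast hr0.ne'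
  have hkc : (k : ℂ) ≠ 0 := by exact_mod_cast hk.ne'
  have hl : HasDerivAt (fun s : ℝ => k * s) k r := by
    simpa using (hasDerivAt_id r).const_mul k
  have hlc : HasDerivAt (fun s : ℝ => ((k * s : ℝ) : ℂ)) (k : ℂ) r := hl.ofReal_comp
  constructor
  · refine ((hasDerivAt_hankel n hkr).scomp r hl).congr_deriv ?_
    simp only [hankelS1, Complex.real_smul]
    push_cast
    field_simp
  · refine (hlc.fun_mul ((hasDerivAt_hankelD n hkr).scomp r hl)).congr_deriv ?_
    simp only [hankelS1, hankelS, Complex.real_smul, Function.comp]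
    push_cast
    field_simp
    ring

lemma IsBessel.conj {k : ℝ} {n : ℕ} {a : ℝ} {F F1 : ℝ → ℂ} (h : IsBessel k n a F F1) :
    IsBessel k n a (fun r => conj (F r)) (fun r => conj (F1 r)) := by
  intro r hr
  obtain ⟨h1, h2⟩ := h r hr
  have e1 := (Complex.conjCLE.toContinuousLinearMap.hasFDerivAt.comp_hasDerivAt r h1)
  have e2 := (Complex.conjCLE.toContinuousLinearMap.hasFDerivAt.comp_hasDerivAt r h2)
  refine ⟨e1.congr_deriv ?_, e2.congr_deriv ?_⟩ <;> simp

lemma exists_const_of_hasDerivAt_zero {a : ℝ} {W : ℝ → ℂ} (h : ∀ r, a < r → HasDerivAt W 0 r) :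
    ∃ c, ∀ r, a < r → W r = c := by
  obtain ⟨c, hc⟩ := isOpen_Ioi.exists_is_const_of_fderiv_eq_zero (𝕜 := ℝ) (f := W)
    (isPreconnected_Ioi (a := a))
    (fun r hr => (h r hr).differentiableAt.differentiableWithinAt)
    (fun r hr => by
      ext
      simp [(h r hr).hasFDerivAt.fderiv])
  exact ⟨c, hc⟩

/-- With F1 = r F' the quantity is r² times the usual Wronskian, whose derivative vanishes by the
equation. -/
lemma IsBessel.wronskian {k : ℝ} {n : ℕ} {a : ℝ} (ha : 0 ≤ a) {F F1 G G1 : ℝ → ℂ}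
    (hF : IsBessel k n a F F1) (hG : IsBessel k n a G G1) :
    ∃ c, ∀ r, a < r → (r : ℂ) * (F r * G1 r - F1 r * G r) = c := by
  refine exists_const_of_hasDerivAt_zero fun r hr => ?_
  have hrc : (r : ℂ) ≠ 0 := by exact_mod_cast (ha.trans_lt hr).ne'
  obtain ⟨f1, f2⟩ := hF r hr
  obtain ⟨g1, g2⟩ := hG r hr
  have h := (Complex.ofRealCLM.hasDerivAt (x := r)).fun_mul ((f1.fun_mul g2).fun_sub (f2.fun_mul g1))
  refine h.congr_deriv ?_
  simp only [Complex.ofRealCLM_apply, Complex.ofReal_one]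
  field_simp
  ring

lemma tendsto_ofReal_mul_atTop {k : ℝ} (hk : 0 < k) : Tendsto (fun r : ℝ => k * r) atTop atTop :=
  tendsto_id.const_mul_atTop hk

lemma tendsto_norm_hankelS {k : ℝ} (hk : 0 < k) (n : ℕ) :
    Tendsto (fun r : ℝ => ‖((k * r : ℝ) : ℂ) * hankelS k n r‖) atTop (𝓝 1) :=
  (tendsto_norm_mul_hankel n).comp (tendsto_ofReal_mul_atTop hk)

lemma tendsto_hankelS1_sub {k : ℝ} (hk : 0 < k) (n : ℕ) :
    Tendsto (fun r : ℝ => hankelS1 k n r - Complex.I * ((k * r : ℝ) : ℂ) * hankelS k n r) atTop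
      (𝓝 0) := by
  refine ((tendsto_hankelD_sub n).comp (tendsto_ofReal_mul_atTop hk)).congr fun r => ?_
  simp only [hankelS1, hankelS, Function.comp]
  ring

lemma tendsto_hankelS {k : ℝ} (hk : 0 < k) (n : ℕ) : Tendsto (hankelS k n) atTop (𝓝 0) := by
  rw [tendsto_zero_iff_norm_tendsto_zero]
  have h := (tendsto_norm_hankelS hk n).mul (tendsto_inv_atTop_zero.comp
    (tendsto_ofReal_mul_atTop hk))
  rw [mul_zero] at h
  refine h.congr' ?_
  filter_upwards [eventually_gt_atTop 0] with r hr
  have hkr : 0 < k * r := mul_pos hk hr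
  rw [norm_mul, Complex.norm_real, Real.norm_eq_abs, abs_of_pos hkr, mul_comm (k * r) ‖_‖,
    Function.comp, mul_assoc, mul_inv_cancel₀ hkr.ne', mul_one]

lemma tendsto_hankelS1_div {k : ℝ} (hk : 0 < k) (n : ℕ) :
    Tendsto (fun r : ℝ => hankelS1 k n r / r) atTop (𝓝 0) := by
  have h := ((tendsto_hankelS1_sub hk n).mul tendsto_ofReal_inv).add
    ((tendsto_hankelS hk n).const_mul (Complex.I * k))
  simp only [mul_zero, add_zero] at h
  refine h.congr' ?_
  filter_upwards [eventually_gt_atTop 0] with r hr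
  have hrc : (r : ℂ) ≠ 0 := by exact_mod_cast hr.ne'
  push_cast
  field_simp
  ring

/-- The constant is read off at infinity, where r h' behaves like i k r h and |k r h| tends to 1. -/
lemma hankelS_wronskian {k : ℝ} (hk : 0 < k) (n : ℕ) {r : ℝ} (hr : 0 < r) :
    (r : ℂ) * (hankelS k n r * conj (hankelS1 k n r) - hankelS1 k n r * conj (hankelS k n r))
      = -(2 * Complex.I / k) := by
  have hB := isBessel_hankelS hk n le_rfl
  have hkc : (k : ℂ) ≠ 0 := by exact_mod_cast hk.ne'
  obtain ⟨c, hc⟩ := hB.wronskian le_rfl hB.conj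
  rw [hc r hr]
  have h1 := tendsto_hankelS1_sub hk n
  have h1c := (Complex.continuous_conj.tendsto 0).comp h1
  rw [map_zero] at h1c
  have hnorm := tendsto_norm_hankelS hk n
  have hbd : IsBoundedUnder (· ≤ ·) atTop
      ((‖·‖) ∘ fun r : ℝ => ((k * r : ℝ) : ℂ) * hankelS k n r) := hnorm.isBoundedUnder_le
  have hbdc : IsBoundedUnder (· ≤ ·) atTop
      ((‖·‖) ∘ fun r : ℝ => conj (((k * r : ℝ) : ℂ) * hankelS k n r)) := by
    convert hbd using 1
    funext r
    exact RCLike.norm_conj _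
  have hlim := (((h1c.zero_mul_isBoundedUnder_le hbd).sub
    (h1.zero_mul_isBoundedUnder_le hbdc)).div_const (k : ℂ)).add
    ((Complex.continuous_ofReal.tendsto _).comp (hnorm.pow 2)|>.const_mul (-(2 * Complex.I / k)))
  refine tendsto_nhds_unique (tendsto_const_nhds (x := c) (f := atTop (α := ℝ))) ?_
  simp only [one_pow, Complex.ofReal_one, mul_one, sub_zero, zero_div, zero_add] at hlim
  refine hlim.congr' ?_
  filter_upwards [eventually_gt_atTop 0] with r hr
  rw [← hc r hr]
  have hsq : ∀ z : ℂ, (((‖z‖ ^ 2 : ℝ)) : ℂ) = z * conj z := fun z => by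
    rw [Complex.mul_conj, Complex.normSq_eq_norm_sq]
  simp only [Function.comp, hsq, map_sub, map_mul, Complex.conj_I, Complex.conj_ofReal]
  push_cast
  field_simp
  ring

lemma hankelS_ne_zero {k : ℝ} (hk : 0 < k) (n : ℕ) {r : ℝ} (hr : 0 < r) : hankelS k n r ≠ 0 := by
  intro h
  have hkc : (k : ℂ) ≠ 0 := by exact_mod_cast hk.ne'
  have := hankelS_wronskian hk n hr
  simp only [h, map_zero, zero_mul, mul_zero, sub_self] at this
  exact (by simp [hkc] : (2 * Complex.I / k : ℂ) ≠ 0) (by simpa using this)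

/-- Cramer's rule: the two coefficients are the constant Wronskians of F with h and conj(h), divided
by that of h with its conjugate. -/
lemma IsBessel.eq_hankelS_add {k : ℝ} (hk : 0 < k) {n : ℕ} {a : ℝ} (ha : 0 ≤ a) {F F1 : ℝ → ℂ}
    (hF : IsBessel k n a F F1) : ∃ α β : ℂ, ∀ r, a < r →
      F r = α * hankelS k n r + β * conj (hankelS k n r) ∧
      F1 r = α * hankelS1 k n r + β * conj (hankelS1 k n r) := by
  have hB := isBessel_hankelS hk n ha
  have hkc : (k : ℂ) ≠ 0 := by exact_mod_cast hk.ne'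
  obtain ⟨c, hc⟩ := hF.wronskian ha hB
  obtain ⟨e, he⟩ := hF.wronskian ha hB.conj
  have hI : (2 * Complex.I / k : ℂ) ≠ 0 := by simp [hkc]
  refine ⟨-e / (2 * Complex.I / k), c / (2 * Complex.I / k), fun r hr => ?_⟩
  have hw := hankelS_wronskian hk n (ha.trans_lt hr)
  have h1 := hc r hr
  have h2 := he r hr
  set w : ℂ := 2 * Complex.I / k
  constructor
  · field_simp
    linear_combination F r * hw + conj (hankelS k n r) * h1 - hankelS k n r * h2
  · field_simp
    linear_combination F1 r * hw + conj (hankelS1 k n r) * h1 - hankelS1 k n r * h2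

/-- A solution of the spherical Bessel equation which satisfies the radiation condition is a
multiple of the outgoing Hankel function. -/
lemma IsBessel.eq_hankelS {k : ℝ} (hk : 0 < k) {n : ℕ} {a : ℝ} (ha : 0 ≤ a) {F F1 : ℝ → ℂ}
    (hF : IsBessel k n a F F1)
    (hrad : Tendsto (fun r : ℝ => F1 r - Complex.I * ((k * r : ℝ) : ℂ) * F r) atTop (𝓝 0)) :
    ∃ α : ℂ, ∀ r, a < r → F r = α * hankelS k n r ∧ F1 r = α * hankelS1 k n r := by
  obtain ⟨α, β, h⟩ := hF.eq_hankelS_add hk ha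
  have h1 := tendsto_hankelS1_sub hk n
  have h1c := (Complex.continuous_conj.tendsto 0).comp h1
  rw [map_zero] at h1c
  have hlim := ((hrad.sub (h1.const_mul α)).sub (h1c.const_mul β)).norm
  simp only [mul_zero, sub_zero, norm_zero] at hlim
  have hlim2 := (tendsto_norm_hankelS hk n).const_mul (2 * ‖β‖)
  -- In the radiation expression the conjugate Hankel function contributes a term of modulus tending
  -- to 2‖β‖, while everything else tends to 0.
  have : 2 * ‖β‖ * 1 = 0 := by
    refine tendsto_nhds_unique hlim2 (hlim.congr' ?_)
    filter_upwards [eventually_gt_atTop a] with r hr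
    obtain ⟨e1, e2⟩ := h r hr
    rw [e1, e2, ← RCLike.norm_conj (((k * r : ℝ) : ℂ) * hankelS k n r)]
    have : (2 : ℝ) = ‖(-2 * Complex.I : ℂ)‖ := by simp
    rw [this, ← norm_mul, ← norm_mul]
    congr 1
    simp only [Function.comp, map_sub, map_mul, Complex.conj_I, Complex.conj_ofReal]
    ring
  have hβ : β = 0 := by simpa using this
  refine ⟨α, fun r hr => ?_⟩
  simpa [hβ] using h r hr

/-- This decay needs no radiation condition. It is used to discard lower order terms before the
radiation condition of the coefficient is known. -/
lemma IsBessel.tendsto_zero {k : ℝ} (hk : 0 < k) {n : ℕ} {a : ℝ} (ha : 0 ≤ a) {F F1 : ℝ → ℂ}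
    (hF : IsBessel k n a F F1) :
    Tendsto F atTop (𝓝 0) ∧ Tendsto (fun r : ℝ => F1 r / r) atTop (𝓝 0) := by
  obtain ⟨α, β, h⟩ := hF.eq_hankelS_add hk ha
  have h0 := tendsto_hankelS hk n
  have h1 := tendsto_hankelS1_div hk n
  have h0c := (Complex.continuous_conj.tendsto 0).comp h0
  have h1c := (Complex.continuous_conj.tendsto 0).comp h1
  rw [map_zero] at h0c h1c
  constructor
  · have := (h0.const_mul α).add (h0c.const_mul β)
    simp only [mul_zero, add_zero] at this
    refine this.congr' ?_
    filter_upwards [eventually_gt_atTop a] with r hr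
    rw [(h r hr).1]
    rfl
  · have := (h1.const_mul α).add (h1c.const_mul β)
    simp only [mul_zero, add_zero] at this
    refine this.congr' ?_
    filter_upwards [eventually_gt_atTop a] with r hr
    rw [(h r hr).2]
    simp only [Function.comp, map_div₀, Complex.conj_ofReal]
    ring

/-- The Wronskian identity gives the value 1 / (k r): an outgoing wave carries positive flux. -/
lemma hankelS_im_pos {k : ℝ} (hk : 0 < k) (n : ℕ) {r : ℝ} (hr : 0 < r) :
    0 < (hankelS1 k n r * conj (hankelS k n r)).im := by
  have h := congrArg Complex.im (hankelS_wronskian hk n hr)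
  have e : hankelS k n r * conj (hankelS1 k n r) = conj (hankelS1 k n r * conj (hankelS k n r)) := by
    rw [map_mul, Complex.conj_conj, mul_comm]
  have e2 : (2 * Complex.I / k : ℂ) = ((2 / k : ℝ) : ℂ) * Complex.I := by push_cast; ring
  rw [e, e2] at h
  simp only [Complex.sub_im, Complex.conj_im, Complex.neg_im, Complex.im_ofReal_mul, Complex.I_im,
    mul_one] at h
  have h2 : 0 < 2 / k := by positivity
  by_contra hcon
  push Not at hcon
  nlinarith

/-! ### Invertibility of the matrices A_n(r). -/

lemma kp_pos {la mu om : ℝ} (hmu : 0 < mu) (hla : 0 < 2 * mu + 3 * la) (hom : 0 < om) :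
    0 < kp la mu om := div_pos hom (Real.sqrt_pos.mpr (by linarith))

lemma ks_pos {mu om : ℝ} (hmu : 0 < mu) (hom : 0 < om) : 0 < ks mu om :=
  div_pos hom (Real.sqrt_pos.mpr hmu)

lemma matA_eq {la mu om : ℝ} (hmu : 0 < mu) (hla : 0 < 2 * mu + 3 * la) (hom : 0 < om) (n : ℕ)
    {r : ℝ} (hr : 0 < r) :
    matA la mu om n r = !![hankelS (ks mu om) n r, 0, 0;
      0, -(hankelS (ks mu om) n r + hankelS1 (ks mu om) n r) / r,
        sqrtDelta n * hankelS (kp la mu om) n r / r;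
      0, -(sqrtDelta n * hankelS (ks mu om) n r) / r, hankelS1 (kp la mu om) n r / r] := by
  have hs := (mul_pos (ks_pos hmu hom) hr).ne'
  have hp := (mul_pos (kp_pos hmu hla hom) hr).ne'
  have hrc : (r : ℂ) ≠ 0 := by exact_mod_cast hr.ne'
  have e : (kp la mu om : ℂ) * hankelD n (kp la mu om * r) = hankelS1 (kp la mu om) n r / r := by
    simp only [hankelS1]
    push_cast
    field_simp
  simp only [matA, (hasDerivAt_hankel n hs).deriv, (hasDerivAt_hankel n hp).deriv, e]
  rfl

/-- The first diagonal entry is a nonzero Hankel value. If the lower 2 × 2 block were singular, a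
positive multiple of the shear flux would equal a nonpositive multiple of the compressional flux. -/
lemma isUnit_matA {la mu om : ℝ} (hmu : 0 < mu) (hla : 0 < 2 * mu + 3 * la) (hom : 0 < om) (n : ℕ)
    {r : ℝ} (hr : 0 < r) : IsUnit (matA la mu om n r) := by
  have hs := ks_pos hmu hom
  have hp := kp_pos hmu hla hom
  have hrc : (r : ℂ) ≠ 0 := by exact_mod_cast hr.ne'
  rw [Matrix.isUnit_iff_isUnit_det, isUnit_iff_ne_zero, matA_eq hmu hla hom n hr, Matrix.det_fin_three]
  have hs0 := hankelS_ne_zero hs n hr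
  have ims := hankelS_im_pos hs n hr
  have imp := hankelS_im_pos hp n hr
  set s := hankelS (ks mu om) n r
  set s1 := hankelS1 (ks mu om) n r
  set p := hankelS (kp la mu om) n r
  set p1 := hankelS1 (kp la mu om) n r
  have hp1 : p1 ≠ 0 := by
    rintro h
    simp [h] at imp
  set D : ℝ := sqrtDelta n
  intro hdet
  simp only [Matrix.of_apply, Matrix.cons_val', Matrix.cons_val_zero, Matrix.cons_val_one,
    Matrix.cons_val] at hdet
  have h1 : (s + s1) * p1 = (D : ℂ) ^ 2 * s * p := by
    field_simp at hdet
    have : s * ((s + s1) * p1 - (D : ℂ) ^ 2 * s * p) = 0 := by linear_combination -hdet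
    exact sub_eq_zero.mp ((mul_eq_zero.mp this).resolve_left hs0)
  have hsq : ∀ z : ℂ, (((‖z‖ ^ 2 : ℝ)) : ℂ) = z * conj z := fun z => by
    rw [Complex.mul_conj, Complex.normSq_eq_norm_sq]
  -- Multiplication by conj(s) conj(p1) leaves real factors beside s1 conj(s) and conj(p1 conj(p)),
  -- whose imaginary parts have opposite signs.
  have h2 : ((‖p1‖ ^ 2 : ℝ) : ℂ) * (((‖s‖ ^ 2 : ℝ) : ℂ) + s1 * conj s)
      = ((D ^ 2 * ‖s‖ ^ 2 : ℝ) : ℂ) * conj (p1 * conj p) := by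
    rw [Complex.ofReal_mul (D ^ 2), hsq, hsq, map_mul, Complex.conj_conj]
    push_cast
    linear_combination conj s * conj p1 * h1
  have h3 := congrArg Complex.im h2
  rw [Complex.im_ofReal_mul, Complex.im_ofReal_mul, Complex.add_im, Complex.ofReal_im, zero_add,
    Complex.conj_im] at h3
  have h4 : 0 < ‖p1‖ ^ 2 := by positivity
  have h5 : 0 ≤ D ^ 2 * ‖s‖ ^ 2 := by positivity
  nlinarith [mul_pos h4 ims, mul_nonneg h5 imp.le]

end ElasticOtI

/-! ### Transport of vector calculus along algebra homomorphisms. -/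

namespace VecCalc

variable {A B : Type*} [CommRing A] [Algebra ℂ A] [CommRing B] [Algebra ℂ B]

/-- A homomorphism compatible with coordinates and derivatives. -/
structure Compat (S : VecCalc A) (T : VecCalc B) (φ : A →ₐ[ℂ] B) : Prop where
  X : ∀ j, φ (S.X j) = T.X j
  d : ∀ j f, φ (S.d j f) = T.d j (φ f)

variable {S : VecCalc A} {T : VecCalc B} {φ : A →ₐ[ℂ] B}

lemma Compat.ang (h : Compat S T φ) (j : Fin 3) (f : A) : φ (S.ang j f) = T.ang j (φ f) := by
  simp [VecCalc.ang, h.X, h.d]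

lemma Compat.xcross (h : Compat S T φ) (v : Fin 3 → A) (j : Fin 3) :
    φ (S.xcross v j) = T.xcross (fun i => φ (v i)) j := by
  simp [VecCalc.xcross, h.X]

lemma Compat.rsq (h : Compat S T φ) : φ S.rsq = T.rsq := by
  simp [VecCalc.rsq, h.X]

variable (S) in
lemma ang_mul (j : Fin 3) (f g : A) : S.ang j (f * g) = S.ang j f * g + f * S.ang j g := by
  simp only [VecCalc.ang, Derivation.leibniz, smul_eq_mul]
  ring

end VecCalc

namespace ElasticOtI

/-! ### Smooth functions and polynomials -/

/-- The algebra of smooth complex functions on `ℝ³`. -/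
def Sm : Subalgebra ℂ (E3 → ℂ) where
  carrier := {f | ContDiff ℝ ∞ f}
  mul_mem' {f g} hf hg := ContDiff.mul (𝕜 := ℝ) (n := ∞) (f := f) (g := g) hf hg
  add_mem' {f g} hf hg := ContDiff.add (𝕜 := ℝ) (n := ∞) (f := f) (g := g) hf hg
  algebraMap_mem' c := contDiff_const (𝕜 := ℝ) (n := ∞) (c := c)

lemma Sm.contDiff (f : Sm) : ContDiff ℝ ∞ f.1 := f.2

lemma Sm.continuous (f : Sm) : Continuous f.1 := (Sm.contDiff f).continuous

lemma Sm.differentiable (f : Sm) : Differentiable ℝ f.1 := (Sm.contDiff f).differentiable (by simp)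

lemma contDiff_pd {f : E3 → ℂ} (hf : ContDiff ℝ ∞ f) (j : Fin 3) : ContDiff ℝ ∞ (pd j f) :=
  (hf.fderiv_right (m := ∞) (by simp)).clm_apply contDiff_const

/-- The partial derivatives as derivations of the algebra of smooth functions. -/
noncomputable def Sm.d (j : Fin 3) : Derivation ℂ Sm Sm where
  toFun f := ⟨pd j f.1, contDiff_pd f.2 j⟩
  map_add' f g := by
    ext x
    change fderiv ℝ (f.1 + g.1) x _ = fderiv ℝ f.1 x _ + fderiv ℝ g.1 x _
    rw [fderiv_add (Sm.differentiable f x) (Sm.differentiable g x)]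
    rfl
  map_smul' c f := by
    ext x
    change fderiv ℝ (c • f.1) x _ = c * fderiv ℝ f.1 x _
    rw [fderiv_const_smul (Sm.differentiable f x)]
    rfl
  map_one_eq_zero' := by
    ext x
    change fderiv ℝ (fun _ => (1 : ℂ)) x _ = 0
    simp
  leibniz' f g := by
    ext x
    change fderiv ℝ (f.1 * g.1) x _ = f.1 x * fderiv ℝ g.1 x _ + g.1 x * fderiv ℝ f.1 x _
    rw [fderiv_mul (Sm.differentiable f x) (Sm.differentiable g x)]
    rfl

/-- The coordinate functions. -/
noncomputable def Sm.X (j : Fin 3) : Sm :=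
  ⟨fun x => ((x j : ℝ) : ℂ),
    ((Complex.ofRealCLM.comp (EuclideanSpace.proj (𝕜 := ℝ) j)).contDiff : ContDiff ℝ ∞ _)⟩

lemma Sm.X_apply (j : Fin 3) (x : E3) : (Sm.X j).1 x = ((x j : ℝ) : ℂ) := rfl

/-- Vector calculus of smooth functions. -/
noncomputable def smoothCalc : VecCalc Sm where
  d := Sm.d
  X := Sm.X
  d_X i j := by
    ext x
    have h : HasFDerivAt (fun y : E3 => ((y j : ℝ) : ℂ))
        (Complex.ofRealCLM.comp (EuclideanSpace.proj (𝕜 := ℝ) j)) x :=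
      (Complex.ofRealCLM.comp (EuclideanSpace.proj (𝕜 := ℝ) j)).hasFDerivAt
    change fderiv ℝ (fun y : E3 => ((y j : ℝ) : ℂ)) x _ = _
    rw [h.fderiv]
    rcases eq_or_ne i j with rfl | hij
    · simp
    · simp [hij, hij.symm]
  d_comm i j f := by
    ext x
    have hd : Differentiable ℝ (fderiv ℝ f.1) :=
      ((Sm.contDiff f).fderiv_right (m := ∞) (by simp)).differentiable (by simp)
    have h (a b : Fin 3) : pd a (pd b f.1) x = fderiv ℝ (fderiv ℝ f.1) x
        (EuclideanSpace.single a 1) (EuclideanSpace.single b 1) := by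
      change fderiv ℝ (fun y => fderiv ℝ f.1 y _) x _ = _
      rw [fderiv_clm_apply (hd x) (differentiableAt_const _)]
      simp
    change pd i (pd j f.1) x = pd j (pd i f.1) x
    rw [h, h]
    exact ((Sm.contDiff f).contDiffAt.isSymmSndFDerivAt
      (by simpa using WithTop.coe_le_coe.mpr (le_top : (2 : ℕ∞) ≤ ⊤))) _ _

/-- Vector calculus of polynomials. -/
noncomputable def polyCalc : VecCalc (MvPolynomial (Fin 3) ℂ) where
  d := MvPolynomial.pderiv
  X := MvPolynomial.X
  d_X i j := by
    rw [MvPolynomial.pderiv_X, Pi.single_apply]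
    simp [eq_comm]
  d_comm i j f := by
    let D : Fin 3 → Derivation ℂ (MvPolynomial (Fin 3) ℂ) (MvPolynomial (Fin 3) ℂ) :=
      fun i => MvPolynomial.pderiv i
    -- The commutator is again a derivation, so it suffices that it vanishes on the variables.
    have h : ⁅D i, D j⁆ = 0 := by
      apply MvPolynomial.derivation_ext
      intro k
      simp only [D, Derivation.commutator_apply, MvPolynomial.pderiv_X, Pi.single_apply]
      split_ifs <;> simp
    have h2 := congrArg (fun E => E f) h
    simpa [D, Derivation.commutator_apply, sub_eq_zero] using h2

/-- The polynomial functions. -/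
noncomputable def polyFun : MvPolynomial (Fin 3) ℂ →ₐ[ℂ] Sm := MvPolynomial.aeval Sm.X

lemma polyFun_apply (p : MvPolynomial (Fin 3) ℂ) (x : E3) :
    (polyFun p).1 x = MvPolynomial.eval (fun i => ((x i : ℝ) : ℂ)) p := by
  induction p using MvPolynomial.induction_on with
  | C a =>
    rw [polyFun, MvPolynomial.aeval_C, MvPolynomial.eval_C]
    rfl
  | add p q hp hq =>
    rw [map_add, map_add, ← hp, ← hq]
    rfl
  | mul_X p i hp =>
    rw [map_mul, map_mul, MvPolynomial.eval_X, ← hp, polyFun, MvPolynomial.aeval_X]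
    rfl

lemma polyFun_compat : VecCalc.Compat polyCalc smoothCalc polyFun where
  X j := by simp [polyCalc, polyFun, smoothCalc]
  d j f := by
    change polyFun (MvPolynomial.pderiv j f) = Sm.d j (polyFun f)
    induction f using MvPolynomial.induction_on with
    | C a =>
      rw [MvPolynomial.pderiv_C, map_zero, polyFun, MvPolynomial.aeval_C, Derivation.map_algebraMap]
    | add p q hp hq => simp [hp, hq]
    | mul_X p i hp =>
      have hX : polyFun (MvPolynomial.X i) = smoothCalc.X i := by simp [polyFun, smoothCalc]
      have h2 := smoothCalc.d_X j i
      have h1 : Sm.d j (smoothCalc.X i) = if j = i then 1 else 0 := h2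
      rw [Derivation.leibniz, map_mul, Derivation.leibniz, hX, h1, MvPolynomial.pderiv_X,
        Pi.single_apply]
      simp only [smul_eq_mul, map_add, map_mul, hp, hX]
      congr 2
      simp only [eq_comm (a := i), apply_ite polyFun, map_one, map_zero]

end ElasticOtI

namespace ElasticOtI

/-! ### Integrals over the unit sphere -/

/-- The unit sphere. -/
abbrev S2 : Type := Metric.sphere (0 : E3) 1

/-- The surface measure of the unit sphere. -/
noncomputable abbrev sigma2 : Measure S2 := (volume : Measure E3).toSphere

lemma integrable_of_continuous {F : Type*} [NormedAddCommGroup F] {g : S2 → F}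
    (hg : Continuous g) : Integrable g sigma2 :=
  hg.integrable_of_hasCompactSupport (HasCompactSupport.of_compactSpace g)

/-- The integral of `f(r y) q(y)` over the unit sphere. -/
noncomputable def coef (f q : Sm) (r : ℝ) : ℂ := ∫ y : S2, f.1 (r • (y : E3)) * q.1 y ∂sigma2

lemma continuous_dilate (f : Sm) : Continuous fun z : ℝ × S2 => f.1 (z.1 • (z.2 : E3)) :=
  (Sm.continuous f).comp (by fun_prop)

lemma continuous_dilate_right (f : Sm) (r : ℝ) : Continuous fun y : S2 => f.1 (r • (y : E3)) :=
  (Sm.continuous f).comp (by fun_prop)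

lemma continuous_restrict (f : Sm) : Continuous fun y : S2 => f.1 (y : E3) :=
  (Sm.continuous f).comp (by fun_prop)

lemma integrable_coef (f q : Sm) (r : ℝ) :
    Integrable (fun y : S2 => f.1 (r • (y : E3)) * q.1 y) sigma2 :=
  integrable_of_continuous ((continuous_dilate_right f r).mul (continuous_restrict q))

lemma coef_add_left (f g q : Sm) (r : ℝ) : coef (f + g) q r = coef f q r + coef g q r := by
  unfold coef
  rw [← integral_add (integrable_coef f q r) (integrable_coef g q r)]
  exact integral_congr_ae (.of_forall fun y => add_mul _ _ _)

lemma coef_add_right (f q p : Sm) (r : ℝ) : coef f (q + p) r = coef f q r + coef f p r := by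
  unfold coef
  rw [← integral_add (integrable_coef f q r) (integrable_coef f p r)]
  exact integral_congr_ae (.of_forall fun y => mul_add _ _ _)

lemma coef_smul_left (c : ℂ) (f q : Sm) (r : ℝ) : coef (c • f) q r = c * coef f q r := by
  unfold coef
  rw [← integral_const_mul]
  exact integral_congr_ae (.of_forall fun y => mul_assoc _ _ _)

lemma coef_smul_right (c : ℂ) (f q : Sm) (r : ℝ) : coef f (c • q) r = c * coef f q r := by
  unfold coef
  rw [← integral_const_mul]
  exact integral_congr_ae (.of_forall fun y => mul_left_comm _ _ _)

lemma coef_zero_left (q : Sm) (r : ℝ) : coef 0 q r = 0 := by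
  simpa using coef_smul_left 0 0 q r

lemma coef_zero_right (f : Sm) (r : ℝ) : coef f 0 r = 0 := by
  simpa using coef_smul_right 0 f 0 r

lemma coef_neg_left (f q : Sm) (r : ℝ) : coef (-f) q r = -coef f q r := by
  simpa using coef_smul_left (-1) f q r

lemma coef_neg_right (f q : Sm) (r : ℝ) : coef f (-q) r = -coef f q r := by
  simpa using coef_smul_right (-1) f q r

lemma coef_sum_left {ι : Type*} (s : Finset ι) (f : ι → Sm) (q : Sm) (r : ℝ) :
    coef (∑ i ∈ s, f i) q r = ∑ i ∈ s, coef (f i) q r := by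
  classical
  induction s using Finset.induction_on with
  | empty => simp [coef_zero_left]
  | insert i s hi ih => rw [Finset.sum_insert hi, Finset.sum_insert hi, coef_add_left, ih]

lemma coef_sum_right {ι : Type*} (s : Finset ι) (f : Sm) (q : ι → Sm) (r : ℝ) :
    coef f (∑ i ∈ s, q i) r = ∑ i ∈ s, coef f (q i) r := by
  classical
  induction s using Finset.induction_on with
  | empty => simp [coef_zero_right]
  | insert i s hi ih => rw [Finset.sum_insert hi, Finset.sum_insert hi, coef_add_right, ih]

lemma coef_congr {f g p q : Sm} {r s : ℝ}
    (h : ∀ y : S2, f.1 (r • (y : E3)) * p.1 y = g.1 (s • (y : E3)) * q.1 y) :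
    coef f p r = coef g q s :=
  integral_congr_ae (.of_forall h)

lemma eul_apply (f : Sm) (x : E3) : (smoothCalc.eul f).1 x = fderiv ℝ f.1 x x := by
  have hx : x = ∑ j, x j • EuclideanSpace.single j (1 : ℝ) := by
    ext i
    fin_cases i <;> simp [Fin.sum_univ_three]
  conv_rhs => rw [hx, map_sum, ← hx]
  simp only [map_smul, VecCalc.eul, Complex.real_smul, Fin.sum_univ_three]
  rfl

lemma hasDerivAt_integral_sphere {G G' : ℝ → S2 → ℂ} (hG : ∀ t, Continuous (G t))
    (hG' : Continuous (Function.uncurry G'))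
    (h : ∀ t y, HasDerivAt (fun s => G s y) (G' t y) t) (t : ℝ) :
    HasDerivAt (fun s => ∫ y, G s y ∂sigma2) (∫ y, G' t y ∂sigma2) t := by
  obtain ⟨C, hC⟩ := ((isCompact_closedBall t 1).prod (isCompact_univ (X := S2))).exists_bound_of_continuousOn
    hG'.continuousOn
  refine (hasDerivAt_integral_of_dominated_loc_of_deriv_le (bound := fun _ => C)
    (Metric.closedBall_mem_nhds t one_pos)
    (.of_forall fun s => (hG s).aestronglyMeasurable) (integrable_of_continuous (hG t))
    (hG'.comp (by fun_prop : Continuous fun y : S2 => (t, y))).aestronglyMeasurable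
    (.of_forall fun y s hs => hC (s, y) ⟨hs, Set.mem_univ _⟩) (integrable_const C)
    (.of_forall fun y s _ => h s y)).2

/-- Radial differentiation of the coefficients. -/
lemma hasDerivAt_coef (f q : Sm) {r : ℝ} (hr : r ≠ 0) :
    HasDerivAt (coef f q) (coef (smoothCalc.eul f) q r / r) r := by
  have hrc : (r : ℂ) ≠ 0 := by exact_mod_cast hr
  have h1 : ∀ (t : ℝ) (y : S2), HasDerivAt (fun s : ℝ => f.1 (s • (y : E3)) * q.1 y)
      ((∑ j, (Sm.d j f).1 (t • (y : E3)) * (Sm.X j).1 y) * q.1 y) t := by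
    intro t y
    refine HasDerivAt.mul_const ?_ _
    have hl : HasDerivAt (fun s : ℝ => s • (y : E3)) (y : E3) t := by
      simpa using (hasDerivAt_id t).smul_const (y : E3)
    refine ((Sm.differentiable f _).hasFDerivAt.comp_hasDerivAt t hl).congr_deriv ?_
    have hx : (y : E3) = ∑ j, (y : E3) j • EuclideanSpace.single j (1 : ℝ) := by
      ext i
      fin_cases i <;> simp [Fin.sum_univ_three]
    conv_lhs => rw [hx, map_sum, ← hx]
    refine Finset.sum_congr rfl fun j _ => ?_
    rw [map_smul, Complex.real_smul, mul_comm]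
    rfl
  have h2 := hasDerivAt_integral_sphere (G := fun t y => f.1 (t • (y : E3)) * q.1 y)
    (fun t => (continuous_dilate_right f t).mul (continuous_restrict q)) (by
      refine Continuous.mul (continuous_finsetSum _ fun j _ => ?_)
        ((continuous_restrict q).comp continuous_snd)
      exact (continuous_dilate (Sm.d j f)).mul ((continuous_restrict (Sm.X j)).comp continuous_snd))
    h1 r
  refine h2.congr_deriv ?_
  rw [coef, ← integral_div]
  refine integral_congr_ae (.of_forall fun y => ?_)
  have : (smoothCalc.eul f).1 (r • (y : E3)) =
      ∑ j, (r : ℂ) * ((Sm.d j f).1 (r • (y : E3)) * (Sm.X j).1 y) := by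
    simp only [VecCalc.eul, Fin.sum_univ_three]
    change (Sm.X 0).1 (r • (y : E3)) * _ + (Sm.X 1).1 (r • (y : E3)) * _ +
      (Sm.X 2).1 (r • (y : E3)) * _ = _
    simp only [Sm.X_apply, PiLp.smul_apply, smul_eq_mul, Complex.ofReal_mul]
    change _ * (Sm.d 0 f).1 _ + _ * (Sm.d 1 f).1 _ + _ * (Sm.d 2 f).1 _ = _
    ring
  change _ = (smoothCalc.eul f).1 (r • (y : E3)) * q.1 y / r
  rw [this, ← Finset.mul_sum]
  field_simp

/-! ### Rotations and integration by parts on the sphere. -/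

/-- The rotation by the angle `t` about the `j`-th coordinate axis. -/
noncomputable def rotLin (j : Fin 3) (t : ℝ) : E3 →ₗ[ℝ] E3 where
  toFun x := WithLp.toLp 2 fun i =>
    if i = j + 1 then Real.cos t * x (j + 1) - Real.sin t * x (j + 2)
    else if i = j + 2 then Real.sin t * x (j + 1) + Real.cos t * x (j + 2) else x i
  map_add' x y := by
    ext i
    simp only [PiLp.add_apply]
    split_ifs <;> ring
  map_smul' c x := by
    ext i
    simp only [PiLp.smul_apply, smul_eq_mul, RingHom.id_apply]
    split_ifs <;> ring

lemma norm_rotLin (j : Fin 3) (t : ℝ) (x : E3) : ‖rotLin j t x‖ = ‖x‖ := by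
  have h := Real.sin_sq_add_cos_sq t
  rw [EuclideanSpace.norm_eq, EuclideanSpace.norm_eq]
  congr 1
  fin_cases j
  · simp [Fin.sum_univ_three, rotLin]
    linear_combination (x 1 ^ 2 + x 2 ^ 2) * h
  · simp [Fin.sum_univ_three, rotLin]
    linear_combination (x 0 ^ 2 + x 2 ^ 2) * h
  · simp [Fin.sum_univ_three, rotLin]
    linear_combination (x 0 ^ 2 + x 1 ^ 2) * h

/-- The rotation by the angle `t` about the `j`-th coordinate axis, as an isometry. -/
noncomputable def rot (j : Fin 3) (t : ℝ) : E3 ≃ₗᵢ[ℝ] E3 :=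
  LinearIsometry.toLinearIsometryEquiv ⟨rotLin j t, norm_rotLin j t⟩ rfl

/-- The action of an isometry on the unit sphere. -/
noncomputable def sphereMap (T : E3 ≃ₗᵢ[ℝ] E3) (y : S2) : S2 :=
  ⟨T y, by simp [T.norm_map]⟩

/-- The surface measure of s is defined through the volume of the cone over s; a linear isometry
maps cones to cones and preserves volume. -/
lemma measurePreserving_sphereMap (T : E3 ≃ₗᵢ[ℝ] E3) :
    MeasurePreserving (sphereMap T) sigma2 sigma2 := by
  have hc : Continuous (sphereMap T) :=
    (T.continuous.comp continuous_subtype_val).subtype_mk _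
  refine ⟨hc.measurable, Measure.ext fun s hs => ?_⟩
  rw [Measure.map_apply hc.measurable hs, Measure.toSphere_apply' _ hs,
    Measure.toSphere_apply' _ (hc.measurable hs)]
  congr 1
  rw [← T.measurePreserving.measure_preimage_emb T.toHomeomorph.measurableEmbedding
    (Set.Ioo (0 : ℝ) 1 • (Subtype.val '' s : Set E3))]
  congr 1
  ext x
  simp only [Set.mem_smul, Set.mem_image, Set.mem_preimage]
  constructor
  · rintro ⟨a, ha, _, ⟨y, hy, rfl⟩, rfl⟩
    exact ⟨a, ha, _, ⟨sphereMap T y, hy, rfl⟩, by simp [sphereMap]⟩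
  · rintro ⟨a, ha, _, ⟨y, hy, rfl⟩, hx⟩
    refine ⟨a, ha, _, ⟨sphereMap T.symm y, ?_, rfl⟩, ?_⟩
    · simpa [sphereMap] using hy
    · simp [sphereMap, ← map_smul, hx]

lemma measurableEmbedding_sphereMap (T : E3 ≃ₗᵢ[ℝ] E3) : MeasurableEmbedding (sphereMap T) := by
  have hc : Continuous (sphereMap T) :=
    (T.continuous.comp continuous_subtype_val).subtype_mk _
  exact hc.measurableEmbedding fun y z h => by
    have h2 : T y = T z := congrArg Subtype.val h
    exact Subtype.ext (T.injective h2)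

lemma continuous_rotLin (j : Fin 3) : Continuous fun z : ℝ × S2 => rotLin j z.1 (z.2 : E3) := by
  have h : ∀ i : Fin 3, Continuous fun z : ℝ × S2 => (z.2 : E3) i := fun i => by fun_prop
  refine (PiLp.continuous_toLp 2 _).comp (continuous_pi fun i => ?_)
  have h1 := h (j + 1)
  have h2 := h (j + 2)
  have h3 := h i
  split_ifs <;> fun_prop

lemma hasDerivAt_of_apply {c : ℝ → E3} {c' : E3} {t : ℝ}
    (h : ∀ i, HasDerivAt (fun s => c s i) (c' i) t) : HasDerivAt c c' t := by
  have h1 : HasDerivAt (fun s i => c s i) (fun i => c' i) t := hasDerivAt_pi.mpr h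
  exact ((PiLp.continuousLinearEquiv 2 ℝ fun _ : Fin 3 => ℝ).symm.toContinuousLinearMap
    |>.hasFDerivAt.comp_hasDerivAt t h1)

/-- The rotations about an axis are the flow of the vector field x ↦ e_j × x, along which `ang j`
differentiates. -/
lemma hasDerivAt_rotLin (f : Sm) (j : Fin 3) (x : E3) (t : ℝ) :
    HasDerivAt (fun s => f.1 (rotLin j s x)) ((smoothCalc.ang j f).1 (rotLin j t x)) t := by
  have hr : HasDerivAt (fun s => rotLin j s x)
      ((rotLin j t x) (j + 1) • EuclideanSpace.single (j + 2) 1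
        - (rotLin j t x) (j + 2) • EuclideanSpace.single (j + 1) (1 : ℝ)) t := by
    refine hasDerivAt_of_apply ?_
    have hs := Real.hasDerivAt_sin t
    have hc := Real.hasDerivAt_cos t
    intro i
    fin_cases j <;> fin_cases i <;>
    · simp only [rotLin]
      simp
      first
        | exact hasDerivAt_const _ _
        | exact ((hs.mul_const _).fun_add (hc.mul_const _)).congr_deriv (by ring)
        | exact ((hc.mul_const _).fun_sub (hs.mul_const _)).congr_deriv (by ring)
  refine ((Sm.differentiable f _).hasFDerivAt.comp_hasDerivAt t hr).congr_deriv ?_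
  rw [map_sub, map_smul, map_smul, Complex.real_smul, Complex.real_smul]
  rfl

/-- The integral of an angular derivative over the unit sphere vanishes. -/
lemma integral_ang (j : Fin 3) (f : Sm) : ∫ y : S2, (smoothCalc.ang j f).1 y ∂sigma2 = 0 := by
  have hc : ∀ t, Continuous fun y : S2 => f.1 (rotLin j t (y : E3)) := fun t =>
    (Sm.continuous f).comp
      ((LinearMap.continuous_of_finiteDimensional (rotLin j t)).comp continuous_subtype_val)
  have hc' : Continuous fun z : ℝ × S2 => (smoothCalc.ang j f).1 (rotLin j z.1 (z.2 : E3)) :=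
    (Sm.continuous _).comp (continuous_rotLin j)
  have h1 := hasDerivAt_integral_sphere hc
    (G' := fun t y => (smoothCalc.ang j f).1 (rotLin j t y)) hc' (fun t y => hasDerivAt_rotLin f j (y : E3) t) 0
  -- Rotation invariance makes this integral constant in t, whereas its derivative at t = 0 is the
  -- integral in question.
  have h2 : (fun t => ∫ y : S2, f.1 (rotLin j t y) ∂sigma2) = fun _ => ∫ y : S2, f.1 y ∂sigma2 := by
    funext t
    have hT := measurePreserving_sphereMap (rot j t)
    exact hT.integral_comp (measurableEmbedding_sphereMap _) (fun y : S2 => f.1 y)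
  rw [h2] at h1
  have h3 := h1.unique (hasDerivAt_const _ _)
  have h4 : ∀ y : E3, rotLin j 0 y = y := fun y => by
    ext i
    simp only [rotLin, LinearMap.coe_mk, AddHom.coe_mk]
    split_ifs with h h' <;> simp [*]
  simpa only [h4] using h3

/-- Dilation of a smooth function. -/
noncomputable def dil (r : ℝ) (f : Sm) : Sm :=
  ⟨fun x => f.1 (r • x), (Sm.contDiff f).comp (contDiff_const_smul r)⟩

lemma d_dil (r : ℝ) (f : Sm) (j : Fin 3) (x : E3) :
    (Sm.d j (dil r f)).1 x = r * (Sm.d j f).1 (r • x) := by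
  have h : HasFDerivAt (fun y : E3 => r • y) (r • ContinuousLinearMap.id ℝ E3) x :=
    (r • ContinuousLinearMap.id ℝ E3).hasFDerivAt
  have h2 := (Sm.differentiable f (r • x)).hasFDerivAt.comp x h
  change fderiv ℝ (f.1 ∘ fun y : E3 => r • y) x _ = r * fderiv ℝ f.1 (r • x) _
  rw [h2.fderiv]
  simp

/-- The factor r from the chain rule is absorbed by the coordinate in front. Integration by parts at
radius r thus reduces to the unit sphere. -/
lemma ang_dil (r : ℝ) (f : Sm) (j : Fin 3) :
    smoothCalc.ang j (dil r f) = dil r (smoothCalc.ang j f) := by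
  ext x
  change (Sm.X _).1 x * (Sm.d _ (dil r f)).1 x - (Sm.X _).1 x * (Sm.d _ (dil r f)).1 x =
    (Sm.X _).1 (r • x) * (Sm.d _ f).1 (r • x) - (Sm.X _).1 (r • x) * (Sm.d _ f).1 (r • x)
  simp only [d_dil, Sm.X_apply, PiLp.smul_apply, smul_eq_mul, Complex.ofReal_mul]
  ring

/-- Integration by parts on the sphere. -/
lemma coef_ang (j : Fin 3) (f q : Sm) (r : ℝ) :
    coef (smoothCalc.ang j f) q r = -coef f (smoothCalc.ang j q) r := by
  have h := integral_ang j (dil r f * q)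
  rw [VecCalc.ang_mul, ang_dil] at h
  rw [eq_neg_iff_add_eq_zero, ← h]
  exact (integral_add (integrable_coef _ _ r) (integrable_coef _ _ r)).symm

end ElasticOtI

namespace ElasticOtI

/-! ### Harmonic polynomials and radial coefficients of Helmholtz fields -/

/-- Homogeneous harmonic polynomials of degree `n`. -/
def IsHarm (n : ℕ) (p : MvPolynomial (Fin 3) ℂ) : Prop :=
  p.IsHomogeneous n ∧ polyCalc.lap p = 0

lemma polyCalc_eul {n : ℕ} {p : MvPolynomial (Fin 3) ℂ} (hp : p.IsHomogeneous n) :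
    polyCalc.eul p = (n : ℂ) • p := by
  have h := hp.sum_X_mul_pderiv
  rw [Nat.cast_smul_eq_nsmul]
  exact h

lemma isHomogeneous_ang {n : ℕ} {p : MvPolynomial (Fin 3) ℂ} (hp : p.IsHomogeneous n)
    (j : Fin 3) : (polyCalc.ang j p).IsHomogeneous n := by
  have h : ∀ a b : Fin 3, (MvPolynomial.X a * MvPolynomial.pderiv b p).IsHomogeneous n := by
    intro a b
    -- Degree 0 is separate: n - 1 is truncated there, and counting degrees in X · ∂p would give 1.
    rcases n with _ | n
    · obtain ⟨c, rfl⟩ : ∃ c, p = MvPolynomial.C c :=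
        ⟨_, (MvPolynomial.totalDegree_eq_zero_iff_eq_C).mp
          (Nat.le_zero.mp hp.totalDegree_le)⟩
      simp [MvPolynomial.isHomogeneous_zero]
    · have := (MvPolynomial.isHomogeneous_X ℂ a).mul (hp.pderiv (i := b))
      simpa [add_comm] using this
  exact (h _ _).sub (h _ _)

lemma IsHarm.ang {n : ℕ} {p : MvPolynomial (Fin 3) ℂ} (hp : IsHarm n p) (j : Fin 3) :
    IsHarm n (polyCalc.ang j p) :=
  ⟨isHomogeneous_ang hp.1 j, by rw [VecCalc.lap_ang, hp.2]; simp [VecCalc.ang]⟩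

/-- In `rsq_mul_lap` the Laplacian drops out and the Euler operator acts as n, leaving -(n² + n). -/
lemma polyCalc_sum_ang_ang {n : ℕ} {p : MvPolynomial (Fin 3) ℂ} (hp : IsHarm n p) :
    ∑ j, polyCalc.ang j (polyCalc.ang j p) = (-((n : ℂ) * (n + 1))) • p := by
  have h := polyCalc.rsq_mul_lap p
  rw [hp.2, mul_zero, polyCalc_eul hp.1] at h
  have h2 : polyCalc.eul ((n : ℂ) • p) = (n : ℂ) • polyCalc.eul p := by
    simp only [VecCalc.eul, Finset.smul_sum, Derivation.map_smul, mul_smul_comm]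
  rw [h2, polyCalc_eul hp.1, add_comm] at h
  rw [eq_neg_of_add_eq_zero_left h.symm, smul_smul, ← add_smul, ← neg_smul]
  congr 1
  ring

/-- The coefficientwise complex conjugate of a polynomial. -/
noncomputable def pconj (p : MvPolynomial (Fin 3) ℂ) : MvPolynomial (Fin 3) ℂ :=
  MvPolynomial.map (starRingEnd ℂ) p

lemma polyFun_pconj (p : MvPolynomial (Fin 3) ℂ) (x : E3) :
    (polyFun (pconj p)).1 x = conj ((polyFun p).1 x) := by
  rw [polyFun_apply, polyFun_apply, pconj, MvPolynomial.eval_map, MvPolynomial.eval₂_eq',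
    MvPolynomial.eval_eq', map_sum]
  refine Finset.sum_congr rfl fun d _ => ?_
  simp [map_prod]

lemma pconj_d (j : Fin 3) (p : MvPolynomial (Fin 3) ℂ) :
    pconj (polyCalc.d j p) = polyCalc.d j (pconj p) := MvPolynomial.pderiv_map.symm

lemma IsHarm.pconj {n : ℕ} {p : MvPolynomial (Fin 3) ℂ} (hp : IsHarm n p) :
    IsHarm n (pconj p) := by
  refine ⟨hp.1.map _, ?_⟩
  have h := congrArg ElasticOtI.pconj hp.2
  simp only [VecCalc.lap, ← pconj_d] at h ⊢
  simpa [ElasticOtI.pconj] using h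

lemma coef_mul_X (f : Fin 3 → Sm) (q : Sm) (r : ℝ) :
    (r : ℂ) * ∑ j, coef (f j) (Sm.X j * q) r = coef (smoothCalc.xdot f) q r := by
  rw [VecCalc.xdot, coef_sum_left, Finset.mul_sum]
  refine Finset.sum_congr rfl fun j _ => ?_
  rw [← coef_smul_left]
  refine coef_congr fun y => ?_
  change (r : ℂ) * (f j).1 _ * ((Sm.X j).1 y * q.1 y) = (Sm.X j).1 _ * (f j).1 _ * q.1 y
  simp only [Sm.X_apply, PiLp.smul_apply, smul_eq_mul, Complex.ofReal_mul]
  ring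

/-- The triple product is antisymmetric. The factor r appears because the first argument is
evaluated at r y, where the position vector is r y, and the second at y. -/
lemma coef_xcross (v w : Fin 3 → Sm) (r : ℝ) :
    (r : ℂ) * ∑ j, coef (v j) (smoothCalc.xcross w j) r
      = -∑ j, coef (smoothCalc.xcross v j) (w j) r := by
  have h : ∀ (a j b : Fin 3), (r : ℂ) * coef (v j) (Sm.X a * w b) r = coef (Sm.X a * v j) (w b) r := by
    intro a j b
    rw [← coef_smul_left]
    refine coef_congr fun y => ?_
    change (r : ℂ) * (v j).1 _ * ((Sm.X a).1 y * (w b).1 y) = (Sm.X a).1 _ * (v j).1 _ * (w b).1 y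
    simp only [Sm.X_apply, PiLp.smul_apply, smul_eq_mul, Complex.ofReal_mul]
    ring
  have hX : smoothCalc.X = Sm.X := rfl
  obtain ⟨a1, a2, a3, a4⟩ := VecCalc.fin3_add
  simp only [VecCalc.xcross, sub_eq_add_neg, coef_add_left, coef_add_right, coef_neg_left,
    coef_neg_right, Fin.sum_univ_three, hX, a1, a2, a3, a4, zero_add, mul_add, mul_neg, h]
  ring

lemma polyFun_sum_ang_ang {n : ℕ} {p : MvPolynomial (Fin 3) ℂ} (hp : IsHarm n p) :
    ∑ j, smoothCalc.ang j (smoothCalc.ang j (polyFun p))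
      = (-((n : ℂ) * (n + 1))) • polyFun p := by
  rw [← map_smul, ← polyCalc_sum_ang_ang hp, map_sum]
  simp only [polyFun_compat.ang]

/-- Integration by parts followed by the eigenvalue equation; only the second argument has to be
harmonic. -/
lemma coef_ang_ang {n : ℕ} {p : MvPolynomial (Fin 3) ℂ} (hp : IsHarm n p) (f : Sm) (r : ℝ) :
    ∑ j, coef (smoothCalc.ang j f) (smoothCalc.ang j (polyFun p)) r
      = (n : ℂ) * (n + 1) * coef f (polyFun p) r := by
  simp only [coef_ang]
  rw [Finset.sum_neg_distrib, ← coef_sum_right, polyFun_sum_ang_ang hp, coef_smul_right]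
  ring

lemma norm_smul_sphere {r : ℝ} (hr : 0 ≤ r) (y : S2) : ‖r • (y : E3)‖ = r := by
  rw [norm_smul, norm_eq_of_mem_sphere, mul_one, Real.norm_of_nonneg hr]

lemma rsq_apply (x : E3) : (smoothCalc.rsq).1 x = ((‖x‖ ^ 2 : ℝ) : ℂ) := by
  rw [EuclideanSpace.norm_sq_eq]
  simp only [VecCalc.rsq, Fin.sum_univ_three, Real.norm_eq_abs, sq_abs]
  push_cast
  rfl

/-- Coefficients of solutions of the Helmholtz equation solve the spherical Bessel equation. -/
lemma isBessel_coef {k a : ℝ} (ha : 0 ≤ a) {f : Sm}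
    (hf : ∀ x : E3, a < ‖x‖ → (smoothCalc.lap f).1 x = -(k : ℂ) ^ 2 * f.1 x) {n : ℕ}
    {p : MvPolynomial (Fin 3) ℂ} (hp : IsHarm n p) :
    IsBessel k n a (coef f (polyFun p)) (coef (smoothCalc.eul f) (polyFun p)) := by
  intro r hr
  have hr0 : 0 < r := ha.trans_lt hr
  refine ⟨hasDerivAt_coef f _ hr0.ne', (hasDerivAt_coef _ _ hr0.ne').congr_deriv ?_⟩
  congr 1
  have h1 : coef (smoothCalc.rsq * smoothCalc.lap f) (polyFun p) r
      = -(k : ℂ) ^ 2 * r ^ 2 * coef f (polyFun p) r := by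
    rw [← coef_smul_left]
    refine coef_congr fun y => ?_
    change (smoothCalc.rsq).1 _ * (smoothCalc.lap f).1 _ * _ = _ * f.1 _ * _
    rw [rsq_apply, norm_smul_sphere hr0.le, hf _ (by rwa [norm_smul_sphere hr0.le])]
    push_cast
    ring
  have h2 : coef (∑ j, smoothCalc.ang j (smoothCalc.ang j f)) (polyFun p) r
      = -((n : ℂ) * (n + 1)) * coef f (polyFun p) r := by
    rw [coef_sum_left]
    simp only [coef_ang _ (smoothCalc.ang _ f)]
    rw [Finset.sum_neg_distrib, coef_ang_ang hp]
    ring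
  rw [VecCalc.rsq_mul_lap, coef_add_left, coef_add_left, h2] at h1
  linear_combination h1

/-- The radiation condition passes to coefficients. -/
lemma tendsto_coef_radiation {k : ℝ} {f g : Sm}
    (h : Tendsto (fun x : E3 => g.1 x - Complex.I * ((k * ‖x‖ : ℝ) : ℂ) * f.1 x)
      (Bornology.cobounded E3) (𝓝 0)) (q : Sm) :
    Tendsto (fun r : ℝ => coef g q r - Complex.I * ((k * r : ℝ) : ℂ) * coef f q r) atTop (𝓝 0) := by
  have hr : ∀ y : S2, Tendsto (fun r : ℝ => r • (y : E3)) atTop (Bornology.cobounded E3) := by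
    intro y
    rw [← tendsto_norm_atTop_iff_cobounded]
    refine tendsto_id.congr' ?_
    filter_upwards [eventually_ge_atTop 0] with r hr
    exact (norm_smul_sphere hr y).symm
  have h1 : Tendsto (fun r : ℝ => ∫ y : S2, (g.1 (r • (y : E3))
      - Complex.I * ((k * ‖r • (y : E3)‖ : ℝ) : ℂ) * f.1 (r • (y : E3))) * q.1 y ∂sigma2) atTop
      (𝓝 (∫ y : S2, 0 * q.1 y ∂sigma2)) := by
    refine tendsto_integral_filter_of_dominated_convergence (fun y => ‖q.1 (y : E3)‖) ?_ ?_ ?_ ?_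
    · refine .of_forall fun r => Continuous.aestronglyMeasurable ?_
      have h1 := continuous_dilate_right f r
      have h2 := continuous_dilate_right g r
      have h3 := continuous_restrict q
      have h4 : Continuous fun y : S2 => ((k * ‖r • (y : E3)‖ : ℝ) : ℂ) := by fun_prop
      exact (h2.sub ((continuous_const.mul h4).mul h1)).mul h3
    · have h2 := h.norm
      rw [norm_zero] at h2
      have h3 := h2.eventually_le_const one_pos
      rw [← comap_norm_atTop, eventually_comap] at h3
      filter_upwards [h3, eventually_ge_atTop 0] with r hr hr0
      refine .of_forall fun y => ?_
      rw [norm_mul]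
      exact mul_le_of_le_one_left (norm_nonneg _) (hr _ (norm_smul_sphere hr0 y))
    · exact integrable_of_continuous (continuous_restrict q).norm
    · exact .of_forall fun y => (h.comp (hr y)).mul_const _
  simp only [zero_mul, integral_zero] at h1
  refine h1.congr' ?_
  filter_upwards [eventually_ge_atTop 0] with r hr
  rw [coef, coef, ← integral_const_mul, ← integral_sub (integrable_coef g q r)
    ((integrable_coef f q r).const_mul _)]
  refine integral_congr_ae (.of_forall fun y => ?_)
  simp only [norm_smul_sphere hr]
  ring

/-! ### Outgoing coefficients of radiating fields. -/

/-- The outgoing condition `x · ∇ f - i k |x| f → 0` for a smooth function. -/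
def IsRadiating (k : ℝ) (f : Sm) : Prop :=
  Tendsto (fun x : E3 => (smoothCalc.eul f).1 x - Complex.I * ((k * ‖x‖ : ℝ) : ℂ) * f.1 x)
    (Bornology.cobounded E3) (𝓝 0)

lemma exists_coef_eq_hankelS {k a : ℝ} (hk : 0 < k) (ha : 0 ≤ a) {f : Sm}
    (hf : ∀ x : E3, a < ‖x‖ → (smoothCalc.lap f).1 x = -(k : ℂ) ^ 2 * f.1 x)
    (hrad : IsRadiating k f) {n : ℕ} {p : MvPolynomial (Fin 3) ℂ} (hp : IsHarm n p) :
    ∃ α : ℂ, ∀ r, a < r → coef f (polyFun p) r = α * hankelS k n r := by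
  obtain ⟨α, h⟩ := (isBessel_coef ha hf hp).eq_hankelS hk ha (tendsto_coef_radiation hrad _)
  exact ⟨α, fun r hr => (h r hr).1⟩

/-- Coefficients of a scalar Helmholtz field whose gradient is radiating. -/
lemma exists_coef_eq_of_grad {k a : ℝ} (hk : 0 < k) (ha : 0 ≤ a) {f : Sm}
    (hf : ∀ x : E3, a < ‖x‖ → (smoothCalc.lap f).1 x = -(k : ℂ) ^ 2 * f.1 x)
    (hrad : ∀ j, IsRadiating k (Sm.d j f)) {n : ℕ} {p : MvPolynomial (Fin 3) ℂ}
    (hp : IsHarm n p) :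
    ∃ α : ℂ, ∀ r, a < r → coef f (polyFun p) r = α * hankelS k n r ∧
      coef (smoothCalc.eul f) (polyFun p) r = α * hankelS1 k n r := by
  have hB := isBessel_coef ha hf hp
  refine hB.eq_hankelS hk ha ?_
  obtain ⟨t0, t1⟩ := hB.tendsto_zero hk ha
  have hkc : (k : ℂ) ≠ 0 := by exact_mod_cast hk.ne'
  -- The conditions on ∂_j f are tested with y_j p and summed. The two sums are the coefficients of
  -- x · ∇f and of its second order analogue, divided by r. The Bessel equation removes the second
  -- derivative, and up to multiples of F / r and F1 / r the outcome is -i k (F1 - i k r F); this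
  -- explains the factor i / k below.
  have h1 : Tendsto (fun r : ℝ => ∑ j, (coef (smoothCalc.eul (Sm.d j f)) (Sm.X j * polyFun p) r
      - Complex.I * ((k * r : ℝ) : ℂ) * coef (Sm.d j f) (Sm.X j * polyFun p) r)) atTop (𝓝 0) := by
    simpa using tendsto_finsetSum Finset.univ
      fun j _ => tendsto_coef_radiation (hrad j) (Sm.X j * polyFun p)
  have h2 := (((h1.add (t1.const_mul 2)).sub
    ((t0.mul tendsto_ofReal_inv).const_mul ((n : ℂ) * (n + 1)))).const_mul (Complex.I / k))
  simp only [mul_zero, add_zero, sub_zero] at h2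
  refine h2.congr' ?_
  filter_upwards [eventually_gt_atTop a] with r hr
  have hr0 : 0 < r := ha.trans_lt hr
  have hrc : (r : ℂ) ≠ 0 := by exact_mod_cast hr0.ne'
  rw [Finset.sum_sub_distrib, ← Finset.mul_sum]
  have e1 := coef_mul_X (fun j => smoothCalc.eul (Sm.d j f)) (polyFun p) r
  have e2 := coef_mul_X (fun j => Sm.d j f) (polyFun p) r
  have e3 : smoothCalc.xdot (fun j => smoothCalc.eul (Sm.d j f))
      = smoothCalc.eul (smoothCalc.eul f) - smoothCalc.eul f := smoothCalc.xdot_eul_d f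
  have e4 : smoothCalc.xdot (fun j => Sm.d j f) = smoothCalc.eul f := rfl
  have e5 := (hasDerivAt_coef (smoothCalc.eul f) (polyFun p) hr0.ne').unique (hB r hr).2
  rw [e3, sub_eq_add_neg, coef_add_left, coef_neg_left] at e1
  rw [e4] at e2
  rw [div_left_inj' hrc] at e5
  rw [e5] at e1
  set Z1 := ∑ j, coef (smoothCalc.eul (Sm.d j f)) (Sm.X j * polyFun p) r
  set Z2 := ∑ j, coef (Sm.d j f) (Sm.X j * polyFun p) r
  set F := coef f (polyFun p) r
  set F1 := coef (smoothCalc.eul f) (polyFun p) r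
  have e1' : Z1 = (-F1 + ((n : ℂ) * (n + 1) - (k : ℂ) ^ 2 * r ^ 2) * F + -F1) / r := by
    rw [← e1]; field_simp
  have e2' : Z2 = F1 / r := by rw [← e2]; field_simp
  rw [e1', e2']
  push_cast
  field_simp
  ring_nf
  simp only [Complex.I_sq]
  ring

/-- Both the cross product and the angular derivative are moved onto v, where `sum_ang_xcross` and
the vanishing divergence leave only x · v. -/
lemma sum_coef_xcross_ang {v : Fin 3 → Sm} (hdiv : smoothCalc.div v = 0) (q : Sm) (r : ℝ) :
    (r : ℂ) * ∑ i, coef (v i) (smoothCalc.xcross (fun a => smoothCalc.ang a q) i) r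
      = -(coef (smoothCalc.xdot v) q r + coef (smoothCalc.eul (smoothCalc.xdot v)) q r) := by
  rw [coef_xcross]
  have : ∀ j, coef (smoothCalc.xcross v j) (smoothCalc.ang j q) r
      = -coef (smoothCalc.ang j (smoothCalc.xcross v j)) q r := fun j => by
    rw [coef_ang, neg_neg]
  simp only [this]
  rw [Finset.sum_neg_distrib, neg_neg, ← coef_sum_left, VecCalc.sum_ang_xcross, hdiv, mul_zero,
    zero_sub, sub_eq_add_neg, coef_add_left, coef_neg_left, coef_neg_left]
  ring

/-- Coefficients of `x · v` for a solenoidal radiating Helmholtz field `v`. -/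
lemma exists_coef_xdot_eq {k a : ℝ} (hk : 0 < k) (ha : 0 ≤ a) {v : Fin 3 → Sm}
    (hv : ∀ j, ∀ x : E3, a < ‖x‖ → (smoothCalc.lap (v j)).1 x = -(k : ℂ) ^ 2 * (v j).1 x)
    (hdiv : smoothCalc.div v = 0)
    (hrad : ∀ j, IsRadiating k (v j)) {n : ℕ} {p : MvPolynomial (Fin 3) ℂ}
    (hp : IsHarm n p) :
    ∃ α : ℂ, ∀ r, a < r → coef (smoothCalc.xdot v) (polyFun p) r = α * hankelS k n r ∧
      coef (smoothCalc.eul (smoothCalc.xdot v)) (polyFun p) r = α * hankelS1 k n r := by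
  have hX : ∀ x : E3, a < ‖x‖ → (smoothCalc.lap (smoothCalc.xdot v)).1 x
      = -(k : ℂ) ^ 2 * (smoothCalc.xdot v).1 x := by
    intro x hx
    rw [VecCalc.lap_xdot, hdiv, mul_zero, add_zero]
    simp only [VecCalc.xdot, Fin.sum_univ_three]
    change (Sm.X 0).1 x * (smoothCalc.lap (v 0)).1 x + (Sm.X 1).1 x * (smoothCalc.lap (v 1)).1 x
      + (Sm.X 2).1 x * (smoothCalc.lap (v 2)).1 x = _ * ((Sm.X 0).1 x * (v 0).1 x
      + (Sm.X 1).1 x * (v 1).1 x + (Sm.X 2).1 x * (v 2).1 x)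
    rw [hv 0 x hx, hv 1 x hx, hv 2 x hx]
    ring
  have hB := isBessel_coef ha hX hp
  refine hB.eq_hankelS hk ha ?_
  obtain ⟨t0, t1⟩ := hB.tendsto_zero hk ha
  have hkc : (k : ℂ) ≠ 0 := by exact_mod_cast hk.ne'
  set w : Fin 3 → Sm := smoothCalc.xcross (fun i => smoothCalc.ang i (polyFun p)) with hw
  set G := coef (smoothCalc.xdot v) (polyFun p)
  set G1 := coef (smoothCalc.eul (smoothCalc.xdot v)) (polyFun p)
  -- The radiation condition for v cannot simply be multiplied by x, since that costs a power of r.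
  -- Testing v with the tangential field w instead gives access to x · v without the loss.
  have hZ : ∀ r : ℝ, (r : ℂ) * ∑ j, coef (v j) (w j) r = -(G r + G1 r) :=
    sum_coef_xcross_ang hdiv _
  have h1 : Tendsto (fun r : ℝ => ∑ j, (coef (smoothCalc.eul (v j)) (w j) r
      - Complex.I * ((k * r : ℝ) : ℂ) * coef (v j) (w j) r)) atTop (𝓝 0) := by
    simpa using tendsto_finsetSum Finset.univ
      fun j _ => tendsto_coef_radiation (hrad j) (w j)
  have h2 := ((((h1.sub t1).add
    ((t0.mul tendsto_ofReal_inv).const_mul ((n : ℂ) * (n + 1) - 1))).const_mul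
    (-Complex.I / k)).sub t0)
  simp only [mul_zero, add_zero, sub_zero] at h2
  refine h2.congr' ?_
  filter_upwards [eventually_gt_atTop a] with r hr
  have hr0 : 0 < r := ha.trans_lt hr
  have hrc : (r : ℂ) ≠ 0 := by exact_mod_cast hr0.ne'
  rw [Finset.sum_sub_distrib, ← Finset.mul_sum]
  -- Differentiating `hZ` in r yields the pairing of x · ∇v with w. After the Bessel equation is
  -- inserted, the radiation condition reads i k (G1 - i k r G) → 0 up to terms already known to
  -- vanish.
  have d1 : HasDerivAt (fun s => ∑ j, coef (v j) (w j) s)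
      (∑ j, coef (smoothCalc.eul (v j)) (w j) r / r) r :=
    HasDerivAt.fun_sum fun j _ => hasDerivAt_coef (v j) (w j) hr0.ne'
  have d2 := (Complex.ofRealCLM.hasDerivAt (x := r)).fun_mul d1
  obtain ⟨b1, b2⟩ := hB r hr
  have d3 := (b1.fun_add b2).fun_neg
  simp only [Complex.ofRealCLM_apply, hZ] at d2
  have e5 := d2.unique d3
  have e6 := hZ r
  rw [← Finset.sum_div] at e5
  simp only [Complex.ofReal_one] at e5
  set Z1 := ∑ j, coef (smoothCalc.eul (v j)) (w j) r
  set Z2 := ∑ j, coef (v j) (w j) r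
  have e2' : Z2 = -(G r + G1 r) / r := by rw [← e6]; field_simp
  have e1' : Z1 = -(G1 r / r + (-G1 r + ((n : ℂ) * (n + 1) - (k : ℂ) ^ 2 * r ^ 2) * G r) / r)
      - Z2 := by
    rw [← e5]; field_simp; ring
  rw [e1', e2']
  push_cast
  field_simp
  ring_nf
  simp only [Complex.I_sq]
  ring

end ElasticOtI

/-! ### Further identities for the Laplacian and the angular derivatives. -/

namespace VecCalc

variable {A : Type*} [CommRing A] [Algebra ℂ A] (S : VecCalc A)

lemma lap_rsq_mul (f : A) : S.lap (S.rsq * f) = S.rsq * S.lap f + 4 * S.eul f + 6 * f := by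
  simp [lap, rsq, eul, Fin.sum_univ_three, S.d_X, Derivation.leibniz, smul_eq_mul, pow_two]
  ring

lemma lap_smul (c : ℂ) (f : A) : S.lap (c • f) = c • S.lap f := by
  simp only [lap, Derivation.map_smul, Finset.smul_sum]

lemma lap_add (f g : A) : S.lap (f + g) = S.lap f + S.lap g := by
  simp only [lap, map_add, Finset.sum_add_distrib]

lemma lap_sub (f g : A) : S.lap (f - g) = S.lap f - S.lap g := by
  simp only [lap, map_sub, Finset.sum_sub_distrib]

lemma ang_add (j : Fin 3) (f g : A) : S.ang j (f + g) = S.ang j f + S.ang j g := by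
  simp only [ang, map_add]
  ring

lemma ang_smul (j : Fin 3) (c : ℂ) (f : A) : S.ang j (c • f) = c • S.ang j f := by
  simp only [ang, Derivation.map_smul, mul_smul_comm, smul_sub]

end VecCalc

namespace ElasticOtI

/-! ### Harmonic decomposition of polynomials and polynomial fields. -/

/-- Complex polynomials on `ℝ³`. -/
abbrev Poly : Type := MvPolynomial (Fin 3) ℂ

lemma isHomogeneous_rsq : (polyCalc.rsq).IsHomogeneous 2 :=
  MvPolynomial.IsHomogeneous.sum _ _ _ fun i _ => by
    have h := (MvPolynomial.isHomogeneous_X ℂ i).pow 2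
    rwa [one_mul] at h

lemma isHomogeneous_lap {n : ℕ} {p : Poly} (hp : p.IsHomogeneous n) :
    (polyCalc.lap p).IsHomogeneous (n - 2) :=
  MvPolynomial.IsHomogeneous.sum _ _ _ fun _ _ => hp.pderiv.pderiv

lemma pderiv_eq_zero_of_isHomogeneous_zero {p : Poly} (hp : p.IsHomogeneous 0) (i : Fin 3) :
    MvPolynomial.pderiv i p = 0 := by
  obtain ⟨c, rfl⟩ : ∃ c, p = MvPolynomial.C c :=
    ⟨_, (MvPolynomial.totalDegree_eq_zero_iff_eq_C).mp (Nat.le_zero.mp hp.totalDegree_le)⟩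
  simp

lemma lap_rsq_pow_mul {m : ℕ} {h : Poly} (hh : IsHarm m h) (s : ℕ) :
    polyCalc.lap (polyCalc.rsq ^ (s + 1) * h)
      = ((2 * (s + 1) * (2 * s + 2 * m + 3) : ℕ) : ℂ) • (polyCalc.rsq ^ s * h) := by
  induction s with
  | zero =>
    rw [zero_add, pow_one, VecCalc.lap_rsq_mul, hh.2, polyCalc_eul hh.1]
    simp only [MvPolynomial.smul_eq_C_mul]
    push_cast
    simp only [map_add, map_mul, map_ofNat, map_zero]
    ring
  | succ s ih =>
    have hom : (polyCalc.rsq ^ (s + 1) * h).IsHomogeneous (2 * (s + 1) + m) :=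
      (isHomogeneous_rsq.pow (s + 1)).mul hh.1
    rw [pow_succ', mul_assoc, VecCalc.lap_rsq_mul, ih, polyCalc_eul hom]
    simp only [MvPolynomial.smul_eq_C_mul]
    push_cast
    simp only [map_add, map_mul, map_one, map_ofNat]
    ring

/-- The span of the products of powers of `|x|²` and harmonic polynomials, of total degree `n`. -/
noncomputable def harmSpan (n : ℕ) : Submodule ℂ Poly :=
  Submodule.span ℂ {q | ∃ s m h, 2 * s + m = n ∧ IsHarm m h ∧ q = polyCalc.rsq ^ s * h}

/-- On each generator the preimage is explicit, because the factor 2(s + 1)(2s + 2m + 3) in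
`lap_rsq_pow_mul` never vanishes. -/
lemma exists_lap_eq {n : ℕ} {q : Poly} (hq : q ∈ harmSpan n) :
    ∃ p ∈ harmSpan (n + 2), polyCalc.lap p = q := by
  induction hq using Submodule.span_induction with
  | mem q hq =>
    obtain ⟨s, m, h, hn, hh, rfl⟩ := hq
    refine ⟨((2 * (s + 1) * (2 * s + 2 * m + 3) : ℕ) : ℂ)⁻¹ • (polyCalc.rsq ^ (s + 1) * h),
      Submodule.smul_mem _ _ (Submodule.subset_span ⟨s + 1, m, h, by omega, hh, rfl⟩), ?_⟩
    rw [VecCalc.lap_smul, lap_rsq_pow_mul hh, smul_smul, inv_mul_cancel₀, one_smul]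
    exact Nat.cast_ne_zero.mpr (by positivity)
  | zero => exact ⟨0, Submodule.zero_mem _, by simp [VecCalc.lap]⟩
  | add p q _ _ hp hq =>
    obtain ⟨p', hp1, hp2⟩ := hp
    obtain ⟨q', hq1, hq2⟩ := hq
    exact ⟨p' + q', Submodule.add_mem _ hp1 hq1, by rw [VecCalc.lap_add, hp2, hq2]⟩
  | smul c p _ hp =>
    obtain ⟨p', hp1, hp2⟩ := hp
    exact ⟨c • p', Submodule.smul_mem _ _ hp1, by rw [VecCalc.lap_smul, hp2]⟩

lemma isHomogeneous_of_mem_harmSpan {n : ℕ} {q : Poly} (hq : q ∈ harmSpan n) :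
    q.IsHomogeneous n := by
  induction hq using Submodule.span_induction with
  | mem q hq =>
    obtain ⟨s, m, h, hn, hh, rfl⟩ := hq
    exact hn ▸ (isHomogeneous_rsq.pow s).mul hh.1
  | zero => exact MvPolynomial.isHomogeneous_zero _ _ _
  | add p q _ _ hp hq => exact hp.add hq
  | smul c p _ hp =>
    rw [MvPolynomial.smul_eq_C_mul]
    exact hp.C_mul c

/-- Every homogeneous polynomial is a sum of products of powers of `|x|²` and harmonic
polynomials. -/
theorem mem_harmSpan (n : ℕ) : ∀ p : Poly, p.IsHomogeneous n → p ∈ harmSpan n := by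
  induction n using Nat.strong_induction_on with
  | _ n ih =>
    intro p hp
    have hharm : ∀ q : Poly, IsHarm n q → q ∈ harmSpan n := fun q hq =>
      Submodule.subset_span ⟨0, n, q, by simp, hq, by simp⟩
    rcases Nat.lt_or_ge n 2 with hn | hn
    · refine hharm p ⟨hp, Finset.sum_eq_zero fun j _ => ?_⟩
      have h1 : (MvPolynomial.pderiv j p).IsHomogeneous 0 := by
        have := hp.pderiv (i := j)
        rwa [show n - 1 = 0 by omega] at this
      exact pderiv_eq_zero_of_isHomogeneous_zero h1 j
    -- By induction Δp lies in the span of degree n - 2, so it equals Δq with q in the span of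
    -- degree n; then p - q is harmonic.
    · obtain ⟨q, hq, hq2⟩ := exists_lap_eq (ih (n - 2) (by omega) _ (isHomogeneous_lap hp))
      rw [Nat.sub_add_cancel hn] at hq
      rw [← sub_add_cancel p q]
      refine Submodule.add_mem _ (hharm _ ⟨hp.sub (isHomogeneous_of_mem_harmSpan hq), ?_⟩) hq
      rw [VecCalc.lap_sub, hq2, sub_self]

/-- The radial fields `x q`. -/
noncomputable def fieldW : Poly →ₗ[ℂ] (Fin 3 → Poly) where
  toFun q j := polyCalc.X j * q
  map_add' p q := by ext1 j; exact mul_add _ _ _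
  map_smul' c q := by ext1 j; exact mul_smul_comm _ _ _

/-- The toroidal fields `x × ∇ q`. -/
noncomputable def fieldV : Poly →ₗ[ℂ] (Fin 3 → Poly) where
  toFun q j := polyCalc.ang j q
  map_add' p q := by ext1 j; exact polyCalc.ang_add _ _ _
  map_smul' c q := by ext1 j; exact polyCalc.ang_smul _ _ _

/-- The tangential fields `x × (x × ∇ q)`. -/
noncomputable def fieldU : Poly →ₗ[ℂ] (Fin 3 → Poly) where
  toFun q := polyCalc.xcross (fun i => polyCalc.ang i q)
  map_add' p q := by
    ext1 j
    simp only [VecCalc.xcross, VecCalc.ang_add, Pi.add_apply]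
    ring
  map_smul' c q := by
    ext1 j
    simp only [VecCalc.xcross, VecCalc.ang_smul, Pi.smul_apply, mul_smul_comm, smul_sub,
      RingHom.id_apply]

/-- A submodule of vector fields which contains the three families of fields generated by
harmonic polynomials and is stable under multiplication and division by `|x|²` contains all
polynomial vector fields. -/
theorem eq_top_of_harmonic_fields (N : Submodule ℂ (Fin 3 → Poly))
    (hr : ∀ w, (fun j => polyCalc.rsq * w j) ∈ N ↔ w ∈ N)
    (hW : ∀ n h, IsHarm n h → fieldW h ∈ N)
    (hV : ∀ n h, IsHarm n h → fieldV h ∈ N)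
    (hU : ∀ n h, IsHarm n h → fieldU h ∈ N) : N = ⊤ := by
  -- extension from harmonic polynomials to all polynomials
  have ext : ∀ Φ : Poly →ₗ[ℂ] (Fin 3 → Poly),
      (∀ q, Φ (polyCalc.rsq * q) = fun j => polyCalc.rsq * Φ q j) →
      (∀ n h, IsHarm n h → Φ h ∈ N) → ∀ q, Φ q ∈ N := by
    intro Φ h1 h2 q
    rw [← MvPolynomial.sum_homogeneousComponent q, map_sum]
    refine Submodule.sum_mem _ fun n _ => ?_
    have hq := mem_harmSpan n _ (MvPolynomial.homogeneousComponent_isHomogeneous n q)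
    generalize MvPolynomial.homogeneousComponent n q = q at hq
    induction hq using Submodule.span_induction with
    | mem q hq =>
      obtain ⟨s, m, h, -, hh, rfl⟩ := hq
      induction s with
      | zero => simpa using h2 m h hh
      | succ s ih => rwa [pow_succ', mul_assoc, h1, hr]
    | zero => simp
    | add p q _ _ hp hq =>
      rw [map_add]
      exact Submodule.add_mem _ hp hq
    | smul c p _ hp =>
      rw [map_smul]
      exact Submodule.smul_mem _ _ hp
  have W : ∀ q, (fun j => polyCalc.X j * q) ∈ N := ext fieldW
    (fun q => by ext1 j; exact mul_left_comm _ _ _) hW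
  have V : ∀ q, (fun j => polyCalc.ang j q) ∈ N := ext fieldV
    (fun q => by ext1 j; exact polyCalc.ang_rsq_mul _ _) hV
  have U : ∀ q, polyCalc.xcross (fun i => polyCalc.ang i q) ∈ N := ext fieldU
    (fun q => by
      ext1 j
      simp only [fieldU, LinearMap.coe_mk, AddHom.coe_mk, VecCalc.xcross, VecCalc.ang_rsq_mul]
      ring) hU
  -- From |x|²∇f = x (x · ∇f) - x × (x × ∇f), after which |x|² is divided out.
  have grad : ∀ f, (fun j => polyCalc.d j f) ∈ N := by
    intro f
    rw [← hr]
    have h := Submodule.sub_mem _ (W (polyCalc.eul f)) (U f)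
    convert h using 1
    ext1 j
    rw [Pi.sub_apply, VecCalc.xcross_ang]
    ring
  have hom : ∀ l : ℕ, ∀ E : Fin 3 → Poly, (∀ j, (E j).IsHomogeneous l) → E ∈ N := by
    intro l
    induction l using Nat.strong_induction_on with
    | _ l ih =>
      intro E hE
      have hcurl : ∀ (m : ℕ) (F : Fin 3 → Poly), (∀ j, (F j).IsHomogeneous m) →
          ∀ j, (polyCalc.curl F j).IsHomogeneous (m - 1) := fun m F hF j =>
        (hF _).pderiv.sub (hF _).pderiv
      have hcurl0 : ∀ (F : Fin 3 → Poly), (∀ j, (F j).IsHomogeneous 0) → polyCalc.curl F = 0 := by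
        intro F hF
        ext1 j
        change MvPolynomial.pderiv _ _ - MvPolynomial.pderiv _ _ = 0
        rw [pderiv_eq_zero_of_isHomogeneous_zero (hF _), pderiv_eq_zero_of_isHomogeneous_zero (hF _),
          sub_zero]
      -- With C = curl E and K = curl C, the identity l x × C = x × ∇(x · C) - x (x · K) + |x|² K
      -- reduces the claim to K, of degree l - 2. The degrees 0 and 1 are separate because C or K
      -- vanishes there.
      have hC : polyCalc.xcross (polyCalc.curl E) ∈ N := by
        rcases Nat.eq_zero_or_pos l with rfl | hl
        · rw [hcurl0 E hE]
          convert Submodule.zero_mem N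
          ext1 j
          simp [VecCalc.xcross]
        · set C := polyCalc.curl E
          set K := polyCalc.curl C
          have hCh : ∀ j, (C j).IsHomogeneous (l - 1) := hcurl l E hE
          have hK : K ∈ N := by
            rcases Nat.lt_or_ge l 2 with h2 | h2
            · have : K = 0 := hcurl0 C (by rwa [show l - 1 = 0 by omega] at hCh)
              rw [this]
              exact Submodule.zero_mem _
            · exact ih (l - 1 - 1) (by omega) K (hcurl _ C hCh)
          have h := Submodule.sub_mem _ (V (polyCalc.xdot C))
            (Submodule.sub_mem _ (W (polyCalc.xdot K)) ((hr K).mpr hK))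
          have hl0 : (l : ℂ) ≠ 0 := by exact_mod_cast hl.ne'
          have hl1 : ((l - 1 : ℕ) : ℂ) = (l : ℂ) - 1 := by push_cast [Nat.cast_sub hl]; rfl
          have e : (fun j => polyCalc.ang j (polyCalc.xdot C)) - ((fun j => polyCalc.X j *
              polyCalc.xdot K) - fun j => polyCalc.rsq * K j) = (l : ℂ) • polyCalc.xcross C := by
            ext1 j
            have e1 : ∀ i, polyCalc.d i (polyCalc.xdot C) = (l : ℂ) • C i + polyCalc.xcross K i := by
              intro i
              rw [VecCalc.d_xdot, polyCalc_eul (hCh i), hl1, sub_smul, one_smul]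
              ring
            have e2 := polyCalc.xcross_xcross K j
            rw [Pi.sub_apply, Pi.sub_apply, ← e2, ← VecCalc.xcross_d, Pi.smul_apply]
            simp only [VecCalc.xcross, e1, MvPolynomial.smul_eq_C_mul]
            ring
          rw [e] at h
          simpa [smul_smul, inv_mul_cancel₀ hl0] using Submodule.smul_mem _ (l : ℂ)⁻¹ h
      have h := Submodule.sub_mem _ (grad (polyCalc.xdot E)) hC
      have hl0 : (l : ℂ) + 1 ≠ 0 := by exact_mod_cast Nat.succ_ne_zero l
      -- Euler's identity in `d_xdot`: a homogeneous field is recovered from ∇(x · E) and x × curl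
      -- E.
      have e : (fun j => polyCalc.d j (polyCalc.xdot E)) - polyCalc.xcross (polyCalc.curl E)
          = ((l : ℂ) + 1) • E := by
        ext1 j
        rw [Pi.sub_apply, VecCalc.d_xdot, polyCalc_eul (hE j), Pi.smul_apply, add_smul, one_smul]
        ring
      rw [e] at h
      simpa [smul_smul, inv_mul_cancel₀ hl0] using Submodule.smul_mem _ ((l : ℂ) + 1)⁻¹ h
  rw [eq_top_iff]
  intro E _
  set M := ∑ j, (E j).totalDegree with hM
  have hE : E = ∑ l ∈ Finset.range (M + 1), fun j => MvPolynomial.homogeneousComponent l (E j) := by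
    ext1 j
    rw [Finset.sum_apply]
    conv_lhs => rw [← MvPolynomial.sum_homogeneousComponent (E j)]
    refine Finset.sum_subset (Finset.range_subset_range.mpr ?_) fun l _ hl => ?_
    · exact Nat.succ_le_succ (Finset.single_le_sum (f := fun j => (E j).totalDegree)
        (fun _ _ => Nat.zero_le _) (Finset.mem_univ j))
    · exact MvPolynomial.homogeneousComponent_eq_zero _ _ (by simpa using hl)
  rw [hE]
  exact Submodule.sum_mem _ fun l _ => hom l _ fun j =>
    MvPolynomial.homogeneousComponent_isHomogeneous l _

/-! ### The dimension of the space of harmonic polynomials -/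

/-- The space of homogeneous harmonic polynomials of degree `n`. -/
def harmSub (n : ℕ) : Submodule ℂ Poly where
  carrier := {p | IsHarm n p}
  add_mem' hp hq := ⟨hp.1.add hq.1, by rw [VecCalc.lap_add, hp.2, hq.2, add_zero]⟩
  zero_mem' := ⟨MvPolynomial.isHomogeneous_zero _ _ _, by simp [VecCalc.lap]⟩
  smul_mem' c p hp := ⟨by
    rw [MvPolynomial.smul_eq_C_mul]
    exact hp.1.C_mul c, by rw [VecCalc.lap_smul, hp.2, smul_zero]⟩

/-- The exponent `(a, b, c)`. -/
noncomputable def expo (a b c : ℕ) : Fin 3 →₀ ℕ := Finsupp.equivFunOnFinite.symm ![a, b, c]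

lemma expo_apply (a b c : ℕ) : expo a b c 0 = a ∧ expo a b c 1 = b ∧ expo a b c 2 = c :=
  ⟨rfl, rfl, rfl⟩

/-- Laplace's equation expresses the coefficients with exponent a ≥ 2 of the first variable through
those with exponent a - 2, so the n + 1 coefficients with a = 0 and the n with a = 1 determine p. -/
lemma coeff_eq_zero_of_isHarm {n : ℕ} {p : Poly} (hp : IsHarm n p)
    (h0 : ∀ b, MvPolynomial.coeff (expo 0 b (n - b)) p = 0)
    (h1 : ∀ b, b < n → MvPolynomial.coeff (expo 1 b (n - 1 - b)) p = 0) :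
    ∀ (a : ℕ) (m : Fin 3 →₀ ℕ), m 0 = a → MvPolynomial.coeff m p = 0 := by
  intro a
  induction a using Nat.strong_induction_on with
  | _ a ih =>
    intro m hm
    by_contra hne
    have hdeg : m 0 + m 1 + m 2 = n := by
      have h := hp.1.degree_eq_sum_deg_support (MvPolynomial.mem_support_iff.mpr hne)
      rw [h, Finset.sum_subset (Finset.subset_univ _) (by simp), Fin.sum_univ_three]
    have hexpo : m = expo (m 0) (m 1) (m 2) := by
      ext i
      fin_cases i <;> simp [expo]
    rcases Nat.lt_or_ge a 2 with ha | ha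
    · obtain rfl | rfl : a = 0 ∨ a = 1 := by omega
      · apply hne
        rw [hexpo, hm, show m 2 = n - m 1 by omega]
        exact h0 _
      · apply hne
        rw [hexpo, hm, show m 2 = n - 1 - m 1 by omega]
        exact h1 _ (by omega)
    · set m' : Fin 3 →₀ ℕ := expo (a - 2) (m 1) (m 2) with hm'
      have hmm : m = m' + Finsupp.single 0 1 + Finsupp.single 0 1 := by
        have e0 : m 0 = a - 2 + 1 + 1 := by omega
        obtain ⟨x0, x1, x2⟩ := expo_apply (a - 2) (m 1) (m 2)
        ext i
        fin_cases i <;> simp [hm', x0, x1, x2, e0]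
      have hl := congrArg (MvPolynomial.coeff m') hp.2
      simp only [VecCalc.lap, polyCalc, Fin.sum_univ_three, MvPolynomial.coeff_add,
        MvPolynomial.coeff_pderiv, MvPolynomial.coeff_zero] at hl
      rw [ih (a - 2) (by omega) (m' + Finsupp.single 1 1 + Finsupp.single 1 1)
        (by simp [hm', (expo_apply _ _ _).1]), ih (a - 2) (by omega) (m' + Finsupp.single 2 1 + Finsupp.single 2 1)
        (by simp [hm', (expo_apply _ _ _).1]), ← hmm] at hl
      simp only [zero_mul, add_zero, mul_eq_zero, hne, false_or] at hl
      rcases hl with h | h <;> exact Nat.cast_add_one_ne_zero _ h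

/-- The linear map used to bound the dimension of `harmSub n`. -/
noncomputable def harmCoeff (n : ℕ) : harmSub n →ₗ[ℂ] (Fin (n + 1) → ℂ) × (Fin n → ℂ) where
  toFun p := (fun b => MvPolynomial.coeff (expo 0 b (n - b)) p.1,
    fun b => MvPolynomial.coeff (expo 1 b (n - 1 - b)) p.1)
  map_add' p q := by ext <;> simp
  map_smul' c p := by ext <;> simp

lemma harmCoeff_injective (n : ℕ) : Function.Injective (harmCoeff n) := by
  rw [injective_iff_map_eq_zero]
  rintro ⟨p, hp⟩ h
  obtain ⟨h0, h1⟩ := Prod.ext_iff.mp h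
  refine Subtype.ext (MvPolynomial.ext _ _ fun m => ?_)
  refine coeff_eq_zero_of_isHarm hp (fun b => ?_) (fun b hb => congrFun h1 ⟨b, hb⟩) (m 0) m rfl
  rcases Nat.lt_or_ge b (n + 1) with hb | hb
  · exact congrFun h0 ⟨b, hb⟩
  -- For b > n the truncated difference n - b is 0, so the exponent has degree b ≠ n.
  · refine hp.1.coeff_eq_zero fun hd => ?_
    rw [Finsupp.degree_eq_sum, Fin.sum_univ_three] at hd
    obtain ⟨x0, x1, x2⟩ := expo_apply 0 b (n - b)
    omega

instance (n : ℕ) : FiniteDimensional ℂ (harmSub n) :=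
  FiniteDimensional.of_injective (harmCoeff n) (harmCoeff_injective n)

lemma finrank_harmSub_le (n : ℕ) : Module.finrank ℂ (harmSub n) ≤ 2 * n + 1 := by
  refine (LinearMap.finrank_le_finrank_of_injective (harmCoeff_injective n)).trans ?_
  simp
  omega

end ElasticOtI

namespace ElasticOtI

/-! ### Density of polynomials in `L²` of the unit sphere -/

/-- The algebra of polynomial functions on the unit sphere. -/
noncomputable def spherePoly : StarSubalgebra ℂ C(S2, ℂ) where
  carrier := {c | ∃ q : Poly, ∀ y : S2, c y = (polyFun q).1 y}
  mul_mem' := by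
    rintro c c' ⟨q, hq⟩ ⟨q', hq'⟩
    refine ⟨q * q', fun y => ?_⟩
    rw [map_mul, ContinuousMap.mul_apply, hq, hq']
    rfl
  add_mem' := by
    rintro c c' ⟨q, hq⟩ ⟨q', hq'⟩
    refine ⟨q + q', fun y => ?_⟩
    rw [map_add, ContinuousMap.add_apply, hq, hq']
    rfl
  algebraMap_mem' a := ⟨MvPolynomial.C a, fun y => by
    rw [polyFun_apply, MvPolynomial.eval_C]
    rfl⟩
  star_mem' := by
    rintro c ⟨q, hq⟩
    exact ⟨pconj q, fun y => by rw [polyFun_pconj, ← hq]; rfl⟩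

/-- Stone–Weierstrass: the coordinate functions separate the points of the sphere. -/
lemma spherePoly_closure : spherePoly.topologicalClosure = ⊤ := by
  refine ContinuousMap.starSubalgebra_topologicalClosure_eq_top_of_separatesPoints _ ?_
  intro y z hyz
  by_contra hcon
  push Not at hcon
  refine hyz (Subtype.ext ?_)
  ext i
  have h := hcon (fun y : S2 => (polyFun (MvPolynomial.X i)).1 y)
    ⟨⟨_, continuous_restrict _⟩, ⟨MvPolynomial.X i, fun y => rfl⟩, rfl⟩
  simp only [polyFun_apply, MvPolynomial.eval_X] at h
  exact_mod_cast h

/-- Orthogonality is a closed condition, so it passes from polynomials to continuous functions,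
which are dense in L². -/
lemma eq_zero_of_integral_poly_mul (g : Lp ℂ 2 sigma2)
    (h : ∀ q : Poly, ∫ y : S2, (polyFun q).1 y * g y ∂sigma2 = 0) : g = 0 := by
  have h1 : ∀ c : C(S2, ℂ), inner ℂ (ContinuousMap.toLp (E := ℂ) 2 sigma2 ℂ c) g = 0 := by
    intro c
    have hc : c ∈ spherePoly.topologicalClosure := by rw [spherePoly_closure]; trivial
    have hclosed : IsClosed {c : C(S2, ℂ) |
        inner ℂ (ContinuousMap.toLp (E := ℂ) 2 sigma2 ℂ c) g = 0} :=
      isClosed_eq (by fun_prop) continuous_const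
    refine (closure_minimal ?_ hclosed) hc
    rintro c ⟨q, hq⟩
    change inner ℂ _ _ = _
    rw [L2.inner_def, ← h (pconj q)]
    refine integral_congr_ae ?_
    filter_upwards [ContinuousMap.coeFn_toLp (E := ℂ) (p := 2) (𝕜 := ℂ) sigma2 c] with y hy
    rw [hy, hq, polyFun_pconj, RCLike.inner_apply, mul_comm]
  have hd := ContinuousMap.toLp_denseRange ℂ sigma2 ℂ (p := 2) (by norm_num)
  exact hd.eq_zero_of_inner_right ℂ h1

/-! ### The space of square integrable fields on the unit sphere -/

/-- The Hilbert space of square integrable fields on the unit sphere. -/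
abbrev HS : Type := Lp C3 2 sigma2

/-- The trace of a smooth field on the sphere of radius `r`. -/
noncomputable def fieldAt (v : Fin 3 → Sm) (r : ℝ) (y : S2) : C3 :=
  WithLp.toLp 2 fun i => (v i).1 (r • (y : E3))

lemma continuous_fieldAt (v : Fin 3 → Sm) (r : ℝ) : Continuous (fieldAt v r) :=
  (PiLp.continuous_toLp 2 _).comp (continuous_pi fun i => continuous_dilate_right (v i) r)

lemma memLp_of_continuous {F : Type*} [NormedAddCommGroup F] {g : S2 → F} (hg : Continuous g) :
    MemLp g 2 sigma2 :=
  hg.memLp_of_hasCompactSupport (HasCompactSupport.of_compactSpace g)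

/-- The trace of a smooth field on the sphere of radius `r` as a square integrable field. -/
noncomputable def emb (v : Fin 3 → Sm) (r : ℝ) : HS :=
  (memLp_of_continuous (continuous_fieldAt v r)).toLp

lemma coeFn_emb (v : Fin 3 → Sm) (r : ℝ) : emb v r =ᵐ[sigma2] fieldAt v r := MemLp.coeFn_toLp _

lemma emb_smul (c : ℂ) (v : Fin 3 → Sm) (r : ℝ) : emb (c • v) r = c • emb v r := by
  rw [emb, emb, ← MemLp.toLp_const_smul]
  rfl

/-- The complex conjugate of a smooth function. -/
noncomputable def Sm.cj (f : Sm) : Sm :=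
  ⟨fun x => conj (f.1 x), Complex.conjCLE.contDiff.comp (Sm.contDiff f)⟩

lemma Sm.cj_apply (f : Sm) (x : E3) : (Sm.cj f).1 x = conj (f.1 x) := rfl

lemma inner_emb_left (v : Fin 3 → Sm) (g : HS) :
    inner ℂ (emb v 1) g = ∫ y : S2, ∑ i, (Sm.cj (v i)).1 y * g y i ∂sigma2 := by
  rw [L2.inner_def]
  refine integral_congr_ae ?_
  filter_upwards [coeFn_emb v 1] with y hy
  rw [hy, PiLp.inner_apply]
  refine Finset.sum_congr rfl fun i _ => ?_
  rw [RCLike.inner_apply, mul_comm, Sm.cj_apply, fieldAt, one_smul]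

lemma inner_emb_emb (v w : Fin 3 → Sm) (r : ℝ) :
    inner ℂ (emb v 1) (emb w r) = ∑ i, coef (w i) (Sm.cj (v i)) r := by
  rw [inner_emb_left]
  simp only [coef]
  rw [← integral_finsetSum _ fun i _ => integrable_coef _ _ _]
  refine integral_congr_ae ?_
  filter_upwards [coeFn_emb w r] with y hy
  rw [hy]
  exact Finset.sum_congr rfl fun i _ => mul_comm _ _

/-! ### Vector spherical harmonics -/

/-- The three vector spherical harmonics `V`, `U`, `W` built from a harmonic function of order
`n`, as smooth fields whose restrictions to the unit sphere are the columns of `M_n^m`. -/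
noncomputable def vsh (n : ℕ) (P : Sm) (j i : Fin 3) : Sm :=
  ![((sqrtDelta n : ℂ)⁻¹) • smoothCalc.ang i P,
    (-(sqrtDelta n : ℂ)⁻¹) • smoothCalc.xcross (fun a => smoothCalc.ang a P) i,
    Sm.X i * P] j

lemma pd_cj (f : Sm) (j : Fin 3) : Sm.d j (Sm.cj f) = Sm.cj (Sm.d j f) := by
  ext x
  have h := (Complex.conjCLE.toContinuousLinearMap.hasFDerivAt.comp x
    (Sm.differentiable f x).hasFDerivAt)
  change fderiv ℝ (fun x => conj (f.1 x)) x _ = conj (fderiv ℝ f.1 x _)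
  rw [show fderiv ℝ (fun x => conj (f.1 x)) x = _ from h.fderiv]
  rfl

lemma cj_X_mul (j : Fin 3) (f : Sm) : Sm.cj (Sm.X j * f) = Sm.X j * Sm.cj f := by
  ext x
  change conj ((Sm.X j).1 x * f.1 x) = (Sm.X j).1 x * conj (f.1 x)
  rw [map_mul, Sm.X_apply, Complex.conj_ofReal]

lemma cj_sub (f g : Sm) : Sm.cj (f - g) = Sm.cj f - Sm.cj g := by
  ext x
  exact map_sub _ _ _

lemma cj_real_smul (c : ℝ) (f : Sm) : Sm.cj ((c : ℂ) • f) = (c : ℂ) • Sm.cj f := by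
  ext x
  change conj ((c : ℂ) * f.1 x) = (c : ℂ) * conj (f.1 x)
  rw [map_mul, Complex.conj_ofReal]

lemma cj_ang (f : Sm) (j : Fin 3) : Sm.cj (smoothCalc.ang j f) = smoothCalc.ang j (Sm.cj f) := by
  change Sm.cj (Sm.X _ * Sm.d _ f - Sm.X _ * Sm.d _ f) = Sm.X _ * Sm.d _ _ - Sm.X _ * Sm.d _ _
  simp only [cj_sub, cj_X_mul, pd_cj]

lemma cj_xcross (v : Fin 3 → Sm) (j : Fin 3) :
    Sm.cj (smoothCalc.xcross v j) = smoothCalc.xcross (fun i => Sm.cj (v i)) j := by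
  change Sm.cj (Sm.X _ * _ - Sm.X _ * _) = Sm.X _ * _ - Sm.X _ * _
  simp only [cj_sub, cj_X_mul]

lemma cj_vsh (n : ℕ) (P : Sm) (j i : Fin 3) : Sm.cj (vsh n P j i) = vsh n (Sm.cj P) j i := by
  fin_cases j
  · change Sm.cj (((sqrtDelta n : ℂ)⁻¹) • _) = ((sqrtDelta n : ℂ)⁻¹) • _
    rw [← Complex.ofReal_inv, cj_real_smul, cj_ang]
  · change Sm.cj ((-(sqrtDelta n : ℂ)⁻¹) • _) = (-(sqrtDelta n : ℂ)⁻¹) • _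
    rw [← Complex.ofReal_inv, ← Complex.ofReal_neg, cj_real_smul, cj_xcross]
    simp only [cj_ang]
  · exact cj_X_mul _ _

lemma cj_polyFun (p : Poly) : Sm.cj (polyFun p) = polyFun (pconj p) := by
  ext x
  exact (polyFun_pconj p x).symm

lemma coef_one_comm (f q : Sm) : coef f q 1 = coef q f 1 :=
  coef_congr fun y => by rw [one_smul, mul_comm]

lemma sqrtDelta_sq (n : ℕ) : (sqrtDelta n : ℂ) ^ 2 = (n : ℂ) * (n + 1) := by
  rw [← Complex.ofReal_pow, sqrtDelta, Real.sq_sqrt (by positivity)]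
  push_cast
  rfl

lemma sqrtDelta_ne_zero {n : ℕ} (hn : n ≠ 0) : (sqrtDelta n : ℂ) ≠ 0 := by
  have : 0 < n := Nat.pos_of_ne_zero hn
  have h : 0 < sqrtDelta n := Real.sqrt_pos.mpr (by positivity)
  exact_mod_cast h.ne'

lemma sqrtDelta_zero : sqrtDelta 0 = 0 := by simp [sqrtDelta]

lemma xdot_xcross (v : Fin 3 → Sm) : smoothCalc.xdot (smoothCalc.xcross v) = 0 := by
  obtain ⟨a1, a2, a3, a4⟩ := VecCalc.fin3_add
  simp [VecCalc.xdot, VecCalc.xcross, Fin.sum_univ_three, a1, a2, a3, a4]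
  ring

lemma coef_rsq_mul (f q : Sm) : coef (smoothCalc.rsq * f) q 1 = coef f q 1 := by
  refine coef_congr fun y => ?_
  change (smoothCalc.rsq).1 _ * f.1 _ * _ = _
  rw [rsq_apply, norm_smul_sphere zero_le_one]
  simp

/-- The pairings of vector spherical harmonics. -/
lemma sum_coef_vsh (n n' : ℕ) (Q : Sm) {p : Poly} (hp : IsHarm n' p) (j j' : Fin 3) :
    ∑ i, coef (vsh n Q j i) (vsh n' (polyFun p) j' i) 1 =
      if j = j' then (if j = 2 then 1 else (sqrtDelta n : ℂ)⁻¹ * (sqrtDelta n' : ℂ)⁻¹ *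
        ((n' : ℂ) * (n' + 1))) * coef Q (polyFun p) 1 else 0 := by
  set P := polyFun p with hP
  have hW : ∀ f : Fin 3 → Sm, ∀ q : Sm, ∑ i, coef (f i) (Sm.X i * q) 1
      = coef (smoothCalc.xdot f) q 1 := fun f q => by
    have := coef_mul_X f q 1
    simpa using this
  have hU : ∀ v w : Fin 3 → Sm, ∑ i, coef (v i) (smoothCalc.xcross w i) 1
      = -∑ i, coef (smoothCalc.xcross v i) (w i) 1 := fun v w => by
    have := coef_xcross v w 1
    simpa using this
  have hVU : ∀ f q : Sm, ∑ i, coef (smoothCalc.xcross (fun a => smoothCalc.ang a f) i)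
      (smoothCalc.ang i q) 1 = 0 := fun f q => by
    have h : ∀ i, coef (smoothCalc.xcross (fun a => smoothCalc.ang a f) i) (smoothCalc.ang i q) 1
      = -coef (smoothCalc.ang i (smoothCalc.xcross (fun a => smoothCalc.ang a f) i)) q 1 :=
      fun i => by rw [coef_ang, neg_neg]
    simp only [h]
    rw [Finset.sum_neg_distrib, ← coef_sum_left, VecCalc.sum_ang_xcross_ang, coef_zero_left,
      neg_zero]
  -- On the unit sphere x × (x × Lf) = -Lf, since the angular field Lf is tangential; the U pairing
  -- thus becomes the V pairing.
  have hUU : ∑ i, coef (smoothCalc.xcross (fun a => smoothCalc.ang a Q) i)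
      (smoothCalc.xcross (fun a => smoothCalc.ang a P) i) 1
      = (n' : ℂ) * (n' + 1) * coef Q P 1 := by
    rw [hU]
    simp only [VecCalc.xcross_xcross, VecCalc.xdot_ang, mul_zero, zero_sub, coef_neg_left,
      coef_rsq_mul]
    rw [Finset.sum_neg_distrib, neg_neg, coef_ang_ang hp]
  have hWa : ∀ (v : Fin 3 → Sm) (f : Sm), ∑ i, coef (Sm.X i * f) (v i) 1
      = coef (smoothCalc.xdot v) f 1 := fun v f => by
    simp only [coef_one_comm (Sm.X _ * f)]
    exact hW _ _
  have hc : smoothCalc.xdot (fun i => Sm.X i * Q) = smoothCalc.rsq * Q := by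
    change ∑ i, Sm.X i * (Sm.X i * Q) = (∑ i, Sm.X i ^ 2) * Q
    rw [Finset.sum_mul]
    exact Finset.sum_congr rfl fun i _ => by ring
  fin_cases j <;> fin_cases j'
  all_goals simp [vsh, coef_smul_left, coef_smul_right, ← Finset.mul_sum, coef_neg_left,
    coef_neg_right]
  · rw [coef_ang_ang hp]
    ring
  · right; right
    simp only [coef_one_comm (smoothCalc.ang _ Q)]
    exact hVU P Q
  · right
    rw [hW, VecCalc.xdot_ang, coef_zero_left]
  · right; right
    exact hVU Q P
  · rw [hUU]
    ring
  · right
    rw [hW, xdot_xcross, coef_zero_left]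
  · right
    rw [hWa, VecCalc.xdot_ang, coef_zero_left]
  · right
    rw [hWa, xdot_xcross, coef_zero_left]
  · rw [hW, hc, coef_rsq_mul]

end ElasticOtI

namespace ElasticOtI

/-! ### The orthonormal basis of vector spherical harmonics -/

/-- An orthonormal system of `2 n + 1` homogeneous harmonic polynomials in each degree `n`. -/
structure HarmSystem (p : ℕ → ℤ → Poly) : Prop where
  harm : ∀ (n : ℕ) (m : ℤ), m ∈ Finset.Icc (-(n : ℤ)) n → IsHarm n (p n m)
  orth : ∀ (n n' : ℕ) (m m' : ℤ), m ∈ Finset.Icc (-(n : ℤ)) n → m' ∈ Finset.Icc (-(n' : ℤ)) n' →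
    coef (polyFun (p n m)) (polyFun (pconj (p n' m'))) 1 = if n = n' ∧ m = m' then 1 else 0

/-- The vector spherical harmonics as elements of `L²` of the unit sphere. -/
noncomputable def vshL (p : ℕ → ℤ → Poly) (n : ℕ) (m : ℤ) (j : Fin 3) : HS :=
  emb (vsh n (polyFun (p n m)) j) 1

lemma cj_vsh_polyFun (n : ℕ) (p : Poly) (j i : Fin 3) :
    Sm.cj (vsh n (polyFun p) j i) = vsh n (polyFun (pconj p)) j i := by
  rw [cj_vsh, cj_polyFun]

/-- For n ≥ 1 the normalisation cancels the eigenvalue n(n + 1). For n = 0 the convention 0⁻¹ = 0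
makes V and U vanish, hence the extra condition on j. -/
lemma inner_vshL {p : ℕ → ℤ → Poly} (hp : HarmSystem p) {n n' : ℕ} {m m' : ℤ}
    (hm : m ∈ Finset.Icc (-(n : ℤ)) n) (hm' : m' ∈ Finset.Icc (-(n' : ℤ)) n') (j j' : Fin 3) :
    inner ℂ (vshL p n m j) (vshL p n' m' j') =
      if n = n' ∧ m = m' ∧ j = j' ∧ (n = 0 → j = 2) then 1 else 0 := by
  rw [vshL, vshL, inner_emb_emb]
  simp only [cj_vsh_polyFun]
  rw [sum_coef_vsh _ _ _ (hp.harm n m hm).pconj, hp.orth n' n m' m hm' hm]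
  by_cases hj : j = j'
  · subst hj
    by_cases hnm : n = n' ∧ m = m'
    · obtain ⟨rfl, rfl⟩ := hnm
      by_cases hj2 : j = 2
      · simp [hj2]
      · rcases eq_or_ne n 0 with rfl | hn
        · simp [hj2]
        · have hs := sqrtDelta_ne_zero hn
          simp only [if_true, hj2, if_false, mul_one, hn, false_imp_iff, and_self]
          rw [← sqrtDelta_sq]
          field_simp
    · have h2 : ¬(n' = n ∧ m' = m) := fun h => hnm ⟨h.1.symm, h.2.symm⟩
      have h3 : ¬(n = n' ∧ m = m' ∧ j = j ∧ (n = 0 → j = 2)) := fun h => hnm ⟨h.1, h.2.1⟩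
      rw [if_neg h2, if_neg h3, mul_zero, ite_self]
  · have h3 : ¬(n = n' ∧ m = m' ∧ j = j' ∧ (n = 0 → j = 2)) := fun h => hj h.2.2.1
    rw [if_neg (fun h => hj h.symm), if_neg h3]

lemma vshL_zero {p : ℕ → ℤ → Poly} (m : ℤ) {j : Fin 3} (hj : j ≠ 2) : vshL p 0 m j = 0 := by
  have h : vsh 0 (polyFun (p 0 m)) j = 0 := by
    ext1 i
    fin_cases j
    · simp [vsh, sqrtDelta_zero]
    · simp [vsh, sqrtDelta_zero]
    · exact absurd rfl hj
  rw [vshL, h]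
  simpa using emb_smul 0 0 1

/-- The index set of the basis. -/
abbrev VIdx : Type := {i : ℕ × ℤ × Fin 3 // i.2.1 ∈ Finset.Icc (-(i.1 : ℤ)) i.1 ∧
  (i.1 = 0 → i.2.2 = 2)}

/-- The nonzero vector spherical harmonics. -/
noncomputable def vshB (p : ℕ → ℤ → Poly) (i : VIdx) : HS := vshL p i.1.1 i.1.2.1 i.1.2.2

lemma orthonormal_vshB {p : ℕ → ℤ → Poly} (hp : HarmSystem p) : Orthonormal ℂ (vshB p) := by
  classical
  rw [orthonormal_iff_ite]
  rintro ⟨⟨n, m, j⟩, h1, h2⟩ ⟨⟨n', m', j'⟩, h1', h2'⟩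
  rw [vshB, vshB, inner_vshL hp h1 h1']
  simp only [Subtype.mk.injEq, Prod.mk.injEq]
  have h2 : n = 0 → j = 2 := h2
  congr 1
  exact propext ⟨fun h => ⟨h.1, h.2.1, h.2.2.1⟩, fun h => ⟨h.1, h.2.1, h.2.2, h2⟩⟩

/-- The 2n + 1 conjugates are linearly independent by orthonormality, and the dimension bound leaves
no room for more. Conjugates are needed because the inner product conjugates its first argument. -/
lemma span_pconj {p : ℕ → ℤ → Poly} (hp : HarmSystem p) {n : ℕ} {h : Poly} (hh : IsHarm n h) :
    h ∈ Submodule.span ℂ (Set.range fun m : Finset.Icc (-(n : ℤ)) n => pconj (p n m)) := by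
  classical
  let b : Finset.Icc (-(n : ℤ)) n → harmSub n := fun m => ⟨pconj (p n m), (hp.harm n m m.2).pconj⟩
  have hb : LinearIndependent ℂ b := by
    rw [linearIndependent_iff']
    intro s c hc m hm
    have h1 : ∑ m ∈ s, c m • polyFun (pconj (p n m)) = 0 := by
      have := congrArg (fun q : harmSub n => polyFun q.1) hc
      simpa [b, map_sum] using this
    have h2 := congrArg (fun q => coef (polyFun (p n m)) q 1) h1
    simp only [coef_sum_right, coef_smul_right, coef_zero_right] at h2
    rw [Finset.sum_eq_single m] at h2
    · simpa [hp.orth n n m m m.2 m.2] using h2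
    · intro m' _ hm'
      rw [hp.orth n n m m' m.2 m'.2, if_neg, mul_zero]
      exact fun h => hm' (Subtype.ext h.2.symm)
    · exact fun h => absurd hm h
  have hcard : Fintype.card (Finset.Icc (-(n : ℤ)) n) = 2 * n + 1 := by
    rw [Fintype.card_coe, Int.card_Icc]
    omega
  have hle := hb.fintype_card_le_finrank
  have hspan := hb.span_eq_top_of_card_eq_finrank'
    (le_antisymm hle (hcard ▸ finrank_harmSub_le n))
  have hmem : (⟨h, hh⟩ : harmSub n) ∈ Submodule.span ℂ (Set.range b) := by rw [hspan]; trivial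
  have h3 := Submodule.mem_map_of_mem (f := (harmSub n).subtype) hmem
  rw [Submodule.map_span, ← Set.range_comp] at h3
  exact h3

lemma integrable_poly_mul (g : HS) (w : Fin 3 → Poly) (i : Fin 3) :
    Integrable (fun y : S2 => (polyFun (w i)).1 y * g y i) sigma2 := by
  have h1 : Integrable g sigma2 := (Lp.memLp g).integrable (by norm_num)
  have h2 : Integrable (fun y => g y i) sigma2 :=
    (EuclideanSpace.proj (𝕜 := ℂ) i : C3 →L[ℂ] ℂ).integrable_comp h1
  obtain ⟨C, hC⟩ := isCompact_univ.exists_bound_of_continuousOn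
    (continuous_restrict (polyFun (w i))).continuousOn
  exact h2.bdd_mul (c := C) (continuous_restrict (polyFun (w i))).aestronglyMeasurable
    (.of_forall fun y => hC y (Set.mem_univ _))

/-- The polynomial fields whose pairing with `g` vanishes. -/
noncomputable def annSub (g : HS) : Submodule ℂ (Fin 3 → Poly) where
  carrier := {w | ∫ y : S2, ∑ i, (polyFun (w i)).1 y * g y i ∂sigma2 = 0}
  add_mem' {v w} hv hw := by
    have hv' : ∫ y : S2, ∑ i, (polyFun (v i)).1 y * g y i ∂sigma2 = 0 := hv
    have hw' : ∫ y : S2, ∑ i, (polyFun (w i)).1 y * g y i ∂sigma2 = 0 := hw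
    change ∫ y : S2, ∑ i, (polyFun (v i + w i)).1 y * g y i ∂sigma2 = 0
    have h := integral_add (integrable_finsetSum Finset.univ fun i _ => integrable_poly_mul g v i)
      (integrable_finsetSum Finset.univ fun i _ => integrable_poly_mul g w i)
    rw [hv', hw', add_zero] at h
    rw [← h]
    refine integral_congr_ae (.of_forall fun y => ?_)
    simp only [map_add, ← Finset.sum_add_distrib]
    exact Finset.sum_congr rfl fun i _ => add_mul _ _ _
  zero_mem' := by simp
  smul_mem' c w hw := by
    have hw' : ∫ y : S2, ∑ i, (polyFun (w i)).1 y * g y i ∂sigma2 = 0 := hw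
    change ∫ y : S2, ∑ i, (polyFun (c • w i)).1 y * g y i ∂sigma2 = 0
    rw [← mul_zero c, ← hw', ← integral_const_mul]
    refine integral_congr_ae (.of_forall fun y => ?_)
    simp only [map_smul, Finset.mul_sum]
    exact Finset.sum_congr rfl fun i _ => mul_assoc _ _ _

lemma inner_vshL_left (p : ℕ → ℤ → Poly) (n : ℕ) (m : ℤ) (j : Fin 3) (g : HS) :
    inner ℂ (vshL p n m j) g
      = ∫ y : S2, ∑ i, (vsh n (polyFun (pconj (p n m))) j i).1 y * g y i ∂sigma2 := by
  rw [vshL, inner_emb_left]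
  simp only [cj_vsh_polyFun]

lemma polyCalc_ang_of_isHarm_zero {p : Poly} (hp : IsHarm 0 p) (j : Fin 3) :
    polyCalc.ang j p = 0 := by
  change _ * MvPolynomial.pderiv _ p - _ * MvPolynomial.pderiv _ p = 0
  rw [pderiv_eq_zero_of_isHomogeneous_zero hp.1, pderiv_eq_zero_of_isHomogeneous_zero hp.1]
  simp

lemma polyFun_ang_zero {p : Poly} (hp : IsHarm 0 p) (j : Fin 3) :
    smoothCalc.ang j (polyFun p) = 0 := by
  rw [← polyFun_compat.ang, polyCalc_ang_of_isHarm_zero hp, map_zero]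

/-- The generation theorem for polynomial fields applies: multiplication by |x|² does not change a
pairing over the unit sphere, and each of the three families is reached by linearity from the system
itself. -/
lemma annSub_eq_top {p : ℕ → ℤ → Poly} (hp : HarmSystem p) {g : HS}
    (hg : ∀ i, inner ℂ (vshB p i) g = 0) : annSub g = ⊤ := by
  have h0 : ∀ (n : ℕ) (m : Finset.Icc (-(n : ℤ)) n) (j : Fin 3),
      ∫ y : S2, ∑ i, (vsh n (polyFun (pconj (p n m))) j i).1 y * g y i ∂sigma2 = 0 := by
    intro n m j
    rw [← inner_vshL_left]
    by_cases hv : n = 0 → j = 2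
    · exact hg ⟨(n, m, j), m.2, hv⟩
    · push Not at hv
      obtain ⟨rfl, hj⟩ := hv
      rw [vshL_zero _ hj, inner_zero_left]
  have ext : ∀ (n : ℕ) (Φ : Poly →ₗ[ℂ] (Fin 3 → Poly)),
      (∀ m : Finset.Icc (-(n : ℤ)) n, Φ (pconj (p n m)) ∈ annSub g) →
      ∀ h, IsHarm n h → Φ h ∈ annSub g := by
    intro n Φ h1 h hh
    have h2 : Submodule.span ℂ (Set.range fun m : Finset.Icc (-(n : ℤ)) n => pconj (p n m))
        ≤ (annSub g).comap Φ := by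
      rw [Submodule.span_le]
      rintro _ ⟨m, rfl⟩
      exact h1 m
    exact h2 (span_pconj hp hh)
  have scale : ∀ (c : ℂ) (w : Fin 3 → Poly), c ≠ 0 → c • w ∈ annSub g → w ∈ annSub g := by
    intro c w hc hw
    simpa [smul_smul, inv_mul_cancel₀ hc] using Submodule.smul_mem _ c⁻¹ hw
  have angc : ∀ (j : Fin 3) (q : Poly), polyFun (polyCalc.ang j q) = smoothCalc.ang j (polyFun q) :=
    fun j q => polyFun_compat.ang j q
  refine eq_top_of_harmonic_fields _ ?_ ?_ ?_ ?_
  · intro w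
    have : ∫ y : S2, ∑ i, (polyFun (polyCalc.rsq * w i)).1 y * g y i ∂sigma2
        = ∫ y : S2, ∑ i, (polyFun (w i)).1 y * g y i ∂sigma2 := by
      refine integral_congr_ae (.of_forall fun y => ?_)
      refine Finset.sum_congr rfl fun i _ => ?_
      rw [map_mul, polyFun_compat.rsq]
      change (smoothCalc.rsq).1 _ * _ * _ = _
      rw [rsq_apply, norm_eq_of_mem_sphere]
      simp
    change _ = 0 ↔ _ = 0
    rw [this]
  · intro n
    refine ext n fieldW fun m => ?_
    change ∫ y : S2, ∑ i, (polyFun (polyCalc.X i * _)).1 y * g y i ∂sigma2 = 0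
    rw [← h0 n m 2]
    simp only [map_mul, polyFun_compat.X]
    rfl
  · intro n
    rcases eq_or_ne n 0 with rfl | hn
    · intro h hh
      have : fieldV h = 0 := funext fun j => polyCalc_ang_of_isHarm_zero hh j
      rw [this]
      exact Submodule.zero_mem _
    · refine ext n fieldV fun m => scale _ _ (inv_ne_zero (sqrtDelta_ne_zero hn)) ?_
      change ∫ y : S2, ∑ i, (polyFun (((sqrtDelta n : ℂ)⁻¹) • polyCalc.ang i _)).1 y * g y i
        ∂sigma2 = 0
      rw [← h0 n m 0]
      simp only [map_smul, angc]
      rfl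
  · intro n
    rcases eq_or_ne n 0 with rfl | hn
    · intro h hh
      have : fieldU h = 0 := funext fun j => by
        change polyCalc.xcross (fun i => polyCalc.ang i h) j = 0
        simp [VecCalc.xcross, polyCalc_ang_of_isHarm_zero hh]
      rw [this]
      exact Submodule.zero_mem _
    · refine ext n fieldU fun m => scale _ _
        (neg_ne_zero.mpr (inv_ne_zero (sqrtDelta_ne_zero hn))) ?_
      change ∫ y : S2, ∑ i, (polyFun ((-(sqrtDelta n : ℂ)⁻¹) •
        polyCalc.xcross (fun i => polyCalc.ang i _) i)).1 y * g y i ∂sigma2 = 0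
      rw [← h0 n m 1]
      simp only [map_smul, polyFun_compat.xcross, angc]
      rfl

/-- The vector spherical harmonics are total. -/
lemma eq_zero_of_inner_vshB {p : ℕ → ℤ → Poly} (hp : HarmSystem p) {g : HS}
    (hg : ∀ i, inner ℂ (vshB p i) g = 0) : g = 0 := by
  have htop := annSub_eq_top hp hg
  have hi : ∀ i : Fin 3, ∀ᵐ y ∂sigma2, g y i = 0 := by
    intro i
    set gi : Lp ℂ 2 sigma2 := (EuclideanSpace.proj (𝕜 := ℂ) i : C3 →L[ℂ] ℂ).compLp g
    have hgi : gi =ᵐ[sigma2] fun y => g y i :=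
      (EuclideanSpace.proj (𝕜 := ℂ) i : C3 →L[ℂ] ℂ).coeFn_compLp g
    have h0 : gi = 0 := by
      refine eq_zero_of_integral_poly_mul gi fun q => ?_
      have hmem : (Pi.single i q : Fin 3 → Poly) ∈ annSub g := by rw [htop]; trivial
      have h1 : ∫ y : S2, ∑ j, (polyFun ((Pi.single i q : Fin 3 → Poly) j)).1 y * g y j ∂sigma2
        = 0 := hmem
      rw [← h1]
      refine integral_congr_ae ?_
      filter_upwards [hgi] with y hy
      rw [hy, Finset.sum_eq_single i]
      · rw [Pi.single_eq_same]
      · intro j _ hj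
        rw [Pi.single_eq_of_ne hj, map_zero]
        exact zero_mul _
      · simp
    have h2 : gi =ᵐ[sigma2] 0 := by rw [h0]; exact Lp.coeFn_zero _ _ _
    filter_upwards [hgi, h2] with y hy hy2
    rw [← hy, hy2]
    rfl
  rw [Lp.eq_zero_iff_ae_eq_zero]
  filter_upwards [hi 0, hi 1, hi 2] with y h0 h1 h2
  ext i
  fin_cases i
  · exact h0
  · exact h1
  · exact h2

/-- The Hilbert basis of vector spherical harmonics. -/
noncomputable def vshBasis {p : ℕ → ℤ → Poly} (hp : HarmSystem p) : HilbertBasis VIdx ℂ HS :=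
  HilbertBasis.mkOfOrthogonalEqBot (orthonormal_vshB hp) (by
    rw [Submodule.eq_bot_iff]
    intro g hg
    refine eq_zero_of_inner_vshB hp fun i => ?_
    exact (Submodule.mem_orthogonal _ _).mp hg _ (Submodule.subset_span ⟨i, rfl⟩))

lemma coe_vshBasis {p : ℕ → ℤ → Poly} (hp : HarmSystem p) : ⇑(vshBasis hp) = vshB p :=
  HilbertBasis.coe_mkOfOrthogonalEqBot _ _

/-- Expansion in vector spherical harmonics, summed over the degree. -/
lemma tendsto_vsh_expansion {p : ℕ → ℤ → Poly} (hp : HarmSystem p) (g : HS) :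
    Tendsto (fun N : ℕ => ∑ n ∈ Finset.range N, ∑ m ∈ Finset.Icc (-(n : ℤ)) n, ∑ j,
      inner ℂ (vshL p n m j) g • vshL p n m j) atTop (𝓝 g) := by
  have h1 := (vshBasis hp).hasSum_repr g
  simp only [HilbertBasis.repr_apply_apply, coe_vshBasis] at h1
  -- Extension by zero to a full product; the excluded indices with n = 0 carry zero vectors anyway.
  let F : ℕ × ℤ × Fin 3 → HS := fun i => if i.2.1 ∈ Finset.Icc (-(i.1 : ℤ)) i.1 then
    inner ℂ (vshL p i.1 i.2.1 i.2.2) g • vshL p i.1 i.2.1 i.2.2 else 0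
  have h2 : HasSum F g := by
    refine (Function.Injective.hasSum_iff (f := F) (g := ((↑) : VIdx → ℕ × ℤ × Fin 3))
      Subtype.val_injective ?_).mp ?_
    · rintro ⟨n, m, j⟩ hi
      by_cases hm : m ∈ Finset.Icc (-(n : ℤ)) n
      · have hj : ¬(n = 0 → j = 2) := fun h => hi ⟨⟨(n, m, j), hm, h⟩, rfl⟩
        push Not at hj
        simp only [F]
        rw [hj.1, vshL_zero _ hj.2, smul_zero, ite_self]
      · exact if_neg hm
    · convert h1 using 1
      funext i
      exact if_pos i.2.1
  -- Boxes exhaust the index set, so the unconditional sum yields convergence of the partial sums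
  -- ordered by degree.
  let S : ℕ → Finset (ℕ × ℤ × Fin 3) := fun N =>
    Finset.range N ×ˢ (Finset.Icc (-(N : ℤ)) N ×ˢ Finset.univ)
  have hS : Tendsto S atTop atTop := by
    refine tendsto_atTop_finset_of_monotone ?_ ?_
    · intro a b hab
      refine Finset.product_subset_product (Finset.range_subset_range.mpr hab)
        (Finset.product_subset_product (Finset.Icc_subset_Icc ?_ ?_) subset_rfl) <;> omega
    · rintro ⟨n, m, j⟩
      refine ⟨n + 1 + m.natAbs, ?_⟩
      simp only [S, Finset.mem_product, Finset.mem_range, Finset.mem_Icc, Finset.mem_univ, and_true]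
      omega
  have h3 := h2.comp hS
  refine h3.congr fun N => ?_
  simp only [Function.comp, S, Finset.sum_product]
  refine Finset.sum_congr rfl fun n hn => ?_
  have hsub : Finset.Icc (-(n : ℤ)) n ⊆ Finset.Icc (-(N : ℤ)) N := by
    have := Finset.mem_range.mp hn
    apply Finset.Icc_subset_Icc <;> omega
  rw [← Finset.sum_subset hsub]
  · exact Finset.sum_congr rfl fun m hm => Finset.sum_congr rfl fun j _ => if_pos hm
  · exact fun m _ hm => Finset.sum_eq_zero fun j _ => if_neg hm

/-- Riesz–Fischer; it produces the incoming field from its coefficients. -/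
lemma exists_inner_vshB_eq {p : ℕ → ℤ → Poly} (hp : HarmSystem p) {c : VIdx → ℂ}
    (hc : Summable fun i => ‖c i‖ ^ 2) : ∃ g : HS, ∀ i, inner ℂ (vshB p i) g = c i := by
  have hmem : Memℓp c 2 := by
    rw [memℓp_gen_iff (by norm_num)]
    simpa using hc
  refine ⟨(vshBasis hp).repr.symm ⟨c, hmem⟩, fun i => ?_⟩
  rw [← coe_vshBasis hp, ← HilbertBasis.repr_apply_apply, LinearIsometryEquiv.apply_symm_apply]

lemma summable_inner_vshB {p : ℕ → ℤ → Poly} (hp : HarmSystem p) (g : HS) :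
    Summable fun i => ‖inner ℂ (vshB p i) g‖ ^ 2 :=
  (orthonormal_vshB hp).inner_products_summable g

end ElasticOtI

namespace ElasticOtI

/-! ### Spheres of radius `r` -/

lemma measurableEmbedding_dilate {r : ℝ} (hr : 0 < r) :
    MeasurableEmbedding fun y : S2 => r • (y : E3) := by
  have hc : Continuous fun y : S2 => r • (y : E3) := by fun_prop
  exact (hc.isClosedEmbedding fun y z h =>
    Subtype.ext (smul_right_injective E3 hr.ne' h)).measurableEmbedding

lemma integral_sphereMeasure {G : Type*} [NormedAddCommGroup G] [NormedSpace ℝ G] {r : ℝ}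
    (hr : 0 < r) (F : E3 → G) :
    ∫ x, F x ∂(sphereMeasure r) = (r ^ 2) • ∫ y : S2, F (r • (y : E3)) ∂sigma2 := by
  rw [sphereMeasure, integral_smul_measure, (measurableEmbedding_dilate hr).integral_map,
    ENNReal.toReal_ofReal (by positivity)]

lemma ae_sphereMeasure_iff {r : ℝ} (hr : 0 < r) {P : E3 → Prop} :
    (∀ᵐ x ∂(sphereMeasure r), P x) ↔ ∀ᵐ y : S2 ∂sigma2, P (r • (y : E3)) := by
  have h : ENNReal.ofReal (r ^ 2) ≠ 0 := by
    rw [ne_eq, ENNReal.ofReal_eq_zero, not_le]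
    positivity
  rw [sphereMeasure, Measure.ae_ennreal_smul_measure_eq h,
    (measurableEmbedding_dilate hr).ae_map_iff]

lemma memLp_sphereMeasure_iff {r : ℝ} (hr : 0 < r) {f : E3 → C3} :
    MemLp f 2 (sphereMeasure r) ↔ MemLp (fun y : S2 => f (r • (y : E3))) 2 sigma2 := by
  have h : ENNReal.ofReal (r ^ 2) ≠ 0 := by
    rw [ne_eq, ENNReal.ofReal_eq_zero, not_le]
    positivity
  rw [← Function.comp_def f, ← (measurableEmbedding_dilate hr).memLp_map_measure_iff, sphereMeasure]
  refine ⟨fun hf => ?_, fun hf => hf.smul_measure ENNReal.ofReal_ne_top⟩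
  have h2 := hf.smul_measure (c := (ENNReal.ofReal (r ^ 2))⁻¹) (ENNReal.inv_ne_top.mpr h)
  rwa [smul_smul, ENNReal.inv_mul_cancel h ENNReal.ofReal_ne_top, one_smul] at h2

/-- The two norms differ by a constant factor that is neither 0 nor infinite. -/
lemma tendsto_eLpNorm_sphereMeasure_iff {r : ℝ} (hr : 0 < r) {f : ℕ → E3 → C3} :
    Tendsto (fun N => eLpNorm (f N) 2 (sphereMeasure r)) atTop (𝓝 0) ↔
      Tendsto (fun N => eLpNorm (fun y : S2 => f N (r • (y : E3))) 2 sigma2) atTop (𝓝 0) := by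
  have h : ENNReal.ofReal (r ^ 2) ≠ 0 := by
    rw [ne_eq, ENNReal.ofReal_eq_zero, not_le]
    positivity
  set c : ENNReal := ENNReal.ofReal (r ^ 2) ^ (1 / (2 : ENNReal)).toReal with hc
  have hc0 : c ≠ 0 := by
    rw [hc, ne_eq, ENNReal.rpow_eq_zero_iff]
    simp [h]
  have hct : c ≠ ⊤ := ENNReal.rpow_ne_top_of_nonneg ENNReal.toReal_nonneg ENNReal.ofReal_ne_top
  have he : ∀ N, eLpNorm (f N) 2 (sphereMeasure r)
      = c * eLpNorm (fun y : S2 => f N (r • (y : E3))) 2 sigma2 := fun N => by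
    rw [sphereMeasure, eLpNorm_smul_measure_of_ne_top (by norm_num),
      (measurableEmbedding_dilate hr).eLpNorm_map_measure]
    rfl
  simp only [he]
  constructor
  · intro ht
    have h2 := ENNReal.Tendsto.const_mul (a := c⁻¹) ht (.inr (ENNReal.inv_ne_top.mpr hc0))
    rw [mul_zero] at h2
    refine h2.congr fun N => ?_
    rw [← mul_assoc, ENNReal.inv_mul_cancel hc0 hct, one_mul]
  · intro ht
    have h2 := ENNReal.Tendsto.const_mul (a := c) ht (.inr hct)
    rwa [mul_zero] at h2

/-- Convergence on the sphere of radius `r`, transported to the unit sphere. -/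
lemma hasL2Sum_iff {r : ℝ} (hr : 0 < r) {f : ℕ → E3 → C3} {ψ : E3 → C3} {F : ℕ → HS} {Ψ : HS}
    (hF : ∀ n, F n =ᵐ[sigma2] fun y => f n (r • (y : E3)))
    (hΨ : Ψ =ᵐ[sigma2] fun y => ψ (r • (y : E3))) :
    HasL2Sum r f ψ ↔ Tendsto (fun N : ℕ => ∑ n ∈ Finset.range N, F n) atTop (𝓝 Ψ) := by
  rw [HasL2Sum, tendsto_eLpNorm_sphereMeasure_iff hr, Lp.tendsto_Lp_iff_tendsto_eLpNorm']
  refine iff_of_eq (congrArg (fun g => Tendsto g atTop (𝓝 0)) (funext fun N => ?_))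
  rw [eLpNorm_sub_comm]
  refine eLpNorm_congr_ae ?_
  have hs : ⇑(∑ n ∈ Finset.range N, F n) =ᵐ[sigma2] fun y => ∑ n ∈ Finset.range N, F n y := by
    have := Lp.coeFn_finsetSum (Finset.range N) F
    filter_upwards [this] with y hy
    rw [hy, Finset.sum_apply]
  have hall : ∀ᵐ y : S2 ∂sigma2, ∀ n, F n y = f n (r • (y : E3)) := ae_all_iff.mpr hF
  filter_upwards [hs, hall, hΨ] with y h1 h2 h3
  rw [Pi.sub_apply, h1, h3]
  exact congrArg _ (Finset.sum_congr rfl fun n _ => (h2 n).symm)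

lemma exists_ae_eq_dilate {r : ℝ} (hr : 0 < r) (g : HS) :
    ∃ ψ : L2S r, (fun y : S2 => ψ (r • (y : E3))) =ᵐ[sigma2] g := by
  obtain ⟨f, hf, hfg⟩ := (measurableEmbedding_dilate hr).exists_stronglyMeasurable_extend
    (Lp.stronglyMeasurable g) (fun _ => ⟨0⟩)
  have hfg' : ∀ y : S2, f (r • (y : E3)) = g y := fun y => congrFun hfg y
  have hmem : MemLp f 2 (sphereMeasure r) := by
    rw [memLp_sphereMeasure_iff hr]
    simp only [hfg']
    exact Lp.memLp g
  refine ⟨hmem.toLp, ?_⟩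
  have := (ae_sphereMeasure_iff hr).mp hmem.coeFn_toLp
  filter_upwards [this] with y hy
  rw [hy, hfg']

lemma exists_pullback {r : ℝ} (hr : 0 < r) (ψ : L2S r) :
    ∃ g : HS, g =ᵐ[sigma2] fun y => ψ (r • (y : E3)) :=
  ⟨((memLp_sphereMeasure_iff hr).mp (Lp.memLp ψ)).toLp, MemLp.coeFn_toLp _⟩

/-! ### The matrices of vector spherical harmonics -/

/-- The derivative is the orthogonal projection onto the tangent plane at y. -/
lemma hasFDerivAt_unitVec {y : E3} (hy : ‖y‖ = 1) :
    HasFDerivAt unitVec (ContinuousLinearMap.id ℝ E3 - (innerSL ℝ y).smulRight y) y := by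
  have h1 : HasFDerivAt (fun z : E3 => ‖z‖ ^ 2) (2 • innerSL ℝ y) y :=
    (hasStrictFDerivAt_norm_sq y).hasFDerivAt
  have h2 := h1.sqrt (by rw [hy]; norm_num)
  simp only [Real.sqrt_sq (norm_nonneg _), hy] at h2
  have h3 := (hasDerivAt_inv (𝕜 := ℝ) (x := ‖y‖) (by rw [hy]; norm_num)).comp_hasFDerivAt y h2
  have h4 := h3.smul (hasFDerivAt_id y)
  refine h4.congr_fderiv ?_
  ext v i
  simp [hy]
  ring

lemma unitVec_of_norm_eq_one {y : E3} (hy : ‖y‖ = 1) : unitVec y = y := by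
  rw [unitVec, hy, inv_one, one_smul]

lemma norm_unitVec {z : E3} (hz : z ≠ 0) : ‖unitVec z‖ = 1 := by
  rw [unitVec, norm_smul, norm_inv, norm_norm, inv_mul_cancel₀ (norm_ne_zero_iff.mpr hz)]

lemma unitVec_smul {r : ℝ} (hr : 0 < r) (y : S2) : unitVec (r • (y : E3)) = y := by
  rw [unitVec, norm_smul_sphere hr.le, smul_smul, inv_mul_cancel₀ hr.ne', one_smul]

/-- The chain rule leaves the tangential part ∇P - y (y · ∇P), which equals -y × (y × ∇P) for |y| =
1. Only the values of f on the sphere enter. -/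
lemma surfGrad_eq {f : E3 → ℂ} {P : Sm} (hf : ∀ x : E3, ‖x‖ = 1 → f x = P.1 x) {y : E3}
    (hy : ‖y‖ = 1) (i : Fin 3) :
    surfGrad f y i = -(smoothCalc.xcross (fun a => smoothCalc.ang a P) i).1 y := by
  have hy0 : y ≠ 0 := by
    rintro rfl
    simp at hy
  have he : (fun z => f (unitVec z)) =ᶠ[𝓝 y] P.1 ∘ unitVec := by
    filter_upwards [isOpen_ne.mem_nhds hy0] with z hz
    exact hf _ (norm_unitVec hz)
  have hP : HasFDerivAt P.1 (fderiv ℝ P.1 (unitVec y)) (unitVec y) :=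
    (Sm.differentiable P _).hasFDerivAt
  have hd := hP.comp y (hasFDerivAt_unitVec hy)
  rw [unitVec_of_norm_eq_one hy] at hd
  rw [surfGrad, pd, he.fderiv_eq, hd.fderiv, VecCalc.xcross_ang]
  change fderiv ℝ P.1 y (EuclideanSpace.single i 1 - inner ℝ y (EuclideanSpace.single i 1) • y)
    = -((Sm.X i).1 y * (smoothCalc.eul P).1 y - (smoothCalc.rsq).1 y * pd i P.1 y)
  rw [map_sub, map_smul, ← eul_apply, rsq_apply, hy, EuclideanSpace.inner_single_right, Sm.X_apply, pd]
  simp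

/-- The system `Y` is given on the unit sphere by the polynomials `p`. -/
def IsPolySystem (Y : ℕ → ℤ → E3 → ℂ) (p : ℕ → ℤ → Poly) : Prop :=
  ∀ (n : ℕ) (m : ℤ), m ∈ Finset.Icc (-(n : ℤ)) n → ∀ x : E3, ‖x‖ = 1 →
    Y n m x = (polyFun (p n m)).1 x

lemma exists_isPolySystem {Y : ℕ → ℤ → E3 → ℂ} (hY : IsSphericalHarmonicSystem Y) :
    ∃ p, HarmSystem p ∧ IsPolySystem Y p := by
  classical
  have h := fun (n : ℕ) (m : ℤ) (hm : m ∈ Finset.Icc (-(n : ℤ)) n) => hY.harmonic n m hm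
  choose q hq1 hq2 hq3 using h
  let p : ℕ → ℤ → Poly := fun n m => if hm : m ∈ Finset.Icc (-(n : ℤ)) n then q n m hm else 0
  have hp : IsPolySystem Y p := by
    intro n m hm x hx
    rw [hq3 n m hm x hx, polyFun_apply]
    simp only [p, dif_pos hm]
  refine ⟨p, ⟨?_, ?_⟩, hp⟩
  · intro n m hm
    simp only [p, dif_pos hm]
    exact ⟨hq1 n m hm, hq2 n m hm⟩
  · intro n n' m m' hm hm'
    rw [← hY.orthonormal n n' m m' hm hm', integral_sphereMeasure one_pos, one_pow, one_smul, coef]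
    refine integral_congr_ae (.of_forall fun y => ?_)
    have hy : ‖(1 : ℝ) • (y : E3)‖ = 1 := norm_smul_sphere zero_le_one y
    change _ = Y n m ((1 : ℝ) • (y : E3)) * conj (Y n' m' ((1 : ℝ) • (y : E3)))
    rw [hp n m hm _ hy, hp n' m' hm' _ hy, ← polyFun_pconj]
    simp only [one_smul]

lemma vshM_apply {Y : ℕ → ℤ → E3 → ℂ} {p : ℕ → ℤ → Poly} (hp : IsPolySystem Y p) {n : ℕ} {m : ℤ}
    (hm : m ∈ Finset.Icc (-(n : ℤ)) n) (y : S2) (i j : Fin 3) :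
    vshM Y n m y i j = (vsh n (polyFun (p n m)) j i).1 y := by
  set P := polyFun (p n m) with hP
  have hy : ‖(y : E3)‖ = 1 := by simp
  have hU : ∀ i, vshU Y n m y i = (vsh n P 1 i).1 y := by
    intro i
    change (sqrtDelta n : ℂ)⁻¹ * surfGrad (Y n m) y i = (-(sqrtDelta n : ℂ)⁻¹) * _
    rw [surfGrad_eq (hp n m hm) hy, mul_neg, neg_mul]
  have hr : (smoothCalc.rsq).1 (y : E3) = 1 := by
    rw [rsq_apply, hy]
    simp
  have hV : ∀ i, vshV Y n m y i = (vsh n P 0 i).1 y := by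
    intro i
    have h1 : vshV Y n m y i = (smoothCalc.xcross (vsh n P 1) i).1 y := by
      obtain ⟨a1, a2, a3, a4⟩ := VecCalc.fin3_add
      rw [vshV, crossProduct]
      fin_cases i
      · simp [VecCalc.xcross, hU]; rfl
      · simp [VecCalc.xcross, hU, a1, a2]; rfl
      · simp [VecCalc.xcross, hU, a3, a4]; rfl
    -- The double cross product of a tangential field is -|x|² times the field, and |x|² = 1 on the
    -- sphere.
    have h2 : smoothCalc.xcross (vsh n P 1) i = (sqrtDelta n : ℂ)⁻¹ •
        (smoothCalc.rsq * smoothCalc.ang i P) := by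
      have h3 := smoothCalc.xcross_xcross (fun a => smoothCalc.ang a P) i
      rw [smoothCalc.xdot_ang] at h3
      have h4 : smoothCalc.xcross (vsh n P 1) i = (-(sqrtDelta n : ℂ)⁻¹) •
          smoothCalc.xcross (smoothCalc.xcross (fun a => smoothCalc.ang a P)) i := by
        change Sm.X _ * ((-(sqrtDelta n : ℂ)⁻¹) • _) - Sm.X _ * ((-(sqrtDelta n : ℂ)⁻¹) • _)
          = (-(sqrtDelta n : ℂ)⁻¹) • (Sm.X _ * _ - Sm.X _ * _)
        rw [mul_smul_comm, mul_smul_comm, smul_sub]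
      rw [h4, h3, mul_zero, zero_sub, smul_neg, neg_smul, neg_neg]
    rw [h1, h2]
    change _ * ((smoothCalc.rsq).1 (y : E3) * _) = _
    rw [hr, one_mul]
    rfl
  fin_cases j
  · exact hV i
  · exact hU i
  · change Y n m y * ((y : E3) i : ℂ) = (Sm.X i).1 y * P.1 y
    rw [hp n m hm y hy, mul_comm]
    rfl

/-- The combination of order `n` of vector spherical harmonics with coefficients `c`. -/
noncomputable def vshSum (p : ℕ → ℤ → Poly) (c : ℕ → ℤ → Fin 3 → ℂ) (n : ℕ) : HS :=
  ∑ m ∈ Finset.Icc (-(n : ℤ)) n, ∑ j, c n m j • vshL p n m j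

lemma coeFn_vshSum {Y : ℕ → ℤ → E3 → ℂ} {p : ℕ → ℤ → Poly} (hp : IsPolySystem Y p)
    (c : ℕ → ℤ → Fin 3 → ℂ) (n : ℕ) :
    vshSum p c n =ᵐ[sigma2] fun y => WithLp.toLp 2 (∑ m ∈ Finset.Icc (-(n : ℤ)) n,
      vshM Y n m y *ᵥ c n m) := by
  have h1 : ⇑(vshSum p c n) =ᵐ[sigma2] fun y => ∑ m ∈ Finset.Icc (-(n : ℤ)) n,
      (∑ j, c n m j • vshL p n m j : HS) y := by
    filter_upwards [Lp.coeFn_finsetSum (Finset.Icc (-(n : ℤ)) n)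
      fun m => ∑ j, c n m j • vshL p n m j] with y hy
    rw [vshSum, hy, Finset.sum_apply]
  have h2 : ∀ᵐ y ∂sigma2, ∀ m, (∑ j, c n m j • vshL p n m j : HS) y
      = ∑ j, (c n m j • vshL p n m j) y := by
    refine ae_all_iff.mpr fun m => ?_
    filter_upwards [Lp.coeFn_finsetSum Finset.univ fun j => c n m j • vshL p n m j] with y hy
    rw [hy, Finset.sum_apply]
  have h3 : ∀ᵐ y ∂sigma2, ∀ m j, (c n m j • vshL p n m j) y
      = c n m j • fieldAt (vsh n (polyFun (p n m)) j) 1 y := by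
    refine ae_all_iff.mpr fun m => ae_all_iff.mpr fun j => ?_
    filter_upwards [Lp.coeFn_smul (c n m j) (vshL p n m j),
      coeFn_emb (vsh n (polyFun (p n m)) j) 1] with y hy hy2
    rw [hy, Pi.smul_apply, vshL, hy2]
  filter_upwards [h1, h2, h3] with y e1 e2 e3
  rw [e1, WithLp.toLp_sum]
  refine Finset.sum_congr rfl fun m hm => ?_
  rw [e2]
  simp only [e3]
  ext i
  rw [WithLp.ofLp_sum, Finset.sum_apply]
  change _ = ∑ j, vshM Y n m y i j * c n m j
  refine Finset.sum_congr rfl fun j _ => ?_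
  rw [vshM_apply hp hm]
  simp [fieldAt, mul_comm]

lemma inner_vshL_eq_zero {p : ℕ → ℤ → Poly} {n : ℕ} (m : ℤ) {j : Fin 3} (h : ¬(n = 0 → j = 2))
    (g : HS) : inner ℂ (vshL p n m j) g = 0 := by
  push Not at h
  obtain ⟨rfl, hj⟩ := h
  rw [vshL_zero _ hj, inner_zero_left]

lemma inner_vshSum {p : ℕ → ℤ → Poly} (hp : HarmSystem p) (c : ℕ → ℤ → Fin 3 → ℂ) {n n' : ℕ}
    {m : ℤ} (hm : m ∈ Finset.Icc (-(n : ℤ)) n) (j : Fin 3) :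
    inner ℂ (vshL p n m j) (vshSum p c n') = if n = n' ∧ (n = 0 → j = 2) then c n m j else 0 := by
  by_cases hj : n = 0 → j = 2
  swap
  · rw [inner_vshL_eq_zero m hj, if_neg fun h => hj h.2]
  rw [vshSum, inner_sum]
  by_cases hn : n = n'
  · subst hn
    rw [Finset.sum_eq_single m, inner_sum, Finset.sum_eq_single j]
    · rw [inner_smul_right, inner_vshL hp hm hm, if_pos ⟨rfl, rfl, rfl, hj⟩, if_pos ⟨rfl, hj⟩,
        mul_one]
    · intro j' _ hj'
      rw [inner_smul_right, inner_vshL hp hm hm, if_neg fun h => hj' h.2.2.1.symm, mul_zero]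
    · simp
    · intro m' hm' hne
      rw [inner_sum]
      refine Finset.sum_eq_zero fun j' _ => ?_
      rw [inner_smul_right, inner_vshL hp hm hm', if_neg fun h => hne h.2.1.symm, mul_zero]
    · exact fun h => absurd hm h
  · rw [if_neg fun h => hn h.1]
    refine Finset.sum_eq_zero fun m' hm' => ?_
    rw [inner_sum]
    refine Finset.sum_eq_zero fun j' _ => ?_
    rw [inner_smul_right, inner_vshL hp hm hm', if_neg fun h => hn h.1, mul_zero]

/-- The coefficients of a convergent expansion. -/
lemma inner_vshL_of_tendsto {p : ℕ → ℤ → Poly} (hp : HarmSystem p) {c : ℕ → ℤ → Fin 3 → ℂ} {g : HS}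
    (hg : Tendsto (fun N : ℕ => ∑ n ∈ Finset.range N, vshSum p c n) atTop (𝓝 g)) {n : ℕ} {m : ℤ}
    (hm : m ∈ Finset.Icc (-(n : ℤ)) n) (j : Fin 3) :
    inner ℂ (vshL p n m j) g = if n = 0 → j = 2 then c n m j else 0 := by
  have h1 := (tendsto_const_nhds (x := vshL p n m j)).inner (𝕜 := ℂ) hg
  refine tendsto_nhds_unique h1 (tendsto_const_nhds.congr' ?_)
  filter_upwards [eventually_gt_atTop n] with N hN
  rw [inner_sum, Finset.sum_eq_single n]
  · simp [inner_vshSum hp c hm]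
  · intro n' _ hne
    rw [inner_vshSum hp c hm, if_neg fun h => hne h.1.symm]
  · exact fun h => absurd (Finset.mem_range.mpr hN) h

/-- Coefficients of the vanishing vectors at n = 0 are irrelevant. -/
lemma vshSum_congr {p : ℕ → ℤ → Poly} {c c' : ℕ → ℤ → Fin 3 → ℂ} {n : ℕ}
    (h : ∀ m ∈ Finset.Icc (-(n : ℤ)) n, ∀ j, (n = 0 → j = 2) → c n m j = c' n m j) :
    vshSum p c n = vshSum p c' n := by
  refine Finset.sum_congr rfl fun m hm => Finset.sum_congr rfl fun j _ => ?_
  by_cases hj : n = 0 → j = 2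
  · rw [h m hm j hj]
  · push Not at hj
    obtain ⟨rfl, hj⟩ := hj
    rw [vshL_zero _ hj, smul_zero, smul_zero]

/-- Convergence of the expansion with the right coefficients. -/
lemma tendsto_vshSum {p : ℕ → ℤ → Poly} (hp : HarmSystem p) {c : ℕ → ℤ → Fin 3 → ℂ} {g : HS}
    (hc : ∀ n : ℕ, ∀ m ∈ Finset.Icc (-(n : ℤ)) n, ∀ j, (n = 0 → j = 2) →
      inner ℂ (vshL p n m j) g = c n m j) :
    Tendsto (fun N : ℕ => ∑ n ∈ Finset.range N, vshSum p c n) atTop (𝓝 g) := by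
  refine (tendsto_vsh_expansion hp g).congr fun N => Finset.sum_congr rfl fun n _ => ?_
  exact vshSum_congr (c := fun n m j => inner ℂ (vshL p n m j) g) (hc n)

/-- The integral of `M_n^m` against a field on the sphere. -/
lemma integral_vshM {Y : ℕ → ℤ → E3 → ℂ} {p : ℕ → ℤ → Poly} (hp : IsPolySystem Y p) {r : ℝ}
    (hr : 0 < r) {φ : E3 → C3} {g : HS} (hg : g =ᵐ[sigma2] fun y => φ (r • (y : E3))) {n : ℕ}
    {m : ℤ} (hm : m ∈ Finset.Icc (-(n : ℤ)) n) :
    ∫ x, (vshM Y n m (unitVec x))ᴴ *ᵥ (φ x).ofLp ∂(sphereMeasure r)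
      = fun j => ((r : ℂ) ^ 2) * inner ℂ (vshL p n m j) g := by
  rw [integral_sphereMeasure hr]
  have he : (fun y : S2 => (vshM Y n m (unitVec (r • (y : E3))))ᴴ *ᵥ (φ (r • (y : E3))).ofLp)
      =ᵐ[sigma2] fun y j => ∑ i, (vsh n (polyFun (pconj (p n m))) j i).1 y * g y i := by
    filter_upwards [hg] with y hy
    ext j
    rw [hy, unitVec_smul hr, Matrix.mulVec, dotProduct]
    refine Finset.sum_congr rfl fun i _ => ?_
    rw [Matrix.conjTranspose_apply, vshM_apply hp hm, ← cj_vsh_polyFun]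
    rfl
  rw [integral_congr_ae he]
  have hint : ∀ j : Fin 3, Integrable (fun y : S2 =>
      ∑ i, (vsh n (polyFun (pconj (p n m))) j i).1 y * g y i) sigma2 := by
    intro j
    refine integrable_finsetSum _ fun i _ => ?_
    have h1 : Integrable g sigma2 := (Lp.memLp g).integrable (by norm_num)
    have h2 : Integrable (fun y => g y i) sigma2 :=
      (EuclideanSpace.proj (𝕜 := ℂ) i : C3 →L[ℂ] ℂ).integrable_comp h1
    obtain ⟨C, hC⟩ := isCompact_univ.exists_bound_of_continuousOn
      (continuous_restrict (vsh n (polyFun (pconj (p n m))) j i)).continuousOn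
    exact h2.bdd_mul (c := C) (continuous_restrict _).aestronglyMeasurable
      (.of_forall fun y => hC y (Set.mem_univ _))
  ext j
  rw [Pi.smul_apply, eval_integral hint, inner_vshL_left, Complex.real_smul]
  push_cast
  rfl

end ElasticOtI

/-! ### Divergence and curl of the Navier operator. -/

namespace VecCalc

variable {A : Type*} [CommRing A] [Algebra ℂ A] (S : VecCalc A)

/-- The divergence of the Lamé operator. -/
lemma div_lame (a b c : ℂ) (u : Fin 3 → A) :
    S.div (fun i => a • S.lap (u i) + b • S.d i (S.div u) + c • u i)
      = (a + b) • S.lap (S.div u) + c • S.div u := by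
  have h : ∑ i, S.d i (S.lap (u i)) = S.lap (S.div u) := by
    simp only [← S.lap_d]
    simp only [lap, div, map_sum]
    exact Finset.sum_comm
  rw [div]
  simp only [map_add, Derivation.map_smul, Finset.sum_add_distrib, ← Finset.smul_sum, h]
  rw [add_smul]
  rfl

lemma lap_curl (u : Fin 3 → A) (j : Fin 3) :
    S.lap (S.curl u j) = S.curl (fun i => S.lap (u i)) j := by
  simp only [curl, ← S.lap_d]
  simp only [lap, map_sub, Finset.sum_sub_distrib]

lemma curl_lame (a b c : ℂ) (u : Fin 3 → A) (j : Fin 3) :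
    S.curl (fun i => a • S.lap (u i) + b • S.d i (S.div u) + c • u i) j
      = a • S.lap (S.curl u j) + c • S.curl u j := by
  have h := S.curl_d (S.div u) j
  have h3 : S.curl (fun i => a • S.lap (u i) + b • S.d i (S.div u) + c • u i) j
      = a • S.curl (fun i => S.lap (u i)) j + b • S.curl (fun i => S.d i (S.div u)) j
        + c • S.curl u j := by
    simp only [curl, map_add, Derivation.map_smul, smul_sub]
    abel
  rw [h3, h, lap_curl, smul_zero, add_zero]

/-- The double curl of the Lamé operator. -/
lemma curl_curl_lame (a b c : ℂ) (u : Fin 3 → A) (j : Fin 3) :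
    S.curl (S.curl fun i => a • S.lap (u i) + b • S.d i (S.div u) + c • u i) j
      = a • S.lap (S.curl (S.curl u) j) + c • S.curl (S.curl u) j := by
  -- A zero multiple of ∇ div is inserted so that the curl is again of Lamé form and `curl_lame`
  -- applies a second time.
  have h : S.curl (fun i => a • S.lap (u i) + b • S.d i (S.div u) + c • u i)
      = fun j => a • S.lap (S.curl u j) + (0 : ℂ) • S.d j (S.div (S.curl u)) + c • S.curl u j := by
    funext j
    rw [curl_lame, zero_smul, add_zero]
  rw [h, curl_lame]

end VecCalc

namespace ElasticOtI

/-! ### Differential operators on vector fields and on smooth components -/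

/-- The vector field with given smooth components. -/
noncomputable def vec (u : Fin 3 → Sm) (x : E3) : C3 := WithLp.toLp 2 fun i => (u i).1 x

lemma contDiff_vec (u : Fin 3 → Sm) : ContDiff ℝ ∞ (vec u) :=
  PiLp.contDiff_toLp.comp (contDiff_pi.mpr fun i => Sm.contDiff (u i))

lemma Sm.sum_apply (f : Fin 3 → Sm) (x : E3) : (∑ i, f i).1 x = ∑ i, (f i).1 x := by
  rw [Fin.sum_univ_three, Fin.sum_univ_three]
  rfl

lemma grad_coe (f : Sm) : grad f.1 = vec fun i => Sm.d i f := rfl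

lemma dvg_vec (u : Fin 3 → Sm) : dvg (vec u) = (smoothCalc.div u).1 := by
  funext x
  exact (Sm.sum_apply (fun i => Sm.d i (u i)) x).symm

lemma curl_vec (u : Fin 3 → Sm) : curl (vec u) = vec (smoothCalc.curl u) := by
  funext x
  ext i
  fin_cases i <;> rfl

/-- The projection to a component. -/
noncomputable def projR (i : Fin 3) : C3 →L[ℝ] ℂ :=
  (EuclideanSpace.proj (𝕜 := ℂ) i : C3 →L[ℂ] ℂ).restrictScalars ℝ

lemma lap_apply (f : Sm) (x : E3) :
    (smoothCalc.lap f).1 x = Laplacian.laplacian f.1 x := by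
  rw [InnerProductSpace.laplacian_eq_iteratedFDeriv_orthonormalBasis f.1
    (EuclideanSpace.basisFun (Fin 3) ℝ)]
  change (∑ j, Sm.d j (Sm.d j f) : Sm).1 x = _
  rw [Sm.sum_apply]
  refine Finset.sum_congr rfl fun j _ => ?_
  have hd : Differentiable ℝ (fderiv ℝ f.1) :=
    ((Sm.contDiff f).fderiv_right (m := ∞) (by simp)).differentiable (by simp)
  rw [iteratedFDeriv_two_apply, EuclideanSpace.basisFun_apply]
  change fderiv ℝ (fun y => fderiv ℝ f.1 y _) x _ = _
  rw [fderiv_clm_apply (hd x) (differentiableAt_const _)]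
  simp

lemma laplacian_vec (u : Fin 3 → Sm) :
    Laplacian.laplacian (vec u) = vec fun i => smoothCalc.lap (u i) := by
  funext x
  ext i
  have h := ((contDiff_vec u).of_le (m := 2) (by
    simpa using WithTop.coe_le_coe.mpr (le_top : (2 : ℕ∞) ≤ ⊤))).contDiffAt.laplacian_CLM_comp_left (x := x)
    (l := projR i)
  exact h.symm.trans (lap_apply (u i) x).symm

lemma eqOn_pd {O : Set E3} (hO : IsOpen O) {f g : E3 → ℂ} (h : Set.EqOn f g O) (j : Fin 3) :
    Set.EqOn (pd j f) (pd j g) O := fun x hx => by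
  rw [pd, pd, (h.eventuallyEq_of_mem (hO.mem_nhds hx)).fderiv_eq]

lemma eqOn_component {O : Set E3} {u v : E3 → C3} (h : Set.EqOn u v O) (i : Fin 3) :
    Set.EqOn (fun x => u x i) (fun x => v x i) O := fun x hx => by
  change u x i = v x i
  rw [h hx]

lemma eqOn_grad {O : Set E3} (hO : IsOpen O) {f g : E3 → ℂ} (h : Set.EqOn f g O) :
    Set.EqOn (grad f) (grad g) O := fun x hx => by
  ext i
  exact eqOn_pd hO h i hx

lemma eqOn_dvg {O : Set E3} (hO : IsOpen O) {u v : E3 → C3} (h : Set.EqOn u v O) :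
    Set.EqOn (dvg u) (dvg v) O := fun _ hx =>
  Finset.sum_congr rfl fun i _ => eqOn_pd hO (eqOn_component h i) i hx

lemma eqOn_curl {O : Set E3} (hO : IsOpen O) {u v : E3 → C3} (h : Set.EqOn u v O) :
    Set.EqOn (curl u) (curl v) O := fun x hx => by
  have h1 := fun i j => eqOn_pd hO (eqOn_component h i) j hx
  simp only [curl, h1]

lemma eqOn_lame {O : Set E3} (hO : IsOpen O) (la mu : ℝ) {u v : E3 → C3} (h : Set.EqOn u v O) :
    Set.EqOn (lame la mu u) (lame la mu v) O := fun x hx => by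
  rw [lame, lame, eqOn_grad hO (eqOn_dvg hO h) hx,
    (InnerProductSpace.laplacian_congr_nhds
      (h.eventuallyEq_of_mem (hO.mem_nhds hx))).eq_of_nhds]

lemma isOpen_norm_gt (a : ℝ) : IsOpen {x : E3 | a < ‖x‖} := isOpen_lt continuous_const continuous_norm

/-- The Sommerfeld condition for the components of a field. -/
lemma isRadiating_of_sommerfeld {k a : ℝ} {F : E3 → C3} {g : Fin 3 → Sm} (h : Sommerfeld k F)
    (hFg : Set.EqOn F (vec g) {x | a < ‖x‖}) (i : Fin 3) : IsRadiating k (g i) := by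
  refine squeeze_zero_norm' ?_ h
  filter_upwards [(tendsto_norm_cobounded_atTop (E := E3)).eventually_gt_atTop (max a 0)] with x hx
  have hx1 : a < ‖x‖ := (le_max_left _ _).trans_lt hx
  have hx0 : 0 < ‖x‖ := (le_max_right _ _).trans_lt hx
  have he := hFg.eventuallyEq_of_mem ((isOpen_norm_gt a).mem_nhds hx1)
  have hd : DifferentiableAt ℝ (vec g) x := ((contDiff_vec g).differentiable (by simp)) x
  have hcomp : fderiv ℝ (g i).1 x = (projR i).comp (fderiv ℝ (vec g) x) :=
    ((projR i).hasFDerivAt.comp x hd.hasFDerivAt).fderiv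
  set V := fderiv ℝ F x (unitVec x) - (Complex.I * (k : ℂ)) • F x with hV
  have hVi : V i = fderiv ℝ (g i).1 x (unitVec x) - Complex.I * k * (g i).1 x := by
    rw [hV, he.fderiv_eq, hFg hx1, hcomp]
    rfl
  have hun : fderiv ℝ (g i).1 x (unitVec x) = (‖x‖⁻¹ : ℝ) • fderiv ℝ (g i).1 x x := by
    rw [unitVec, map_smul]
  have hkey : (smoothCalc.eul (g i)).1 x - Complex.I * ((k * ‖x‖ : ℝ) : ℂ) * (g i).1 x
      = (‖x‖ : ℂ) * V i := by
    have hx0' : (‖x‖ : ℂ) ≠ 0 := by exact_mod_cast hx0.ne'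
    rw [hVi, eul_apply, hun, Complex.real_smul]
    push_cast
    field_simp
  rw [hkey, norm_mul, Complex.norm_real, norm_norm]
  exact mul_le_mul_of_nonneg_left (PiLp.norm_apply_le V i) hx0.le

/-- A field smooth outside a ball agrees with a globally smooth field farther out. -/
lemma exists_smooth_extension {O : Set E3} (hO : IsOpen O) {v : E3 → C3} (hv : ContDiffOn ℝ ∞ v O)
    {a b : ℝ} (ha : 0 < a) (hab : a < b) (hsub : ∀ x : E3, a ≤ ‖x‖ → x ∈ O) :
    ∃ U : Fin 3 → Sm, Set.EqOn v (vec U) {x | b < ‖x‖} := by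
  let χ : ContDiffBump (0 : E3) := ⟨a, b, ha, hab⟩
  have hsm : ∀ i, ContDiff ℝ ∞ fun x => ((1 - χ x : ℝ) : ℂ) * v x i := by
    intro i
    rw [contDiff_iff_contDiffAt]
    intro x
    rcases lt_or_ge ‖x‖ a with hx | hx
    · refine (contDiffAt_const (c := (0 : ℂ))).congr_of_eventuallyEq ?_
      filter_upwards [(isOpen_lt continuous_norm continuous_const).mem_nhds hx] with z hz
      have hz' : ‖z‖ < a := hz
      have : χ z = 1 := χ.one_of_mem_closedBall (by simpa using hz'.le)
      simp [this]
    · have h1 : ContDiffAt ℝ ∞ v x := hv.contDiffAt (hO.mem_nhds (hsub x hx))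
      have h2 : ContDiffAt ℝ ∞ (fun x => v x i) x :=
        ((projR i).contDiff.contDiffAt (x := v x)).comp x h1
      have h3 : ContDiff ℝ ∞ fun x => ((1 - χ x : ℝ) : ℂ) :=
        Complex.ofRealCLM.contDiff.comp (contDiff_const.sub χ.contDiff)
      exact h3.contDiffAt.mul h2
  refine ⟨fun i => ⟨_, hsm i⟩, fun x hx => ?_⟩
  have hx' : b < ‖x‖ := hx
  have h0 : χ x = 0 := χ.zero_of_le_dist (by simpa using hx'.le)
  ext i
  change v x i = ((1 - χ x : ℝ) : ℂ) * v x i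
  simp [h0]

/-! ### Splitting into compressional and shear parts. -/

/-- The functions vanishing outside the ball of radius `a`. -/
def VanishOut (a : ℝ) (f : Sm) : Prop := Set.EqOn f.1 0 {x | a < ‖x‖}

lemma VanishOut.d {a : ℝ} {f : Sm} (h : VanishOut a f) (j : Fin 3) : VanishOut a (Sm.d j f) := by
  intro x hx
  have := eqOn_pd (isOpen_norm_gt a) h j hx
  change pd j f.1 x = 0
  rw [this, pd]
  simp [Pi.zero_def]

lemma VanishOut.sub {a : ℝ} {f g : Sm} (hf : VanishOut a f) (hg : VanishOut a g) :
    VanishOut a (f - g) := by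
  intro x hx
  change f.1 x - g.1 x = 0
  rw [hf hx, hg hx]
  simp

lemma VanishOut.curl {a : ℝ} {u : Fin 3 → Sm} (h : ∀ i, VanishOut a (u i)) (j : Fin 3) :
    VanishOut a (smoothCalc.curl u j) := ((h _).d _).sub ((h _).d _)

lemma VanishOut.div {a : ℝ} {u : Fin 3 → Sm} (h : ∀ i, VanishOut a (u i)) :
    VanishOut a (smoothCalc.div u) := by
  intro x hx
  change (∑ i, Sm.d i (u i) : Sm).1 x = 0
  rw [Sm.sum_apply]
  exact Finset.sum_eq_zero fun i _ => (h i).d i hx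

/-- The decomposition of a radiating elastic field, outside the ball of radius `a`, into a
compressional and a shear part. -/
structure IsDecomposition (la mu om a : ℝ) (U : Fin 3 → Sm) (f : Sm) (w : Fin 3 → Sm) : Prop where
  eq : ∀ x : E3, a < ‖x‖ → ∀ i, (U i).1 x = (Sm.d i f).1 x + (w i).1 x
  lap_f : ∀ x : E3, a < ‖x‖ → (smoothCalc.lap f).1 x = -(kp la mu om : ℂ) ^ 2 * f.1 x
  lap_w : ∀ i, ∀ x : E3, a < ‖x‖ → (smoothCalc.lap (w i)).1 x = -(ks mu om : ℂ) ^ 2 * (w i).1 x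
  div_w : smoothCalc.div w = 0
  rad_f : ∀ i, IsRadiating (kp la mu om) (Sm.d i f)
  rad_w : ∀ i, IsRadiating (ks mu om) (w i)

/-- Here f = -k_p⁻² div U and w = k_s⁻² curl curl U. Since curl curl = ∇ div - Δ, the Navier
equation gives U = ∇f + w; its divergence and double curl give the two Helmholtz equations. As a <
R, all of this holds near the sphere of radius R. -/
lemma exists_isDecomposition {la mu om R : ℝ} (hmu : 0 < mu) (hla : 0 < 2 * mu + 3 * la)
    (hom : 0 < om) (hR : 0 < R) {D : Set E3} (hD : IsObstacle D R) {h v : E3 → C3}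
    (hv : IsRadiatingSolution la mu om D R h v) :
    ∃ (a : ℝ) (U : Fin 3 → Sm) (f : Sm) (w : Fin 3 → Sm), 0 ≤ a ∧ a < R ∧
      Set.EqOn v (vec U) {x | a < ‖x‖} ∧ IsDecomposition la mu om a U f w := by
  obtain ⟨r, hrR, hr⟩ := exists_lt_subset_ball isClosed_closure hD.closure_subset
  obtain ⟨r1, h1, h1R⟩ := exists_between (max_lt hrR hR)
  obtain ⟨a, h1a, haR⟩ := exists_between h1R
  have hr1 : 0 < r1 := (le_max_right _ _).trans_lt h1
  have hsub : ∀ x : E3, r1 ≤ ‖x‖ → x ∈ (closure D)ᶜ := by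
    intro x hx hxD
    have h2 := hr hxD
    rw [mem_ball_zero_iff] at h2
    exact absurd (hx.trans_lt h2) (not_lt.mpr ((le_max_left _ _).trans h1.le))
  obtain ⟨U, hU⟩ := exists_smooth_extension isClosed_closure.isOpen_compl hv.smooth hr1 h1a hsub
  set O := {x : E3 | a < ‖x‖} with hO
  have hOo : IsOpen O := isOpen_norm_gt a
  have hla' : 0 < 2 * mu + la := by linarith
  have hkp : (kp la mu om) ^ 2 = om ^ 2 / (2 * mu + la) := by
    rw [kp, div_pow, Real.sq_sqrt hla'.le]
  have hks : (ks mu om) ^ 2 = om ^ 2 / mu := by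
    rw [ks, div_pow, Real.sq_sqrt hmu.le]
  have hkpC : (kp la mu om : ℂ) ^ 2 = (om : ℂ) ^ 2 / (2 * mu + la) := by exact_mod_cast hkp
  have hksC : (ks mu om : ℂ) ^ 2 = (om : ℂ) ^ 2 / mu := by exact_mod_cast hks
  have hmuC : (mu : ℂ) ≠ 0 := by exact_mod_cast hmu.ne'
  have hlaC : (2 * mu + la : ℂ) ≠ 0 := by exact_mod_cast hla'.ne'
  have homC : (om : ℂ) ≠ 0 := by exact_mod_cast hom.ne'
  set N : Fin 3 → Sm := fun i => (mu : ℂ) • smoothCalc.lap (U i)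
    + ((la + mu : ℝ) : ℂ) • smoothCalc.d i (smoothCalc.div U) + ((om ^ 2 : ℝ) : ℂ) • U i with hN
  -- The residual of the extended field may be nonzero inside, but vanishing on an open set passes
  -- to derivatives, so global identities can be applied to N.
  have hNv : ∀ i, VanishOut a (N i) := by
    intro i x hx
    have h2 := hv.navier x (hsub x (h1a.le.trans (le_of_lt hx)))
    rw [eqOn_lame hOo la mu hU hx, hU hx, lame, laplacian_vec, dvg_vec, grad_coe] at h2
    have h3 := congrArg (fun z : C3 => z i) h2
    have h4 : (mu : ℂ) * (smoothCalc.lap (U i)).1 x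
        + ((la + mu : ℝ) : ℂ) * (Sm.d i (smoothCalc.div U)).1 x
        + ((om ^ 2 : ℝ) : ℂ) * (U i).1 x = 0 := by
      simpa [vec, Complex.real_smul] using h3
    exact h4
  set q := smoothCalc.div U with hq
  set cc := smoothCalc.curl (smoothCalc.curl U) with hcc
  refine ⟨a, U, ((-((kp la mu om) ^ 2)⁻¹ : ℝ) : ℂ) • q,
    fun i => ((((ks mu om) ^ 2)⁻¹ : ℝ) : ℂ) • cc i, hr1.le.trans h1a.le, haR, hU,
    ⟨?_, ?_, ?_, ?_, ?_, ?_⟩⟩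
  · intro x hx i
    have h2 : (mu : ℂ) * (smoothCalc.lap (U i)).1 x
        + ((la + mu : ℝ) : ℂ) * (Sm.d i q).1 x
        + ((om ^ 2 : ℝ) : ℂ) * (U i).1 x = 0 := hNv i hx
    have h3 : (cc i).1 x = (Sm.d i q).1 x - (smoothCalc.lap (U i)).1 x := by
      rw [hcc, VecCalc.curl_curl]
      rfl
    rw [Derivation.map_smul]
    change _ = ((-((kp la mu om) ^ 2)⁻¹ : ℝ) : ℂ) * (Sm.d i q).1 x
      + ((((ks mu om) ^ 2)⁻¹ : ℝ) : ℂ) * (cc i).1 x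
    rw [h3]
    push_cast at h2 ⊢
    rw [hkpC, hksC]
    field_simp
    linear_combination h2
  · intro x hx
    have h2 := VanishOut.div hNv hx
    rw [hN, VecCalc.div_lame] at h2
    have h3 : ((mu : ℂ) + ((la + mu : ℝ) : ℂ)) * (smoothCalc.lap q).1 x
      + ((om ^ 2 : ℝ) : ℂ) * q.1 x = 0 := h2
    have h4 : smoothCalc.lap (((-((kp la mu om) ^ 2)⁻¹ : ℝ) : ℂ) • q)
        = ((-((kp la mu om) ^ 2)⁻¹ : ℝ) : ℂ) • smoothCalc.lap q := by
      simp only [VecCalc.lap, Derivation.map_smul, ← Finset.smul_sum]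
    rw [h4]
    change _ * (smoothCalc.lap q).1 x = _ * (_ * q.1 x)
    have h5 : (smoothCalc.lap q).1 x = -(kp la mu om : ℂ) ^ 2 * q.1 x := by
      push_cast at h3
      rw [hkpC]
      field_simp
      linear_combination h3
    rw [h5]
    ring
  · intro i x hx
    have h2 := VanishOut.curl (VanishOut.curl hNv) i hx
    rw [hN, VecCalc.curl_curl_lame] at h2
    have h3 : (mu : ℂ) * (smoothCalc.lap (cc i)).1 x + ((om ^ 2 : ℝ) : ℂ) * (cc i).1 x = 0 := h2
    have h4 : smoothCalc.lap (((((ks mu om) ^ 2)⁻¹ : ℝ) : ℂ) • cc i)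
        = ((((ks mu om) ^ 2)⁻¹ : ℝ) : ℂ) • smoothCalc.lap (cc i) := by
      simp only [VecCalc.lap, Derivation.map_smul, ← Finset.smul_sum]
    rw [h4]
    change _ * (smoothCalc.lap (cc i)).1 x = _ * (_ * (cc i).1 x)
    have h5 : (smoothCalc.lap (cc i)).1 x = -(ks mu om : ℂ) ^ 2 * (cc i).1 x := by
      push_cast at h3
      rw [hksC]
      field_simp
      linear_combination h3
    rw [h5]
    ring
  · have h2 : smoothCalc.div (fun i => ((((ks mu om) ^ 2)⁻¹ : ℝ) : ℂ) • cc i)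
        = ((((ks mu om) ^ 2)⁻¹ : ℝ) : ℂ) • smoothCalc.div cc := by
      simp only [VecCalc.div, Derivation.map_smul, ← Finset.smul_sum]
    rw [h2, hcc, VecCalc.div_curl, smul_zero]
  · intro i
    refine isRadiating_of_sommerfeld (a := a)
      (g := fun i => Sm.d i (((-((kp la mu om) ^ 2)⁻¹ : ℝ) : ℂ) • q)) hv.radiation.1 ?_ i
    intro x hx
    rw [pPart, eqOn_grad hOo (eqOn_dvg hOo hU) hx, dvg_vec, grad_coe]
    ext i
    simp only [Derivation.map_smul]
    change -(((kp la mu om) ^ 2)⁻¹ • (Sm.d i q).1 x)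
      = ((-((kp la mu om) ^ 2)⁻¹ : ℝ) : ℂ) * (Sm.d i q).1 x
    rw [Complex.real_smul]
    push_cast
    ring
  · intro i
    refine isRadiating_of_sommerfeld (a := a)
      (g := fun i => ((((ks mu om) ^ 2)⁻¹ : ℝ) : ℂ) • cc i) hv.radiation.2 ?_ i
    intro x hx
    rw [sPart, eqOn_curl hOo (eqOn_curl hOo hU) hx, curl_vec, curl_vec]
    ext i
    change ((ks mu om) ^ 2)⁻¹ • (cc i).1 x = ((((ks mu om) ^ 2)⁻¹ : ℝ) : ℂ) * (cc i).1 x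
    rw [Complex.real_smul]

end ElasticOtI

namespace ElasticOtI

/-! ### Coefficients of radiating elastic fields -/

lemma inner_vshL_emb (p : ℕ → ℤ → Poly) (n : ℕ) (m : ℤ) (j : Fin 3) (u : Fin 3 → Sm) (r : ℝ) :
    inner ℂ (vshL p n m j) (emb u r)
      = ∑ i, coef (u i) (vsh n (polyFun (pconj (p n m))) j i) r := by
  rw [vshL, inner_emb_emb]
  simp only [cj_vsh_polyFun]

/-- A gradient has no toroidal component, since L · ∇ = 0. -/
lemma sum_coef_grad_ang (f q : Sm) (r : ℝ) :
    ∑ i, coef (Sm.d i f) (smoothCalc.ang i q) r = 0 := by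
  have h : ∀ i, coef (Sm.d i f) (smoothCalc.ang i q) r
      = -coef (smoothCalc.ang i (Sm.d i f)) q r := fun i => by rw [coef_ang, neg_neg]
  simp only [h]
  rw [Finset.sum_neg_distrib, ← coef_sum_left]
  have h2 : ∑ i, smoothCalc.ang i (Sm.d i f) = 0 := smoothCalc.sum_ang_d f
  rw [h2, coef_zero_left, neg_zero]

lemma sum_coef_grad_xcross {n : ℕ} {p : Poly} (hp : IsHarm n p) (f : Sm) (r : ℝ) :
    (r : ℂ) * ∑ i, coef (Sm.d i f)
      (smoothCalc.xcross (fun a => smoothCalc.ang a (polyFun p)) i) r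
      = -((n : ℂ) * (n + 1) * coef f (polyFun p) r) := by
  rw [coef_xcross, ← coef_ang_ang hp]
  rfl

lemma sum_coef_vsh_zero (u : Fin 3 → Sm) (n : ℕ) (q : Sm) (r : ℝ) :
    ∑ i, coef (u i) (vsh n q 0 i) r
      = (sqrtDelta n : ℂ)⁻¹ * ∑ i, coef (u i) (smoothCalc.ang i q) r := by
  rw [Finset.mul_sum]
  exact Finset.sum_congr rfl fun i _ => coef_smul_right _ _ _ _

lemma sum_coef_vsh_one (u : Fin 3 → Sm) (n : ℕ) (q : Sm) (r : ℝ) :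
    ∑ i, coef (u i) (vsh n q 1 i) r = -(sqrtDelta n : ℂ)⁻¹ *
      ∑ i, coef (u i) (smoothCalc.xcross (fun a => smoothCalc.ang a q) i) r := by
  rw [Finset.mul_sum]
  exact Finset.sum_congr rfl fun i _ => coef_smul_right _ _ _ _

lemma sum_coef_vsh_two (u : Fin 3 → Sm) (n : ℕ) (q : Sm) {r : ℝ} (hr : 0 < r) :
    ∑ i, coef (u i) (vsh n q 2 i) r = coef (smoothCalc.xdot u) q r / r := by
  have hrc : (r : ℂ) ≠ 0 := by exact_mod_cast hr.ne'
  rw [← coef_mul_X, mul_div_cancel_left₀ _ hrc]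
  rfl

/-- The coefficients of the shear part. -/
lemma IsDecomposition.exists_coef_shear {la mu om a : ℝ} {U : Fin 3 → Sm} {f : Sm}
    {w : Fin 3 → Sm} (hdec : IsDecomposition la mu om a U f w) (ha : 0 ≤ a) (hk : 0 < ks mu om)
    {p : ℕ → ℤ → Poly} (hp : HarmSystem p) {n : ℕ} {m : ℤ} (hm : m ∈ Finset.Icc (-(n : ℤ)) n) :
    ∃ α β : ℂ, ∀ r, a < r →
      inner ℂ (vshL p n m 0) (emb w r) = hankelS (ks mu om) n r * α ∧
      inner ℂ (vshL p n m 1) (emb w r)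
        = -(hankelS (ks mu om) n r + hankelS1 (ks mu om) n r) / r * β ∧
      inner ℂ (vshL p n m 2) (emb w r) = -(sqrtDelta n * hankelS (ks mu om) n r) / r * β := by
  set q := pconj (p n m) with hq
  have hh : IsHarm n q := (hp.harm n m hm).pconj
  -- Each angular derivative of q is again harmonic of degree n, so the Cartesian components of w
  -- can be treated as scalars.
  have hB : ∀ i, ∃ β : ℂ, ∀ r, a < r → coef (w i) (smoothCalc.ang i (polyFun q)) r
      = β * hankelS (ks mu om) n r := fun i => by
    have h := exists_coef_eq_hankelS hk ha (hdec.lap_w i) (hdec.rad_w i) (hh.ang i)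
    rwa [polyFun_compat.ang] at h
  choose b hb using hB
  obtain ⟨γ, hγ⟩ := exists_coef_xdot_eq hk ha hdec.lap_w hdec.div_w hdec.rad_w hh
  refine ⟨(sqrtDelta n : ℂ)⁻¹ * ∑ i, b i, -(sqrtDelta n : ℂ)⁻¹ * γ, fun r hr => ?_⟩
  have hr0 : 0 < r := ha.trans_lt hr
  have hrc : (r : ℂ) ≠ 0 := by exact_mod_cast hr0.ne'
  obtain ⟨g0, g1⟩ := hγ r hr
  have hX := sum_coef_xcross_ang hdec.div_w (polyFun q) r
  rw [g0, g1] at hX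
  simp only [inner_vshL_emb, ← hq]
  refine ⟨?_, ?_, ?_⟩
  · rw [sum_coef_vsh_zero]
    simp only [hb _ r hr]
    rw [← Finset.sum_mul]
    ring
  · rw [sum_coef_vsh_one]
    have h2 : ∑ i, coef (w i) (smoothCalc.xcross (fun a => smoothCalc.ang a (polyFun q)) i) r
        = -(γ * hankelS (ks mu om) n r + γ * hankelS1 (ks mu om) n r) / r := by
      rw [← hX, mul_div_cancel_left₀ _ hrc]
    rw [h2]
    ring
  · rw [sum_coef_vsh_two _ _ _ hr0, g0]
    -- For n = 0 the asserted W coefficient is 0, so γ must vanish: the tangential test field is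
    -- zero, which gives γ (h + r h') = 0, and h + r h' ≠ 0 by the sign of the flux.
    rcases eq_or_ne n 0 with rfl | hn
    · have hz : ∀ i, smoothCalc.xcross (fun a => smoothCalc.ang a (polyFun q)) i = 0 := fun i => by
        simp [VecCalc.xcross, polyFun_ang_zero hh]
      simp only [hz, coef_zero_right, Finset.sum_const_zero, mul_zero] at hX
      have hS : hankelS (ks mu om) 0 r + hankelS1 (ks mu om) 0 r ≠ 0 := by
        intro h0
        have h1 := hankelS_im_pos hk 0 hr0
        have h2 : hankelS1 (ks mu om) 0 r = -hankelS (ks mu om) 0 r := by linear_combination h0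
        rw [h2, neg_mul, Complex.mul_conj] at h1
        simp at h1
      have hγ0 : γ = 0 := by
        have h3 : γ * (hankelS (ks mu om) 0 r + hankelS1 (ks mu om) 0 r) = 0 := by
          linear_combination hX
        exact (mul_eq_zero.mp h3).resolve_right hS
      rw [hγ0]
      simp
    · have := sqrtDelta_ne_zero hn
      field_simp

/-- The coefficients of the compressional part. -/
lemma IsDecomposition.exists_coef_compressional {la mu om a : ℝ} {U : Fin 3 → Sm} {f : Sm}
    {w : Fin 3 → Sm} (hdec : IsDecomposition la mu om a U f w) (ha : 0 ≤ a)
    (hk : 0 < kp la mu om) {p : ℕ → ℤ → Poly} (hp : HarmSystem p) {n : ℕ} {m : ℤ}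
    (hm : m ∈ Finset.Icc (-(n : ℤ)) n) :
    ∃ β : ℂ, ∀ r, a < r →
      inner ℂ (vshL p n m 0) (emb (fun i => Sm.d i f) r) = 0 ∧
      inner ℂ (vshL p n m 1) (emb (fun i => Sm.d i f) r)
        = sqrtDelta n * hankelS (kp la mu om) n r / r * β ∧
      inner ℂ (vshL p n m 2) (emb (fun i => Sm.d i f) r)
        = hankelS1 (kp la mu om) n r / r * β := by
  set q := pconj (p n m) with hq
  have hh : IsHarm n q := (hp.harm n m hm).pconj
  obtain ⟨β, hβ⟩ := exists_coef_eq_of_grad hk ha hdec.lap_f hdec.rad_f hh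
  refine ⟨β, fun r hr => ?_⟩
  have hr0 : 0 < r := ha.trans_lt hr
  have hrc : (r : ℂ) ≠ 0 := by exact_mod_cast hr0.ne'
  obtain ⟨g0, g1⟩ := hβ r hr
  simp only [inner_vshL_emb, ← hq]
  refine ⟨?_, ?_, ?_⟩
  · rw [sum_coef_vsh_zero, sum_coef_grad_ang, mul_zero]
  · have hX := sum_coef_grad_xcross hh f r
    rw [g0, ← sqrtDelta_sq] at hX
    rw [sum_coef_vsh_one]
    have h2 : ∑ i, coef (Sm.d i f)
        (smoothCalc.xcross (fun a => smoothCalc.ang a (polyFun q)) i) r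
        = -((sqrtDelta n : ℂ) ^ 2 * (β * hankelS (kp la mu om) n r)) / r := by
      rw [← hX, mul_div_cancel_left₀ _ hrc]
    rw [h2]
    rcases eq_or_ne n 0 with rfl | hn
    · simp [sqrtDelta_zero]
    · have := sqrtDelta_ne_zero hn
      field_simp
  · rw [sum_coef_vsh_two _ _ _ hr0]
    have : smoothCalc.xdot (fun i => Sm.d i f) = smoothCalc.eul f := rfl
    rw [this, g1]
    ring

lemma IsDecomposition.inner_emb {la mu om a : ℝ} {U : Fin 3 → Sm} {f : Sm}
    {w : Fin 3 → Sm} (hdec : IsDecomposition la mu om a U f w) (ha : 0 ≤ a) (p : ℕ → ℤ → Poly)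
    (n : ℕ) (m : ℤ) (j : Fin 3) {r : ℝ} (hr : a < r) :
    inner ℂ (vshL p n m j) (emb U r) = inner ℂ (vshL p n m j) (emb (fun i => Sm.d i f) r)
      + inner ℂ (vshL p n m j) (emb w r) := by
  simp only [inner_vshL_emb, ← Finset.sum_add_distrib, ← coef_add_left]
  refine Finset.sum_congr rfl fun i _ => coef_congr fun y => ?_
  have hy : a < ‖r • (y : E3)‖ := by rwa [norm_smul_sphere (ha.trans hr.le)]
  rw [hdec.eq _ hy i]
  rfl

/-- Conjugating x and z may destroy cancellation in x b + z c, but it preserves the modulus of each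
product. -/
lemma norm_conj_mul_add_sq_le (x b z c : ℂ) :
    ‖conj x * b + conj z * c‖ ^ 2 ≤ 2 * ‖x * b‖ ^ 2 + 2 * ‖z * c‖ ^ 2 := by
  have h := norm_add_le (conj x * b) (conj z * c)
  simp only [norm_mul, RCLike.norm_conj] at h ⊢
  nlinarith [sq_nonneg (‖x‖ * ‖b‖ - ‖z‖ * ‖c‖), norm_nonneg (conj x * b + conj z * c)]

/-- The outgoing expansion of a radiating elastic field, and the square summability of the
incoming expansion with the same coefficients. -/
lemma IsDecomposition.exists_expansion {la mu om a : ℝ} (hmu : 0 < mu) (hla : 0 < 2 * mu + 3 * la)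
    (hom : 0 < om) {U : Fin 3 → Sm} {f : Sm} {w : Fin 3 → Sm}
    (hdec : IsDecomposition la mu om a U f w) (ha : 0 ≤ a) {p : ℕ → ℤ → Poly} (hp : HarmSystem p) :
    ∃ α : ℕ → ℤ → Fin 3 → ℂ, ∀ r, a < r →
      (∀ n : ℕ, ∀ m ∈ Finset.Icc (-(n : ℤ)) n, ∀ j,
        inner ℂ (vshL p n m j) (emb U r) = (matA la mu om n r *ᵥ α n m) j) ∧
      ∃ g : HS, ∀ n : ℕ, ∀ m ∈ Finset.Icc (-(n : ℤ)) n, ∀ j, (n = 0 → j = 2) →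
        inner ℂ (vshL p n m j) g = -(conjM (matA la mu om n r) *ᵥ α n m) j := by
  have hs := fun (n : ℕ) (m : ℤ) (hm : m ∈ Finset.Icc (-(n : ℤ)) n) =>
    hdec.exists_coef_shear ha (ks_pos hmu hom) hp hm
  have hc := fun (n : ℕ) (m : ℤ) (hm : m ∈ Finset.Icc (-(n : ℤ)) n) =>
    hdec.exists_coef_compressional ha (kp_pos hmu hla hom) hp hm
  choose α β hαβ using hs
  choose γ hγ using hc
  classical
  let c : ℕ → ℤ → Fin 3 → ℂ := fun n m =>
    if hm : m ∈ Finset.Icc (-(n : ℤ)) n then ![α n m hm, β n m hm, γ n m hm] else 0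
  refine ⟨c, fun r hr => ⟨fun n m hm j => ?_, ?_⟩⟩
  · have hr0 : 0 < r := ha.trans_lt hr
    obtain ⟨s0, s1, s2⟩ := hαβ n m hm r hr
    obtain ⟨c0, c1, c2⟩ := hγ n m hm r hr
    rw [hdec.inner_emb ha p n m j hr, matA_eq hmu hla hom n hr0]
    simp only [c, dif_pos hm]
    fin_cases j
    · simp [Matrix.mulVec, dotProduct, Fin.sum_univ_three, s0, c0]
    · simp [Matrix.mulVec, dotProduct, Fin.sum_univ_three, s1, c1, add_comm]
    · simp [Matrix.mulVec, dotProduct, Fin.sum_univ_three, s2, c2, add_comm]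
  · have hr0 : 0 < r := ha.trans_lt hr
    -- An incoming coefficient is bounded by the coefficients of w and ∇f on the same sphere, and
    -- both families are square summable by Bessel's inequality.
    have hle : ∀ i : VIdx, ‖-(conjM (matA la mu om i.1.1 r) *ᵥ c i.1.1 i.1.2.1) i.1.2.2‖ ^ 2
        ≤ 2 * ‖inner ℂ (vshB p i) (emb w r)‖ ^ 2
          + 2 * ‖inner ℂ (vshB p i) (emb (fun i => Sm.d i f) r)‖ ^ 2 := by
      rintro ⟨⟨n, m, j⟩, hm, hj⟩
      have hm : m ∈ Finset.Icc (-(n : ℤ)) n := hm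
      obtain ⟨s0, s1, s2⟩ := hαβ n m hm r hr
      obtain ⟨c0, c1, c2⟩ := hγ n m hm r hr
      rw [norm_neg, matA_eq hmu hla hom n hr0]
      simp only [vshB, c, dif_pos hm]
      clear hj
      fin_cases j
      · have := norm_conj_mul_add_sq_le (x := hankelS (ks mu om) n r) (b := α n m hm) (z := 0) (c := 0)
         
        simpa [conjM, Matrix.mulVec, dotProduct, Fin.sum_univ_three, s0, c0] using this
      · have := norm_conj_mul_add_sq_le
          (x := -(hankelS (ks mu om) n r + hankelS1 (ks mu om) n r) / r) (b := β n m hm)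
          (z := sqrtDelta n * hankelS (kp la mu om) n r / r) (c := γ n m hm)
        rw [← s1, ← c1] at this
        simpa [conjM, Matrix.mulVec, dotProduct, Fin.sum_univ_three] using this
      · have := norm_conj_mul_add_sq_le
          (x := -(sqrtDelta n * hankelS (ks mu om) n r) / r) (b := β n m hm)
          (z := hankelS1 (kp la mu om) n r / r) (c := γ n m hm)
        rw [← s2, ← c2] at this
        simpa [conjM, Matrix.mulVec, dotProduct, Fin.sum_univ_three] using this
    have hsum : Summable fun i : VIdx =>
        ‖-(conjM (matA la mu om i.1.1 r) *ᵥ c i.1.1 i.1.2.1) i.1.2.2‖ ^ 2 :=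
      Summable.of_nonneg_of_le (fun _ => by positivity) hle
        (((summable_inner_vshB hp _).mul_left 2).add ((summable_inner_vshB hp _).mul_left 2))
    obtain ⟨g, hg⟩ := exists_inner_vshB_eq hp hsum
    exact ⟨g, fun n m hm j hj => hg ⟨(n, m, j), hm, hj⟩⟩

end ElasticOtI

namespace ElasticOtI

/-! ### The outgoing-to-incoming mapping -/

lemma coeFn_outTerm {la mu om : ℝ} {Y : ℕ → ℤ → E3 → ℂ} {p : ℕ → ℤ → Poly}
    (hY : IsPolySystem Y p) (α : ℕ → ℤ → Fin 3 → ℂ) {r : ℝ} (hr : 0 < r) (n : ℕ) :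
    vshSum p (fun n m => matA la mu om n r *ᵥ α n m) n
      =ᵐ[sigma2] fun y => outTerm la mu om Y α n (r • (y : E3)) := by
  filter_upwards [coeFn_vshSum hY (fun n m => matA la mu om n r *ᵥ α n m) n] with y hy
  rw [hy, outTerm, unitVec_smul hr, norm_smul_sphere hr.le]

lemma coeFn_inTerm {la mu om : ℝ} {Y : ℕ → ℤ → E3 → ℂ} {p : ℕ → ℤ → Poly}
    (hY : IsPolySystem Y p) (α : ℕ → ℤ → Fin 3 → ℂ) {r : ℝ} (hr : 0 < r) (n : ℕ) :
    vshSum p (fun n m => -(conjM (matA la mu om n r) *ᵥ α n m)) n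
      =ᵐ[sigma2] fun y => inTerm la mu om Y α n (r • (y : E3)) := by
  filter_upwards [coeFn_vshSum hY (fun n m => -(conjM (matA la mu om n r) *ᵥ α n m)) n] with y hy
  rw [hy, inTerm, unitVec_smul hr, norm_smul_sphere hr.le]
  simp only [Matrix.mulVec_neg, Finset.sum_neg_distrib]

lemma coeFn_otiTerm {la mu om : ℝ} {Y : ℕ → ℤ → E3 → ℂ} {p : ℕ → ℤ → Poly}
    (hY : IsPolySystem Y p) {R : ℝ} (hR : 0 < R) {φ : E3 → C3} {g : HS}
    (hg : g =ᵐ[sigma2] fun y => φ (R • (y : E3))) (n : ℕ) :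
    vshSum p (fun n m => -((conjM (matA la mu om n R) * (matA la mu om n R)⁻¹) *ᵥ
        fun j => inner ℂ (vshL p n m j) g)) n
      =ᵐ[sigma2] fun y => otiTerm la mu om R Y φ n (R • (y : E3)) := by
  have hRc : (R : ℂ) ^ 2 ≠ 0 := pow_ne_zero 2 (by exact_mod_cast hR.ne')
  filter_upwards [coeFn_vshSum hY (fun n m => -((conjM (matA la mu om n R) *
    (matA la mu om n R)⁻¹) *ᵥ fun j => inner ℂ (vshL p n m j) g)) n] with y hy
  rw [hy, otiTerm, unitVec_smul hR, Finset.smul_sum]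
  congr 1
  refine Finset.sum_congr rfl fun m hm => ?_
  rw [integral_vshM hY hR hg hm]
  have h : (fun j => (R : ℂ) ^ 2 * inner ℂ (vshL p n m j) g)
      = ((R : ℂ) ^ 2) • fun j => inner ℂ (vshL p n m j) g := rfl
  rw [h, Matrix.mulVec_smul, Matrix.mulVec_smul, smul_smul, neg_mul, inv_mul_cancel₀ hRc, neg_smul,
    one_smul, Matrix.mulVec_neg]

/-- The visible coefficients of φ are A_n α except that at n = 0 the first two are lost. As A_0 is
diagonal, discarding them amounts to discarding the same entries of α, which do not affect the
third. -/
lemma conjM_mul_inv_mulVec {la mu om : ℝ} (hmu : 0 < mu) (hla : 0 < 2 * mu + 3 * la)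
    (hom : 0 < om) {n : ℕ} {r : ℝ} (hr : 0 < r) (α : Fin 3 → ℂ) {j : Fin 3} (hj : n = 0 → j = 2) :
    ((conjM (matA la mu om n r) * (matA la mu om n r)⁻¹) *ᵥ
      fun j => if n = 0 → j = 2 then (matA la mu om n r *ᵥ α) j else 0) j
      = (conjM (matA la mu om n r) *ᵥ α) j := by
  have hdet := (Matrix.isUnit_iff_isUnit_det _).mp (isUnit_matA hmu hla hom n hr)
  set β : Fin 3 → ℂ := fun j => if n = 0 → j = 2 then α j else 0 with hβ
  have h1 : (fun j => if n = 0 → j = 2 then (matA la mu om n r *ᵥ α) j else 0)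
      = matA la mu om n r *ᵥ β := by
    rcases eq_or_ne n 0 with rfl | hn
    · rw [matA_eq hmu hla hom 0 hr]
      funext i
      fin_cases i <;>
        simp [hβ, Matrix.mulVec, dotProduct, Fin.sum_univ_three, sqrtDelta_zero]
    · simp [hβ, hn]
  have h2 : (conjM (matA la mu om n r) *ᵥ β) j = (conjM (matA la mu om n r) *ᵥ α) j := by
    rcases eq_or_ne n 0 with rfl | hn
    · obtain rfl := hj rfl
      rw [matA_eq hmu hla hom 0 hr]
      simp [hβ, conjM, Matrix.mulVec, dotProduct, Fin.sum_univ_three, sqrtDelta_zero]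
    · simp [hβ, hn]
  rw [h1, ← Matrix.mulVec_mulVec, Matrix.mulVec_mulVec β, Matrix.nonsing_inv_mul _ hdet,
    Matrix.one_mulVec, h2]

/-- Every restriction of a radiating solution has an image. -/
lemma exists_otiGraph {la mu om R : ℝ} (hmu : 0 < mu) (hla : 0 < 2 * mu + 3 * la) (hom : 0 < om)
    (hR : 0 < R) {D : Set E3} (hD : IsObstacle D R) {Y : ℕ → ℤ → E3 → ℂ} {p : ℕ → ℤ → Poly}
    (hp : HarmSystem p) (hY : IsPolySystem Y p) {φ : L2S R} (hφ : φ ∈ rangeG la mu om D R) :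
    ∃ ψ, OtIGraph la mu om D R Y φ ψ := by
  obtain ⟨h, u, hu⟩ := hφ
  obtain ⟨a, U, f, w, ha, haR, hU, hdec⟩ := exists_isDecomposition hmu hla hom hR hD hu.2.1
  obtain ⟨α, hα⟩ := hdec.exists_expansion hmu hla hom ha hp
  obtain ⟨g, hg⟩ := (hα R haR).2
  obtain ⟨ψ, hψ⟩ := exists_ae_eq_dilate hR g
  refine ⟨ψ, h, u, α, hu, fun r hr => ?_, ?_⟩
  · have hr0 : 0 < r := hR.trans_le hr
    have har : a < r := haR.trans_le hr
    refine (hasL2Sum_iff (Ψ := emb U r) hr0 (coeFn_outTerm hY α hr0) ?_).mpr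
      (tendsto_vshSum hp fun n m hm j _ => (hα r har).1 n m hm j)
    filter_upwards [coeFn_emb U r] with y hy
    have hyr : a < ‖r • (y : E3)‖ := by rwa [norm_smul_sphere hr0.le]
    rw [hy, hU hyr]
    rfl
  · exact (hasL2Sum_iff hR (coeFn_inTerm hY α hR) hψ.symm).mpr (tendsto_vshSum hp hg)

/-- Every image is given by the series. -/
lemma OtIGraph.hasL2Sum {la mu om R : ℝ} (hmu : 0 < mu) (hla : 0 < 2 * mu + 3 * la) (hom : 0 < om)
    (hR : 0 < R) {D : Set E3} {Y : ℕ → ℤ → E3 → ℂ} {p : ℕ → ℤ → Poly}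
    (hp : HarmSystem p) (hY : IsPolySystem Y p) {φ ψ : L2S R}
    (h : OtIGraph la mu om D R Y φ ψ) : HasL2Sum R (otiTerm la mu om R Y φ) ψ := by
  obtain ⟨b, u, α, hu, hout, hin⟩ := h
  obtain ⟨gφ, hgφ⟩ := exists_pullback hR φ
  obtain ⟨gψ, hgψ⟩ := exists_pullback hR ψ
  have hgu : gφ =ᵐ[sigma2] fun y => u (R • (y : E3)) := by
    filter_upwards [hgφ, (ae_sphereMeasure_iff hR).mp hu.2.2] with y h1 h2
    rw [h1, h2]
  have h1 := (hasL2Sum_iff hR (coeFn_outTerm hY α hR) hgu).mp (hout R le_rfl)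
  have h2 := (hasL2Sum_iff hR (coeFn_inTerm hY α hR) hgψ).mp hin
  refine (hasL2Sum_iff hR (coeFn_otiTerm hY hR hgφ) hgψ).mpr (h2.congr fun N => ?_)
  refine Finset.sum_congr rfl fun n _ => vshSum_congr fun m hm j hj => ?_
  -- The outgoing expansion at r = R already fixes the coefficients of φ, whichever solution and α
  -- were chosen.
  have hc : (fun j => inner ℂ (vshL p n m j) gφ)
      = fun j => if n = 0 → j = 2 then (matA la mu om n R *ᵥ α n m) j else 0 :=
    funext fun j => inner_vshL_of_tendsto hp h1 hm j
  rw [hc, Pi.neg_apply, Pi.neg_apply, conjM_mul_inv_mulVec hmu hla hom hR _ hj]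

/-- The sum of the series is unique. -/
lemma eq_of_hasL2Sum_otiTerm {la mu om R : ℝ} (hR : 0 < R) {Y : ℕ → ℤ → E3 → ℂ}
    {p : ℕ → ℤ → Poly} (hY : IsPolySystem Y p) {φ ψ ψ' : L2S R}
    (h : HasL2Sum R (otiTerm la mu om R Y φ) ψ) (h' : HasL2Sum R (otiTerm la mu om R Y φ) ψ') :
    ψ = ψ' := by
  obtain ⟨gφ, hgφ⟩ := exists_pullback hR φ
  obtain ⟨g, hg⟩ := exists_pullback hR ψ
  obtain ⟨g', hg'⟩ := exists_pullback hR ψ'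
  have he := tendsto_nhds_unique ((hasL2Sum_iff hR (coeFn_otiTerm hY hR hgφ) hg).mp h)
    ((hasL2Sum_iff hR (coeFn_otiTerm hY hR hgφ) hg').mp h')
  subst he
  refine Lp.ext ((ae_sphereMeasure_iff hR).mpr ?_)
  filter_upwards [hg, hg'] with y h1 h2
  rw [← h1, ← h2]

end ElasticOtI

theorem mainTheorem7 (la mu om R : ℝ) (hmu : 0 < mu) (hla : 0 < 2 * mu + 3 * la) (hom : 0 < om)
    (hR : 0 < R) (D : Set ElasticOtI.E3) (hD : ElasticOtI.IsObstacle D R)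
    (Y : ℕ → ℤ → ElasticOtI.E3 → ℂ) (hY : ElasticOtI.IsSphericalHarmonicSystem Y) :
    (∀ n : ℕ, IsUnit (ElasticOtI.matA la mu om n R)) ∧
    ∃ T : ElasticOtI.rangeG la mu om D R → ElasticOtI.L2S R,
      (∀ (φ : ElasticOtI.rangeG la mu om D R) (ψ : ElasticOtI.L2S R),
        ElasticOtI.OtIGraph la mu om D R Y φ ψ ↔ T φ = ψ) ∧
      ∀ φ : ElasticOtI.rangeG la mu om D R,
        ElasticOtI.HasL2Sum R
          (ElasticOtI.otiTerm la mu om R Y (φ : ElasticOtI.L2S R)) (T φ) := by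
  refine ⟨fun n => ElasticOtI.isUnit_matA hmu hla hom n hR, ?_⟩
  obtain ⟨p, hp, hYp⟩ := ElasticOtI.exists_isPolySystem hY
  choose T hT using fun φ : ElasticOtI.rangeG la mu om D R =>
    ElasticOtI.exists_otiGraph hmu hla hom hR hD hp hYp φ.2
  refine ⟨T, fun φ ψ => ⟨fun h => ?_, ?_⟩, fun φ => (hT φ).hasL2Sum hmu hla hom hR hp hYp⟩
  -- Both the chosen image and any other are sums of the same series in φ.
  · exact ElasticOtI.eq_of_hasL2Sum_otiTerm hR hYp ((hT φ).hasL2Sum hmu hla hom hR hp hYp)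
      (h.hasL2Sum hmu hla hom hR hp hYp)
  · rintro rfl
    exact hT φ
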